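/- Let $(\Omega,\mathcal F)$ be a standard Borel space, $T:\Omega\to\Omega$ measurable, $\mu$ a $T$-invariant probability measure, and $\mathcal A$ a finite measurable partition of $\Omega$. Write $\mathcal A^n=\bigvee_{j=0}^{n-1}T^{-j}\mathcal A$, let $A_n(x)$ be the atom of $\mathcal A^n$ containing $x$, and assume that $\mathcal A$ is generating, i.e. the atoms of $\bigvee_{j\ge 0}T^{-j}\mathcal A$ are single points. Assume that $\mu$ is uniformly strong mixing with respect to $\mathcal A$: there is a decreasing function $\psi:\mathbb N\to[0,\infty)$ with $\psi(\Delta)\to0$ such that $$\Bigl|\sum_{(B,C)\in S}\bigl(\mu(B\cap C)-\mu(B)\mu(C)\bigr)\Bigr|\le\psi(\Delta)$$ for all $n,m,\Delta>0$ and every $S\subset\mathcal A^n\times T^{-\Delta-n}\mathcal A^m$. Assume that $\psi(\Delta)=O(\Delta^{-p})$ for some real $p>8$. Put $K_w(\mathcal A^n)=\sum_{A\in\mathcal A^n}\mu(A)|\log\mu(A)|^w$ and $H(\mathcal A^n)=K_1(\mathcal A^n)$, and let $h$ be the metric (Kolmogorov--Sinai) entropy of $(T,\mu)$, which is finite. Then: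 (I) The limit $\sigma^2=\lim_{n\to\infty}\frac1n\bigl(K_2(\mathcal A^n)-H(\mathcal A^n)^2\bigr)$ exists in $[0,\infty)$. (II) Suppose $\sigma>0$, and put $\Xi_n(t)=\mu\bigl\{x\in\Omega:\frac{-\log\mu(A_n(x))-nh}{\sigma\sqrt n}\le t\bigr\}$ and $N(t)=\frac1{\sqrt{2\pi}}\int_{-\infty}^te^{-s^2/2}\,ds$. Then for every $\kappa<\frac1{10}-\frac3{5(p+2)}$ there is a constant $C$ with $|\Xi_n(t)-N(t)|\le C\,n^{-\kappa}$ for all $n\ge1$ and all $t\in\mathbb R$. If $\psi$ decays hyper-polynomially, i.e. $\psi(\Delta)=O(\Delta^{-q})$ for every $q$, the same holds for every $\kappa<\frac1{10}$. -/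

import Mathlib

open MeasureTheory Filter Topology Asymptotics
open scoped ENNReal

noncomputable section

namespace InfoCLT

variable {Ω ι : Type*}

/-! A finite partition of `Ω` is given by its labelling map `P : Ω → ι` with `ι` finite: its atoms
are the sets `P ⁻¹' {i}`, and it is measurable when `P` is. Labels with an empty atom are harmless,
because every quantity below gives weight zero to empty sets. -/

/-- The `n`-cylinder with word `w`, i.e. the set `⋂ j < n, T^{-j} (P ⁻¹' {w j})`. For varying `w`
these sets are the atoms of the `n`-th join of the partition. -/
def joinCylinder (T : Ω → Ω) (P : Ω → ι) (n : ℕ) (w : Fin n → ι) : Set Ω :=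
  {x | ∀ j : Fin n, P (T^[(j : ℕ)] x) = w j}

/-- The `n`-cylinder `A_n(x)` that contains the point `x`. -/
def cylinderAt (T : Ω → Ω) (P : Ω → ι) (n : ℕ) (x : Ω) : Set Ω :=
  joinCylinder T P n fun j => P (T^[(j : ℕ)] x)

/-- The partition is generating: the atoms of its infinite join under `T` are single points. -/
def IsGenerating (T : Ω → Ω) (P : Ω → ι) : Prop :=
  ∀ x : Ω, {y | ∀ j : ℕ, P (T^[j] y) = P (T^[j] x)} = {x}

/-- `μ` is uniformly strong mixing with rate `ψ` with respect to the finite partition `P`: the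
function `ψ` is decreasing with limit zero (so it is nonnegative), and the sum of
`μ (B ∩ C) - μ B * μ C` over any set of pairs of an `n`-cylinder `B` and the preimage `C` under
`T ^ (Δ + n)` of an `m`-cylinder is at most `ψ Δ` in absolute value. -/
structure IsUniformlyStrongMixing [MeasurableSpace Ω] (T : Ω → Ω) (μ : Measure Ω) (P : Ω → ι)
    (ψ : ℕ → ℝ) : Prop where
  antitone : Antitone ψ
  tendsto_zero : Tendsto ψ atTop (𝓝 0)
  mixing : ∀ n m Δ : ℕ, 0 < n → 0 < m → 0 < Δ → ∀ S : Finset ((Fin n → ι) × (Fin m → ι)),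
    |∑ s ∈ S, (μ.real (joinCylinder T P n s.1 ∩ T^[Δ + n] ⁻¹' joinCylinder T P m s.2) -
      μ.real (joinCylinder T P n s.1) * μ.real (T^[Δ + n] ⁻¹' joinCylinder T P m s.2))| ≤ ψ Δ

/-- The moment `K_q = ∑ μ(A) |log μ(A)|^q` of the `n`-th join of the partition; null cylinders
contribute zero. -/
def infoMoment [MeasurableSpace Ω] [Fintype ι] (T : Ω → Ω) (μ : Measure Ω) (P : Ω → ι)
    (q : ℝ) (n : ℕ) : ℝ :=
  ∑ w : Fin n → ι, μ.real (joinCylinder T P n w) * |Real.log (μ.real (joinCylinder T P n w))| ^ q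

/-- The Shannon entropy of the `n`-th join of the partition. -/
def joinEntropy [MeasurableSpace Ω] [Fintype ι] (T : Ω → Ω) (μ : Measure Ω) (P : Ω → ι)
    (n : ℕ) : ℝ :=
  infoMoment T μ P 1 n

/-- The entropy of `T` relative to the partition. For an invariant probability measure the
sequence converges, so that the `limsup` is a limit. -/
def partitionEntropy [MeasurableSpace Ω] [Fintype ι] (T : Ω → Ω) (μ : Measure Ω)
    (P : Ω → ι) : ℝ≥0∞ :=
  limsup (fun n : ℕ => ENNReal.ofReal (joinEntropy T μ P n / n)) atTop

/-- The metric (Kolmogorov–Sinai) entropy: the supremum of the entropies relative to all finite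
measurable partitions. -/
def metricEntropy [MeasurableSpace Ω] (T : Ω → Ω) (μ : Measure Ω) : ℝ≥0∞ :=
  ⨆ (k : ℕ) (Q : Ω → Fin k) (_ : Measurable Q), partitionEntropy T μ Q

/-- The information function `I_n(x) = -log μ(A_n(x))`. -/
def information [MeasurableSpace Ω] (T : Ω → Ω) (μ : Measure Ω) (P : Ω → ι) (n : ℕ) (x : Ω) : ℝ :=
  -Real.log (μ.real (cylinderAt T P n x))

/-- The distribution function `Ξ_n` of `(I_n - n h) / (σ √n)`, where `h` is the metric entropy. -/
def infoDistribution [MeasurableSpace Ω] (T : Ω → Ω) (μ : Measure Ω) (P : Ω → ι) (σ : ℝ)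
    (n : ℕ) (t : ℝ) : ℝ :=
  μ.real {x | (information T μ P n x - n * (metricEntropy T μ).toReal) / (σ * √(n : ℝ)) ≤ t}

/-- The standard normal distribution function. -/
def normalDistribution (t : ℝ) : ℝ :=
  1 / √(2 * Real.pi) * ∫ s in Set.Iic t, Real.exp (-s ^ 2 / 2)

end InfoCLT

end

/-!
The information function `I_n = -log μ(A_n)` is almost additive: the excess of `I_{m+d+l}` over the
information of its first `m` and its last `l` letters (`gapDefect`) is the conditional information
of the `d` letters in the gap minus the logarithm of a density, that of the joint law of the outer
words with respect to the product of their laws. The first has an exponential moment of at most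
`exp (d log k)`. The density is small only with small probability, whatever the joint law is, and by
mixing it exceeds `2` only with probability at most `2 ψ d`
(`IsMixingSystem.integral_abs_gapDefect_pow_le`, `IsMixingSystem.measureReal_abs_gapDefect_le`).

With gaps of length `n ^ (1/3)` this makes the entropy and the variance of `I_n` almost additive
sequences, hence linear up to `n ^ (1/3)` and `n ^ (5/6)` (`exists_linear_of_almost_additive`,
`IsMixingSystem.exists_meanInfo_linear`, `IsMixingSystem.exists_varInfo_linear`); the slope of the
variance is `σ ^ 2`. The slope of the entropy is the metric entropy by the Kolmogorov–Sinai theorem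
(`metricEntropy_eq`). It is proved with Gibbs' inequality: a partition `Q` that agrees with a
function of finitely many letters of `P` off a small set is encoded cheaply, given these letters.
The third absolute moment of `I_n` is `O(n ^ (3/2))`, by induction over halves
(`IsMixingSystem.exists_thirdMoment_le`).

For the central limit theorem, `n` letters are cut into about `n ^ (4 κ)` blocks separated by gaps
of length about `n ^ (2 / (p + 2))`. The sum of the centred block informations is compared with a
Gaussian variable by Lindeberg's method, applied directly to the dependent blocks: mixing decouples
the last block from the others, and a Taylor expansion of the normal distribution function together
with the heat equation replaces it by a Gaussian of equal variance
(`IsMixingSystem.abs_integral_blockSum_sub_le`). Starting from a Gaussian of variance `√N` times the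
variance of a block keeps the sum of the errors over `N` blocks at `O(N ^ (-1/4))`. The block sum
differs from `I_n - n h` by little off a small set, and the smoothing is removed at the cost of a
factor `log n` (`IsMixingSystem.exists_abs_measureReal_wordInfo_le_sub_le`).
-/

set_option linter.unusedSectionVars false

namespace InfoCLT

/-! ### Finite-valued functions -/

/-- A measurable function that takes only finitely many values. Such functions are integrable, and
any function of them is again measurable and finite-valued. -/
structure FiniteValued {Ω β : Type*} [MeasurableSpace Ω] [MeasurableSpace β] (f : Ω → β) :
    Prop where
  measurable : Measurable f
  finite_range : (Set.range f).Finite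

section FiniteValued

variable {Ω β γ δ : Type*} [MeasurableSpace Ω] [MeasurableSpace β] [MeasurableSpace γ]
  [MeasurableSpace δ]

lemma FiniteValued.of_finite [Finite β] {f : Ω → β} (hf : Measurable f) : FiniteValued f :=
  ⟨hf, Set.toFinite _⟩

lemma FiniteValued.const (c : β) : FiniteValued (fun _ : Ω => c) :=
  ⟨measurable_const, Set.finite_range_const⟩

lemma FiniteValued.comp [MeasurableSingletonClass β] {f : Ω → β} (hf : FiniteValued f)
    (F : β → γ) : FiniteValued (fun x => F (f x)) := by
  refine ⟨fun s _ => ?_, ?_⟩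
  · have : (fun x => F (f x)) ⁻¹' s = f ⁻¹' (F ⁻¹' s ∩ Set.range f) := by
      ext x; simp
    rw [this]
    exact hf.measurable ((hf.finite_range.subset Set.inter_subset_right).measurableSet)
  · have : Set.range (fun x => F (f x)) = F '' Set.range f := by
      ext x; simp
    rw [this]
    exact hf.finite_range.image F

lemma FiniteValued.prodMk {f : Ω → β} {g : Ω → γ} (hf : FiniteValued f) (hg : FiniteValued g) :
    FiniteValued (fun x => (f x, g x)) := by
  refine ⟨hf.measurable.prodMk hg.measurable, (hf.finite_range.prod hg.finite_range).subset ?_⟩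
  rintro _ ⟨x, rfl⟩
  exact ⟨⟨x, rfl⟩, ⟨x, rfl⟩⟩

lemma FiniteValued.comp₂ [MeasurableSingletonClass β] [MeasurableSingletonClass γ]
    {f : Ω → β} {g : Ω → γ} (hf : FiniteValued f) (hg : FiniteValued g) (F : β → γ → δ) :
    FiniteValued (fun x => F (f x) (g x)) :=
  (hf.prodMk hg).comp (fun z => F z.1 z.2)

lemma FiniteValued.comp_measurable {f : Ω → β} (hf : FiniteValued f) {T : Ω → Ω}
    (hT : Measurable T) : FiniteValued (fun x => f (T x)) :=
  ⟨hf.measurable.comp hT, hf.finite_range.subset (by rintro _ ⟨x, rfl⟩; exact ⟨T x, rfl⟩)⟩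

lemma FiniteValued.integrable {μ : Measure Ω} [IsFiniteMeasure μ] {f : Ω → ℝ}
    (hf : FiniteValued f) : Integrable f μ := by
  obtain ⟨C, hC⟩ := hf.finite_range.isBounded.exists_norm_le
  exact Integrable.of_bound hf.measurable.aestronglyMeasurable C
    (ae_of_all _ fun x => hC _ ⟨x, rfl⟩)

lemma FiniteValued.add {f g : Ω → ℝ} (hf : FiniteValued f) (hg : FiniteValued g) :
    FiniteValued (fun x => f x + g x) := hf.comp₂ hg (· + ·)

lemma FiniteValued.sub {f g : Ω → ℝ} (hf : FiniteValued f) (hg : FiniteValued g) :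
    FiniteValued (fun x => f x - g x) := hf.comp₂ hg (· - ·)

lemma FiniteValued.mul {f g : Ω → ℝ} (hf : FiniteValued f) (hg : FiniteValued g) :
    FiniteValued (fun x => f x * g x) := hf.comp₂ hg (· * ·)

lemma FiniteValued.sum {ι : Type*} (s : Finset ι) {f : ι → Ω → ℝ}
    (hf : ∀ i ∈ s, FiniteValued (f i)) : FiniteValued (fun x => ∑ i ∈ s, f i x) := by
  classical
  induction s using Finset.induction_on with
  | empty => simpa using FiniteValued.const 0
  | insert a s ha ih =>
    simp only [Finset.sum_insert ha]
    exact (hf a (Finset.mem_insert_self a s)).add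
      (ih fun i hi => hf i (Finset.mem_insert_of_mem hi))

variable {μ : Measure Ω} [IsProbabilityMeasure μ]

lemma FiniteValued.integral_add {f g : Ω → ℝ} (hf : FiniteValued f) (hg : FiniteValued g) :
    ∫ x, (f x + g x) ∂μ = ∫ x, f x ∂μ + ∫ x, g x ∂μ :=
  MeasureTheory.integral_add hf.integrable hg.integrable

lemma FiniteValued.integral_sub {f g : Ω → ℝ} (hf : FiniteValued f) (hg : FiniteValued g) :
    ∫ x, (f x - g x) ∂μ = ∫ x, f x ∂μ - ∫ x, g x ∂μ :=
  MeasureTheory.integral_sub hf.integrable hg.integrable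

lemma FiniteValued.const_mul (c : ℝ) {f : Ω → ℝ} (hf : FiniteValued f) :
    FiniteValued (fun x => c * f x) := hf.comp (c * ·)

lemma FiniteValued.pow {f : Ω → ℝ} (hf : FiniteValued f) (q : ℕ) :
    FiniteValued (fun x => f x ^ q) := hf.comp (· ^ q)

/-- The Cauchy–Schwarz inequality. -/
lemma integral_mul_le_sqrt {f g : Ω → ℝ} (hf : FiniteValued f) (hg : FiniteValued g) :
    |∫ x, f x * g x ∂μ| ≤ √(∫ x, f x ^ 2 ∂μ) * √(∫ x, g x ^ 2 ∂μ) := by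
  have key : ∀ t : ℝ, 0 ≤ (∫ x, g x ^ 2 ∂μ) * (t * t) + (2 * ∫ x, f x * g x ∂μ) * t
      + ∫ x, f x ^ 2 ∂μ := by
    intro t
    have h0 : 0 ≤ ∫ x, (f x + t * g x) ^ 2 ∂μ := integral_nonneg fun x => sq_nonneg _
    have h1 : ∫ x, (f x + t * g x) ^ 2 ∂μ = ∫ x, (t * t * g x ^ 2 + 2 * t * (f x * g x))
        + f x ^ 2 ∂μ := integral_congr_ae (ae_of_all _ fun x => by ring)
    rw [h1, (((hg.pow 2).const_mul _).add ((hf.mul hg).const_mul _)).integral_add (hf.pow 2),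
      ((hg.pow 2).const_mul _).integral_add ((hf.mul hg).const_mul _), integral_const_mul,
      integral_const_mul] at h0
    linarith
  have hd := discrim_le_zero key
  rw [discrim] at hd
  rw [← Real.sqrt_mul (integral_nonneg fun x => sq_nonneg _)]
  apply Real.abs_le_sqrt
  nlinarith

lemma integral_le_integral_of_ae {f g : Ω → ℝ} (hf : FiniteValued f) (hg : FiniteValued g)
    (h : ∀ᵐ x ∂μ, f x ≤ g x) : ∫ x, f x ∂μ ≤ ∫ x, g x ∂μ :=
  integral_mono_ae hf.integrable hg.integrable h

/-- The integral of a function of a finite-valued map is a finite sum. -/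
lemma integral_comp_eq_sum {α : Type*} [Fintype α] [MeasurableSpace α]
    [MeasurableSingletonClass α] {f : Ω → α} (hf : Measurable f) (G : α → ℝ) :
    ∫ x, G (f x) ∂μ = ∑ a, μ.real (f ⁻¹' {a}) * G a := by
  have h1 : ∫ x, G (f x) ∂μ = ∫ a, G a ∂(μ.map f) := by
    rw [integral_map hf.aemeasurable]
    exact (measurable_of_countable G).aestronglyMeasurable
  have : IsFiniteMeasure (μ.map f) := Measure.isFiniteMeasure_map μ f
  rw [h1, integral_fintype .of_finite]
  refine Finset.sum_congr rfl fun a _ => ?_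
  rw [smul_eq_mul, measureReal_def, Measure.map_apply hf (measurableSet_singleton a),
    measureReal_def]

lemma pow_add_le_two_pow {a b : ℝ} (ha : 0 ≤ a) (hb : 0 ≤ b) (q : ℕ) :
    (a + b) ^ q ≤ 2 ^ q * (a ^ q + b ^ q) := by
  have h1 : a + b ≤ 2 * max a b := by
    have := le_max_left a b; have := le_max_right a b; linarith
  calc (a + b) ^ q ≤ (2 * max a b) ^ q := by gcongr
    _ = 2 ^ q * (max a b) ^ q := by rw [mul_pow]
    _ ≤ 2 ^ q * (a ^ q + b ^ q) := by
      gcongr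
      have := pow_nonneg ha q
      have := pow_nonneg hb q
      rcases max_choice a b with h | h <;> rw [h] <;> linarith

/-- A nonnegative function whose exponential moment is at most `exp L` has `q`-th moment of order
at most `L ^ q`. -/
lemma integral_pow_le_of_integral_exp_le {J : Ω → ℝ} (hJ : FiniteValued J)
    (h0 : ∀ᵐ x ∂μ, 0 ≤ J x) {L : ℝ} (hL : 0 ≤ L)
    (hexp : ∫ x, Real.exp (J x) ∂μ ≤ Real.exp L) (q : ℕ) :
    ∫ x, J x ^ q ∂μ ≤ 2 ^ q * (L ^ q + 2 * q.factorial) := by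
  -- `J ≤ L + y` with `y = max (J - L) 0`, and `y ^ q ≤ q! * exp y`
  have hpt : ∀ᵐ x ∂μ, J x ^ q ≤
      2 ^ q * (L ^ q + q.factorial * (1 + Real.exp (-L) * Real.exp (J x))) := by
    filter_upwards [h0] with x hx
    have h1 : J x ≤ L + max (J x - L) 0 := by have := le_max_left (J x - L) 0; linarith
    have h2 : (0 : ℝ) ≤ max (J x - L) 0 := le_max_right _ _
    have h3 := Real.pow_div_factorial_le_exp (max (J x - L) 0) h2 q
    rw [div_le_iff₀ (by positivity)] at h3
    have h4 : Real.exp (max (J x - L) 0) ≤ 1 + Real.exp (-L) * Real.exp (J x) := by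
      rw [← Real.exp_add, show -L + J x = J x - L by ring]
      rcases max_choice (J x - L) 0 with h | h <;> rw [h]
      · linarith
      · have := Real.exp_pos (J x - L); simp; positivity
    calc J x ^ q ≤ (L + max (J x - L) 0) ^ q := by gcongr
      _ ≤ 2 ^ q * (L ^ q + (max (J x - L) 0) ^ q) := pow_add_le_two_pow hL h2 q
      _ ≤ _ := by
        gcongr
        calc _ ≤ _ := h3
          _ ≤ _ := by rw [mul_comm]; gcongr
  have hI := (hJ.comp Real.exp).const_mul (Real.exp (-L))
  have hI' := (FiniteValued.const (1 : ℝ)).add hI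
  have h5 := integral_le_integral_of_ae (hJ.comp (· ^ q))
    (hJ.comp fun y => 2 ^ q * (L ^ q + q.factorial * (1 + Real.exp (-L) * Real.exp y))) hpt
  refine h5.trans ?_
  rw [integral_const_mul, (FiniteValued.const (L ^ q)).integral_add (hI'.const_mul _),
    integral_const_mul, (FiniteValued.const (1 : ℝ)).integral_add hI, integral_const_mul]
  simp only [integral_const, probReal_univ, one_smul]
  have h6 : Real.exp (-L) * ∫ x, Real.exp (J x) ∂μ ≤ 1 := by
    calc _ ≤ Real.exp (-L) * Real.exp L := by gcongr
      _ = 1 := by rw [← Real.exp_add]; simp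
  have : (0 : ℝ) ≤ q.factorial := by positivity
  refine mul_le_mul_of_nonneg_left (add_le_add le_rfl ?_) (by positivity)
  nlinarith

/-- Exponential Chebyshev inequality. -/
lemma measureReal_lt_le_of_integral_exp_le {J : Ω → ℝ} (hJ : FiniteValued J) {L : ℝ}
    (hexp : ∫ x, Real.exp (J x) ∂μ ≤ Real.exp L) (s : ℝ) :
    μ.real {x | L + s < J x} ≤ Real.exp (-s) := by
  have h := mul_meas_ge_le_integral_of_nonneg (μ := μ) (f := fun x => Real.exp (J x))
    (ae_of_all _ fun x => (Real.exp_pos _).le) (hJ.comp Real.exp).integrable (Real.exp (L + s))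
  have h1 : μ.real {x | L + s < J x} ≤ μ.real {x | Real.exp (L + s) ≤ Real.exp (J x)} :=
    measureReal_mono (fun x hx => Real.exp_le_exp.2 (le_of_lt hx))
  have h2 : Real.exp (L + s) * μ.real {x | L + s < J x} ≤ Real.exp L :=
    le_trans (by gcongr) (h.trans hexp)
  rw [Real.exp_add, mul_assoc] at h2
  have h3 : Real.exp s * μ.real {x | L + s < J x} ≤ 1 :=
    le_of_mul_le_mul_left (by linarith) (Real.exp_pos L)
  rw [Real.exp_neg, ← one_div, le_div_iff₀ (Real.exp_pos s)]
  linarith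

end FiniteValued

/-! ### Information of finite-valued maps -/

section Info

variable {Ω α β : Type*} [MeasurableSpace Ω] {μ : Measure Ω}

/-- The probability of the fibre of `f` that contains `x`. -/
noncomputable def fiberProb (μ : Measure Ω) (f : Ω → α) (x : Ω) : ℝ := μ.real {y | f y = f x}

/-- The information function of `f`, i.e. of the partition into the fibres of `f`. It is zero
on null fibres, as `Real.log 0 = 0`. -/
noncomputable def info (μ : Measure Ω) (f : Ω → α) (x : Ω) : ℝ := -Real.log (fiberProb μ f x)

lemma fiberProb_congr {f : Ω → α} {g : Ω → β} (h : ∀ x y, f x = f y ↔ g x = g y) :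
    fiberProb μ f = fiberProb μ g := by
  funext x
  simp only [fiberProb, h]

lemma info_congr {f : Ω → α} {g : Ω → β} (h : ∀ x y, f x = f y ↔ g x = g y) :
    info μ f = info μ g := by
  funext x
  simp only [info, fiberProb_congr h]

/-- Two finite-valued maps are `δ`-nearly independent: over any set of pairs of values, the total
deviation of the joint law from the product of the marginal laws is at most `δ`. -/
def NearlyIndep (μ : Measure Ω) (f : Ω → α) (g : Ω → β) (δ : ℝ) : Prop :=
  ∀ S : Finset (α × β), |∑ s ∈ S, (μ.real (f ⁻¹' {s.1} ∩ g ⁻¹' {s.2}) -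
    μ.real (f ⁻¹' {s.1}) * μ.real (g ⁻¹' {s.2}))| ≤ δ

lemma fiberProb_nonneg (f : Ω → α) (x : Ω) : 0 ≤ fiberProb μ f x := measureReal_nonneg

lemma fiberProb_le_one [IsProbabilityMeasure μ] (f : Ω → α) (x : Ω) : fiberProb μ f x ≤ 1 :=
  measureReal_le_one

lemma info_nonneg [IsProbabilityMeasure μ] (f : Ω → α) (x : Ω) : 0 ≤ info μ f x :=
  neg_nonneg.2 (Real.log_nonpos (fiberProb_nonneg f x) (fiberProb_le_one f x))

lemma fiberProb_prodMk_le_right [IsProbabilityMeasure μ] (f : Ω → α) (g : Ω → β) (x : Ω) :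
    fiberProb μ (fun y => (f y, g y)) x ≤ fiberProb μ g x :=
  measureReal_mono fun y hy => (Prod.ext_iff.1 hy).2

lemma fiberProb_prodMk_le_left [IsProbabilityMeasure μ] (f : Ω → α) (g : Ω → β) (x : Ω) :
    fiberProb μ (fun y => (f y, g y)) x ≤ fiberProb μ f x :=
  measureReal_mono fun y hy => (Prod.ext_iff.1 hy).1

lemma preimage_prodMk_singleton {Ω : Type*} (f : Ω → α) (g : Ω → β) (z : α × β) :
    (fun y => (f y, g y)) ⁻¹' {z} = f ⁻¹' {z.1} ∩ g ⁻¹' {z.2} := by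
  ext y; simp [Prod.ext_iff]

variable [IsProbabilityMeasure μ] [Fintype α] [MeasurableSpace α] [MeasurableSingletonClass α]
  [Fintype β] [MeasurableSpace β] [MeasurableSingletonClass β]

lemma FiniteValued.fiberProb {f : Ω → α} (hf : Measurable f) : FiniteValued (fiberProb μ f) :=
  (FiniteValued.of_finite hf).comp fun a => μ.real (f ⁻¹' {a})

lemma FiniteValued.info {f : Ω → α} (hf : Measurable f) : FiniteValued (info μ f) :=
  (FiniteValued.fiberProb hf).comp fun p => -Real.log p

lemma fiberProb_pos_ae (f : Ω → α) : ∀ᵐ x ∂μ, 0 < fiberProb μ f x := by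
  have hne : ∀ x, ¬ 0 < InfoCLT.fiberProb μ f x → μ (f ⁻¹' {f x}) = 0 := by
    intro x hx
    have : μ.real {y | f y = f x} = 0 := le_antisymm (not_lt.1 hx) measureReal_nonneg
    exact (measureReal_eq_zero_iff).1 this
  rw [ae_iff]
  refine measure_mono_null (t := ⋃ a ∈ {a : α | μ (f ⁻¹' {a}) = 0}, f ⁻¹' {a}) ?_ ?_
  · intro x hx
    simp only [Set.mem_iUnion]
    exact ⟨f x, hne x hx, rfl⟩
  · rw [measure_biUnion_null_iff (Set.to_countable _)]
    exact fun a ha => ha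

/-- The conditional information of `f` given `g` is almost surely nonnegative. -/
lemma info_le_info_prodMk (f : Ω → α) (g : Ω → β) :
    ∀ᵐ x ∂μ, 0 ≤ info μ (fun y => (f y, g y)) x - info μ g x := by
  filter_upwards [fiberProb_pos_ae (μ := μ) fun y => (f y, g y)] with x hx
  have := Real.log_le_log hx (fiberProb_prodMk_le_right f g x)
  simp only [info]
  linarith

lemma sum_measureReal_preimage {f : Ω → α} (hf : Measurable f) :
    ∑ a, μ.real (f ⁻¹' {a}) = 1 := by
  have := integral_comp_eq_sum (μ := μ) hf (fun _ => 1)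
  simpa using this.symm

/-- The exponential moment of the conditional information of `f` given `g` is at most the number
of values of `f`. -/
lemma integral_exp_condInfo_le {f : Ω → α} {g : Ω → β} (hf : Measurable f) (hg : Measurable g) :
    ∫ x, Real.exp (info μ (fun y => (f y, g y)) x - info μ g x) ∂μ ≤ Fintype.card α := by
  have hfg := hf.prodMk hg
  have h1 : ∀ᵐ x ∂μ, Real.exp (info μ (fun y => (f y, g y)) x - info μ g x)
      ≤ fiberProb μ g x / fiberProb μ (fun y => (f y, g y)) x := by
    filter_upwards [fiberProb_pos_ae (μ := μ) fun y => (f y, g y)] with x hx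
    have hg0 := hx.trans_le (fiberProb_prodMk_le_right f g x)
    rw [info, info, neg_sub_neg, Real.exp_sub, Real.exp_log hg0, Real.exp_log hx]
  refine (integral_le_integral_of_ae
    (((FiniteValued.info hfg).sub (FiniteValued.info hg)).comp Real.exp)
    ((FiniteValued.fiberProb hg).comp₂ (FiniteValued.fiberProb hfg) (· / ·)) h1).trans ?_
  have h2 := integral_comp_eq_sum (μ := μ) hfg (fun z => μ.real (g ⁻¹' {z.2}) /
    μ.real ((fun y => (f y, g y)) ⁻¹' {z}))
  have h3 : ∫ x, fiberProb μ g x / fiberProb μ (fun y => (f y, g y)) x ∂μ = _ := h2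
  rw [h3, Fintype.sum_prod_type]
  calc _ ≤ ∑ _a : α, ∑ b : β, μ.real (g ⁻¹' {b}) := by
        gcongr with a _ b _
        -- a null fibre contributes zero on the left
        by_cases h0 : μ.real ((fun y => (f y, g y)) ⁻¹' {(a, b)}) = 0
        · rw [h0]; simp
        · rw [mul_div_cancel₀ _ h0]
    _ = Fintype.card α := by simp [sum_measureReal_preimage hg]

/-- The density of the product of the marginals with respect to the joint law has expectation at
most one. -/
lemma integral_exp_info_sub_le {f : Ω → α} {g : Ω → β} (hf : Measurable f) (hg : Measurable g) :
    ∫ x, Real.exp (info μ (fun y => (f y, g y)) x - info μ f x - info μ g x) ∂μ ≤ 1 := by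
  have hfg := hf.prodMk hg
  have h1 : ∀ᵐ x ∂μ, Real.exp (info μ (fun y => (f y, g y)) x - info μ f x - info μ g x)
      ≤ fiberProb μ f x * fiberProb μ g x / fiberProb μ (fun y => (f y, g y)) x := by
    filter_upwards [fiberProb_pos_ae (μ := μ) fun y => (f y, g y)] with x hx
    have hg0 := hx.trans_le (fiberProb_prodMk_le_right f g x)
    have hf0 := hx.trans_le (fiberProb_prodMk_le_left f g x)
    rw [info, info, info, show ∀ a b c : ℝ, -a - -b - -c = b + c - a by intros; ring,
      Real.exp_sub, Real.exp_add, Real.exp_log hg0, Real.exp_log hx, Real.exp_log hf0]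
  refine (integral_le_integral_of_ae
    ((((FiniteValued.info hfg).sub (FiniteValued.info hf)).sub
      (FiniteValued.info hg)).comp Real.exp)
    (((FiniteValued.fiberProb hf).mul (FiniteValued.fiberProb hg)).comp₂
      (FiniteValued.fiberProb hfg) (· / ·)) h1).trans ?_
  have h2 := integral_comp_eq_sum (μ := μ) hfg (fun z => μ.real (f ⁻¹' {z.1}) *
    μ.real (g ⁻¹' {z.2}) / μ.real ((fun y => (f y, g y)) ⁻¹' {z}))
  have h3 : ∫ x, fiberProb μ f x * fiberProb μ g x / fiberProb μ (fun y => (f y, g y)) x ∂μ = _ :=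
    h2
  rw [h3, Fintype.sum_prod_type]
  calc _ ≤ ∑ a : α, ∑ b : β, μ.real (f ⁻¹' {a}) * μ.real (g ⁻¹' {b}) := by
        refine Finset.sum_le_sum fun a _ => Finset.sum_le_sum fun b _ => ?_
        by_cases h0 : μ.real ((fun y => (f y, g y)) ⁻¹' {(a, b)}) = 0
        · rw [h0]; simp; positivity
        · rw [mul_div_cancel₀ _ h0]
    _ = 1 := by
      simp [← Finset.mul_sum, sum_measureReal_preimage hg, sum_measureReal_preimage hf]

end Info

/-! ### Nearly independent pairs -/

section NearlyIndep

variable {Ω α β : Type*} [MeasurableSpace Ω] {μ : Measure Ω} [IsProbabilityMeasure μ]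
  [Fintype α] [MeasurableSpace α] [MeasurableSingletonClass α]
  [Fintype β] [MeasurableSpace β] [MeasurableSingletonClass β]
  {f : Ω → α} {g : Ω → β} {δ : ℝ}

/-- The expectation of `F (f, g)` when `f` and `g` are replaced by independent copies. -/
noncomputable def indepExp (μ : Measure Ω) (f : Ω → α) (g : Ω → β) (F : α → β → ℝ) : ℝ :=
  ∫ x, ∫ y, F (f x) (g y) ∂μ ∂μ

lemma indepExp_eq_sum (hf : Measurable f) (hg : Measurable g) (F : α → β → ℝ) :
    indepExp μ f g F =
      ∑ z : α × β, μ.real (f ⁻¹' {z.1}) * μ.real (g ⁻¹' {z.2}) * F z.1 z.2 := by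
  rw [indepExp, integral_comp_eq_sum hf (fun a => ∫ y, F a (g y) ∂μ), Fintype.sum_prod_type]
  refine Finset.sum_congr rfl fun a _ => ?_
  rw [integral_comp_eq_sum hg (fun b => F a b), Finset.mul_sum]
  exact Finset.sum_congr rfl fun b _ => by ring

lemma integral_prodMk_eq_sum (hf : Measurable f) (hg : Measurable g) (F : α → β → ℝ) :
    ∫ x, F (f x) (g x) ∂μ = ∑ z : α × β, μ.real (f ⁻¹' {z.1} ∩ g ⁻¹' {z.2}) * F z.1 z.2 := by
  rw [integral_comp_eq_sum (hf.prodMk hg) (fun z => F z.1 z.2)]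
  exact Finset.sum_congr rfl fun z _ => by rw [preimage_prodMk_singleton]

/-- The deviations from independence, summed without cancellation. -/
lemma NearlyIndep.sum_abs_le (h : NearlyIndep μ f g δ) :
    ∑ z : α × β, |μ.real (f ⁻¹' {z.1} ∩ g ⁻¹' {z.2}) -
      μ.real (f ⁻¹' {z.1}) * μ.real (g ⁻¹' {z.2})| ≤ 2 * δ := by
  classical
  set d : α × β → ℝ := fun z => μ.real (f ⁻¹' {z.1} ∩ g ⁻¹' {z.2}) -
      μ.real (f ⁻¹' {z.1}) * μ.real (g ⁻¹' {z.2}) with hd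
  have h1 := (le_abs_self _).trans (h (Finset.univ.filter fun z => 0 ≤ d z))
  have h2 := (neg_le_abs _).trans (h (Finset.univ.filter fun z => ¬ 0 ≤ d z))
  rw [← Finset.sum_filter_add_sum_filter_not Finset.univ (fun z => 0 ≤ d z)]
  have h3 : ∑ z with 0 ≤ d z, |d z| = ∑ z with 0 ≤ d z, d z :=
    Finset.sum_congr rfl fun z hz => abs_of_nonneg (Finset.mem_filter.1 hz).2
  have h4 : ∑ z with ¬ 0 ≤ d z, |d z| = -∑ z with ¬ 0 ≤ d z, d z := by
    rw [← Finset.sum_neg_distrib]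
    exact Finset.sum_congr rfl fun z hz => abs_of_neg (not_le.1 (Finset.mem_filter.1 hz).2)
  change ∑ z with 0 ≤ d z, |d z| + ∑ z with ¬ 0 ≤ d z, |d z| ≤ 2 * δ
  rw [h3, h4]
  linarith

lemma NearlyIndep.abs_integral_sub_indepExp_le (h : NearlyIndep μ f g δ) (hf : Measurable f)
    (hg : Measurable g) {F : α → β → ℝ} {M : ℝ} (hF : ∀ a b, |F a b| ≤ M) :
    |∫ x, F (f x) (g x) ∂μ - indepExp μ f g F| ≤ 2 * δ * M := by
  rw [integral_prodMk_eq_sum hf hg, indepExp_eq_sum hf hg, ← Finset.sum_sub_distrib]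
  refine (Finset.abs_sum_le_sum_abs _ _).trans ?_
  by_cases hne : Nonempty (α × β)
  · obtain ⟨a, b⟩ := hne
    have hM : 0 ≤ M := (abs_nonneg _).trans (hF a b)
    refine le_trans ?_ (mul_le_mul_of_nonneg_right h.sum_abs_le hM)
    rw [Finset.sum_mul]
    refine Finset.sum_le_sum fun z _ => ?_
    rw [← sub_mul, abs_mul]
    exact mul_le_mul_of_nonneg_left (hF _ _) (abs_nonneg _)
  · have hα := nonempty_of_isProbabilityMeasure μ
    exact absurd ⟨(f hα.some, g hα.some)⟩ hne

/-- Cauchy–Schwarz bound for the change of an expectation under decoupling. -/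
lemma NearlyIndep.abs_integral_sub_indepExp_le_sqrt (h : NearlyIndep μ f g δ) (hf : Measurable f)
    (hg : Measurable g) (F : α → β → ℝ) :
    |∫ x, F (f x) (g x) ∂μ - indepExp μ f g F| ≤
      √(2 * δ) * √(∫ x, F (f x) (g x) ^ 2 ∂μ + indepExp μ f g fun a b => F a b ^ 2) := by
  rw [integral_prodMk_eq_sum hf hg, indepExp_eq_sum hf hg, ← Finset.sum_sub_distrib,
    integral_prodMk_eq_sum hf hg fun a b => F a b ^ 2, indepExp_eq_sum hf hg,
    ← Finset.sum_add_distrib]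
  set d : α × β → ℝ := fun z => |μ.real (f ⁻¹' {z.1} ∩ g ⁻¹' {z.2}) -
      μ.real (f ⁻¹' {z.1}) * μ.real (g ⁻¹' {z.2})| with hd
  have hd0 : ∀ z, 0 ≤ d z := fun z => abs_nonneg _
  calc _ ≤ ∑ z : α × β, d z * |F z.1 z.2| := by
        refine (Finset.abs_sum_le_sum_abs _ _).trans (Finset.sum_le_sum fun z _ => ?_)
        rw [← sub_mul, abs_mul]
    _ = ∑ z : α × β, √(d z) * (√(d z) * |F z.1 z.2|) := by
        refine Finset.sum_congr rfl fun z _ => ?_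
        rw [← mul_assoc, Real.mul_self_sqrt (hd0 z)]
    _ ≤ √(∑ z : α × β, √(d z) ^ 2) * √(∑ z : α × β, (√(d z) * |F z.1 z.2|) ^ 2) :=
        Real.sum_mul_le_sqrt_mul_sqrt _ _ _
    _ ≤ _ := by
        refine mul_le_mul (Real.sqrt_le_sqrt ?_) (Real.sqrt_le_sqrt ?_) (Real.sqrt_nonneg _)
          (Real.sqrt_nonneg _)
        · simp only [Real.sq_sqrt (hd0 _)]
          exact h.sum_abs_le
        · refine Finset.sum_le_sum fun z _ => ?_
          rw [mul_pow, Real.sq_sqrt (hd0 z), sq_abs, ← add_mul]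
          refine mul_le_mul_of_nonneg_right ?_ (sq_nonneg _)
          have h1 : 0 ≤ μ.real (f ⁻¹' {z.1} ∩ g ⁻¹' {z.2}) := measureReal_nonneg
          have h2 : 0 ≤ μ.real (f ⁻¹' {z.1}) * μ.real (g ⁻¹' {z.2}) := by positivity
          rw [hd, abs_le]
          constructor <;> linarith

/-- The information of the pair minus the sum of the informations, `-log` of the density of the
joint law with respect to the product of its marginals. -/
noncomputable def infoDefect (μ : Measure Ω) (f : Ω → α) (g : Ω → β) (x : Ω) : ℝ :=
  info μ (fun y => (f y, g y)) x - info μ f x - info μ g x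

lemma FiniteValued.infoDefect (hf : Measurable f) (hg : Measurable g) :
    FiniteValued (infoDefect μ f g) :=
  ((FiniteValued.info (hf.prodMk hg)).sub (FiniteValued.info hf)).sub (FiniteValued.info hg)

lemma measureReal_lt_infoDefect_le (hf : Measurable f) (hg : Measurable g) (s : ℝ) :
    μ.real {x | s < infoDefect μ f g x} ≤ Real.exp (-s) := by
  have := measureReal_lt_le_of_integral_exp_le (μ := μ) (FiniteValued.infoDefect hf hg) (L := 0)
    (by rw [Real.exp_zero]; exact integral_exp_info_sub_le hf hg) s
  simpa using this

/-- The density `p / r` of the joint law exceeds two only with small probability, because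
`p ≤ 2 * (p - r)` where it does. -/
lemma NearlyIndep.measureReal_infoDefect_lt_le (h : NearlyIndep μ f g δ) (hf : Measurable f)
    (hg : Measurable g) :
    μ.real {x | infoDefect μ f g x < -Real.log 2} ≤ 2 * δ := by
  classical
  set p : α × β → ℝ := fun z => μ.real (f ⁻¹' {z.1} ∩ g ⁻¹' {z.2}) with hp
  set r : α × β → ℝ := fun z => μ.real (f ⁻¹' {z.1}) * μ.real (g ⁻¹' {z.2}) with hr
  have h1 := (le_abs_self _).trans (h (Finset.univ.filter fun z => 2 * r z < p z))
  have h2 : μ.real {x | infoDefect μ f g x < -Real.log 2} ≤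
      ∫ x, (if 2 * r (f x, g x) < p (f x, g x) then 1 else 0 : ℝ) ∂μ := by
    have hind : ∫ x, (if 2 * r (f x, g x) < p (f x, g x) then 1 else 0 : ℝ) ∂μ =
        μ.real {x | 2 * r (f x, g x) < p (f x, g x)} := by
      rw [← integral_indicator_one]
      · rfl
      · exact ((FiniteValued.of_finite (hf.prodMk hg)).comp
          (fun z => 2 * r z < p z)).measurable (measurableSet_singleton True) |>.congr (by
            ext x; simp)
    rw [hind]
    refine ENNReal.toReal_mono (measure_ne_top _ _) (measure_mono_ae ?_)
    filter_upwards [fiberProb_pos_ae (μ := μ) fun y => (f y, g y)] with x hx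
    have hg0 := hx.trans_le (fiberProb_prodMk_le_right f g x)
    have hf0 := hx.trans_le (fiberProb_prodMk_le_left f g x)
    intro hlt
    change infoDefect μ f g x < -Real.log 2 at hlt
    have hpe : fiberProb μ (fun y => (f y, g y)) x = p (f x, g x) := by
      rw [hp]; exact congrArg μ.real (preimage_prodMk_singleton f g (f x, g x))
    rw [infoDefect, info, info, info] at hlt
    have h3 : Real.log (2 * (fiberProb μ f x * fiberProb μ g x)) <
        Real.log (fiberProb μ (fun y => (f y, g y)) x) := by
      rw [Real.log_mul (by norm_num) (by positivity), Real.log_mul hf0.ne' hg0.ne']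
      linarith
    have h4 := (Real.log_lt_log_iff (by positivity) hx).1 h3
    rw [hpe] at h4
    exact h4
  rw [integral_prodMk_eq_sum hf hg (fun a b => if 2 * r (a, b) < p (a, b) then (1:ℝ) else 0)] at h2
  refine h2.trans ?_
  calc _ = ∑ z with 2 * r z < p z, p z := by
        rw [Finset.sum_filter]
        exact Finset.sum_congr rfl fun z _ => by simp [hp]
    _ ≤ ∑ z with 2 * r z < p z, 2 * (p z - r z) := by
        refine Finset.sum_le_sum fun z hz => ?_
        have := (Finset.mem_filter.1 hz).2
        linarith
    _ ≤ 2 * δ := by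
        rw [← Finset.mul_sum]
        linarith

lemma abs_pow_eq_max_add_max (y : ℝ) {q : ℕ} (hq : q ≠ 0) :
    |y| ^ q = max y 0 ^ q + max (-y) 0 ^ q := by
  rcases le_total 0 y with h | h
  · rw [abs_of_nonneg h, max_eq_left h, max_eq_right (by linarith), zero_pow hq, add_zero]
  · rw [abs_of_nonpos h, max_eq_right h, max_eq_left (by linarith), zero_pow hq, zero_add]

/-- Moments of the information defect of a nearly independent pair. Its positive part has a bounded
exponential moment. Its negative part is at most `log 2` off a set of measure `2 * δ`, on which it
is at most the information of `g`, and the Cauchy–Schwarz inequality applies. -/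
lemma NearlyIndep.integral_abs_infoDefect_pow_le (h : NearlyIndep μ f g δ) (hf : Measurable f)
    (hg : Measurable g) {q : ℕ} (hq : q ≠ 0) :
    ∫ x, |infoDefect μ f g x| ^ q ∂μ ≤
      2 ^ q * (1 + 2 * q.factorial) + 1 + √(2 * δ) * √(∫ x, info μ g x ^ (2 * q) ∂μ) := by
  classical
  have hD := FiniteValued.infoDefect (μ := μ) hf hg
  have hI := FiniteValued.info (μ := μ) hg
  have hU := hD.comp (fun y => max y 0)
  have hV := hD.comp (fun y => max (-y) 0)
  have hB := hD.comp (fun y => if y < -Real.log 2 then (1 : ℝ) else 0)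
  simp only [abs_pow_eq_max_add_max _ hq]
  rw [(hU.pow q).integral_add (hV.pow q), add_assoc]
  have hexp := integral_exp_info_sub_le (μ := μ) hf hg
  have h1 : ∫ x, max (infoDefect μ f g x) 0 ^ q ∂μ ≤ 2 ^ q * (1 ^ q + 2 * q.factorial) := by
    refine integral_pow_le_of_integral_exp_le hU (ae_of_all _ fun x => le_max_right _ _)
      zero_le_one ?_ q
    calc _ ≤ ∫ x, (1 + Real.exp (infoDefect μ f g x)) ∂μ := by
          refine integral_le_integral_of_ae (hU.comp Real.exp)
            ((FiniteValued.const 1).add (hD.comp Real.exp)) (ae_of_all _ fun x => ?_)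
          rcases max_choice (infoDefect μ f g x) 0 with h | h <;> rw [h]
          · linarith
          · simp; positivity
      _ ≤ 2 := by
          rw [(FiniteValued.const (1 : ℝ)).integral_add (hD.comp Real.exp)]
          simp only [integral_const, probReal_univ, one_smul]
          have : ∫ x, Real.exp (infoDefect μ f g x) ∂μ ≤ 1 := hexp
          linarith
      _ ≤ Real.exp 1 := by have := Real.add_one_le_exp 1; linarith
  have h2 : ∫ x, max (-infoDefect μ f g x) 0 ^ q ∂μ ≤
      ∫ x, (1 + (if infoDefect μ f g x < -Real.log 2 then (1 : ℝ) else 0) * info μ g x ^ q) ∂μ := by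
    refine integral_le_integral_of_ae (hV.pow q)
      ((FiniteValued.const 1).add (hB.mul (hI.pow q))) ?_
    filter_upwards [info_le_info_prodMk (μ := μ) g f] with x hx
    have hsw : info μ (fun y => (g y, f y)) = info μ (fun y => (f y, g y)) :=
      info_congr fun x y => by simp [and_comm]
    rw [hsw] at hx
    have hle : -infoDefect μ f g x ≤ info μ g x := by rw [infoDefect]; linarith
    have h0 := info_nonneg (μ := μ) g x
    split_ifs with hc
    · rw [one_mul]
      have : max (-infoDefect μ f g x) 0 ^ q ≤ info μ g x ^ q := by
        gcongr
        exact max_le hle h0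
      linarith
    · rw [zero_mul, add_zero]
      refine pow_le_one₀ (le_max_right _ _) (max_le ?_ zero_le_one)
      have := Real.log_two_lt_d9
      linarith
  have h3 := integral_mul_le_sqrt (μ := μ) hB (hI.pow q)
  have h4 : ∫ x, (if infoDefect μ f g x < -Real.log 2 then (1 : ℝ) else 0) ^ 2 ∂μ ≤ 2 * δ := by
    refine le_trans (le_of_eq ?_) (h.measureReal_infoDefect_lt_le hf hg)
    rw [← integral_indicator_one]
    · congr 1
      funext x
      simp [Set.indicator]
    · exact hD.measurable measurableSet_Iio
  rw [(FiniteValued.const (1 : ℝ)).integral_add (hB.mul (hI.pow q))] at h2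
  simp only [integral_const, probReal_univ, one_smul] at h2
  have h5 : √(∫ x, (if infoDefect μ f g x < -Real.log 2 then (1 : ℝ) else 0) ^ 2 ∂μ) *
      √(∫ x, (info μ g x ^ q) ^ 2 ∂μ) ≤ √(2 * δ) * √(∫ x, info μ g x ^ (2 * q) ∂μ) := by
    simp only [← pow_mul, mul_comm q 2]
    gcongr
  have h6 := le_abs_self (∫ x, (if infoDefect μ f g x < -Real.log 2 then (1 : ℝ) else 0) *
    info μ g x ^ q ∂μ)
  rw [one_pow] at h1
  linarith

end NearlyIndep

/-! ### Words of a process and their information -/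

section Words

variable {Ω ι : Type*}

/-- The word of length `n` that `x` spells under the partition `P`. -/
def word (T : Ω → Ω) (P : Ω → ι) (n : ℕ) (x : Ω) : Fin n → ι := fun j => P (T^[(j : ℕ)] x)

lemma word_eq_iff {T : Ω → Ω} {P : Ω → ι} {n : ℕ} {x y : Ω} :
    word T P n x = word T P n y ↔ ∀ j < n, P (T^[j] x) = P (T^[j] y) := by
  rw [funext_iff]
  exact ⟨fun h j hj => h ⟨j, hj⟩, fun h j => h j j.2⟩

lemma word_iterate_eq_iff {T : Ω → Ω} {P : Ω → ι} {m n : ℕ} {x y : Ω} :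
    word T P n (T^[m] x) = word T P n (T^[m] y) ↔
      ∀ j, m ≤ j → j < m + n → P (T^[j] x) = P (T^[j] y) := by
  simp only [word_eq_iff, ← Function.iterate_add_apply]
  constructor
  · intro h j hj hj'
    have := h (j - m) (by omega)
    rwa [Nat.sub_add_cancel hj] at this
  · intro h j hj
    exact h (j + m) (by omega) (by omega)

variable [MeasurableSpace Ω] {μ : Measure Ω} [IsProbabilityMeasure μ]
  [Fintype ι] [MeasurableSpace ι] [MeasurableSingletonClass ι] {T : Ω → Ω} {P : Ω → ι} {ψ : ℕ → ℝ}

lemma information_eq_info (n : ℕ) : information T μ P n = info μ (word T P n) := by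
  funext x
  simp only [information, info, fiberProb, cylinderAt, joinCylinder, word, funext_iff]

lemma measurable_word (hT : Measurable T) (hP : Measurable P) (n : ℕ) :
    Measurable (word T P n) :=
  measurable_pi_lambda _ fun j => hP.comp (hT.iterate j)

lemma fiberProb_comp {α : Type*} [Fintype α] [MeasurableSpace α] [MeasurableSingletonClass α]
    {f : Ω → α} (hf : Measurable f) {S : Ω → Ω} (hS : MeasurePreserving S μ μ) (x : Ω) :
    fiberProb μ (fun y => f (S y)) x = fiberProb μ f (S x) := by
  have h : MeasurableSet (f ⁻¹' {f (S x)}) := hf (measurableSet_singleton _)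
  exact hS.measureReal_preimage h.nullMeasurableSet

lemma info_comp {α : Type*} [Fintype α] [MeasurableSpace α] [MeasurableSingletonClass α]
    {f : Ω → α} (hf : Measurable f) {S : Ω → Ω} (hS : MeasurePreserving S μ μ) (x : Ω) :
    info μ (fun y => f (S y)) x = info μ f (S x) := by
  rw [info, info, fiberProb_comp hf hS]

lemma FiniteValued.integral_comp_measurePreserving {F : Ω → ℝ} (hF : FiniteValued F)
    {S : Ω → Ω} (hS : MeasurePreserving S μ μ) : ∫ x, F (S x) ∂μ = ∫ x, F x ∂μ := by
  conv_rhs => rw [← hS.map_eq]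
  rw [integral_map hS.measurable.aemeasurable hF.measurable.aestronglyMeasurable]

/-- The information of the first `n` symbols. -/
noncomputable def wordInfo (μ : Measure Ω) (T : Ω → Ω) (P : Ω → ι) (n : ℕ) : Ω → ℝ :=
  info μ (word T P n)

/-- The logarithm of the size of the alphabet. -/
noncomputable def logCard (ι : Type*) [Fintype ι] : ℝ := Real.log (Fintype.card ι)

lemma logCard_nonneg : 0 ≤ logCard ι := Real.log_natCast_nonneg _

lemma card_word_le_exp (P : Ω → ι) (μ : Measure Ω) [IsProbabilityMeasure μ] (n : ℕ) :
    (Fintype.card (Fin n → ι) : ℝ) ≤ Real.exp (n * logCard ι) := by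
  have : Nonempty ι := (nonempty_of_isProbabilityMeasure μ).map P
  rw [logCard, mul_comm, Real.exp_mul, Real.exp_log (by exact_mod_cast Fintype.card_pos)]
  simp

lemma FiniteValued.wordInfo (hT : Measurable T) (hP : Measurable P) (n : ℕ) :
    FiniteValued (wordInfo μ T P n) := FiniteValued.info (measurable_word hT hP n)

lemma wordInfo_nonneg (n : ℕ) (x : Ω) : 0 ≤ wordInfo μ T P n x := info_nonneg _ _

section Extension

variable (hT : MeasurePreserving T μ μ) (hP : Measurable P) (m n : ℕ)

lemma wordInfo_add_eq : wordInfo μ T P (m + n) =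
    info μ (fun y => (word T P n (T^[m] y), word T P m y)) := by
  refine info_congr fun x y => ?_
  rw [Prod.ext_iff]
  simp only [word_eq_iff (T := T) (n := m + n), word_iterate_eq_iff, word_eq_iff (n := m)]
  refine ⟨fun h => ⟨fun j _ hj => h j hj, fun j hj => h j (by omega)⟩, fun h j hj => ?_⟩
  rcases lt_or_ge j m with h' | h'
  exacts [h.2 j h', h.1 j h' hj]

lemma wordInfo_add_eq' : wordInfo μ T P (m + n) =
    info μ (fun y => (word T P m y, word T P n (T^[m] y))) := by
  rw [wordInfo_add_eq]
  exact info_congr fun x y => by simp [and_comm]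

lemma wordInfo_le_add_right : ∀ᵐ x ∂μ, 0 ≤ wordInfo μ T P (m + n) x - wordInfo μ T P m x := by
  rw [wordInfo_add_eq]
  exact info_le_info_prodMk _ _

lemma integral_exp_wordInfo_add_right_le (hT : Measurable T) (hP : Measurable P) (m n : ℕ) :
    ∫ x, Real.exp (wordInfo μ T P (m + n) x - wordInfo μ T P m x) ∂μ ≤
      Real.exp (n * logCard ι) := by
  rw [wordInfo_add_eq]
  exact (integral_exp_condInfo_le ((measurable_word hT hP n).comp (hT.iterate m))
    (measurable_word hT hP m)).trans (card_word_le_exp P μ n)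

lemma info_word_iterate (hT : MeasurePreserving T μ μ) (hP : Measurable P) (m n : ℕ) (x : Ω) :
    info μ (fun y => word T P n (T^[m] y)) x = wordInfo μ T P n (T^[m] x) :=
  info_comp (measurable_word hT.measurable hP n) (hT.iterate m) x

lemma wordInfo_le_add_left (hT : MeasurePreserving T μ μ) (hP : Measurable P) (m n : ℕ) :
    ∀ᵐ x ∂μ, 0 ≤ wordInfo μ T P (m + n) x - wordInfo μ T P n (T^[m] x) := by
  rw [wordInfo_add_eq']
  simp only [← info_word_iterate hT hP]
  exact info_le_info_prodMk _ _

lemma integral_exp_wordInfo_add_left_le (hT : MeasurePreserving T μ μ) (hP : Measurable P)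
    (m n : ℕ) :
    ∫ x, Real.exp (wordInfo μ T P (m + n) x - wordInfo μ T P n (T^[m] x)) ∂μ ≤
      Real.exp (m * logCard ι) := by
  rw [wordInfo_add_eq']
  simp only [← info_word_iterate hT hP]
  exact (integral_exp_condInfo_le (measurable_word hT.measurable hP m)
    ((measurable_word hT.measurable hP n).comp (hT.iterate m).measurable)).trans
      (card_word_le_exp P μ m)

lemma FiniteValued.wordInfo_iterate (hT : Measurable T) (hP : Measurable P) (m n : ℕ) :
    FiniteValued (fun x => InfoCLT.wordInfo μ T P n (T^[m] x)) :=
  (FiniteValued.wordInfo hT hP n).comp_measurable (hT.iterate m)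

/-- Bound for the moments of a word of length `n`, as a function of `n * log (card ι)`. -/
noncomputable def momentBound (q : ℕ) (L : ℝ) : ℝ := 2 ^ q * (L ^ q + 2 * q.factorial)

lemma integral_wordInfo_add_right_pow_le (hT : Measurable T) (hP : Measurable P) (m n q : ℕ) :
    ∫ x, |wordInfo μ T P (m + n) x - wordInfo μ T P m x| ^ q ∂μ ≤
      momentBound q (n * logCard ι) := by
  have h := integral_pow_le_of_integral_exp_le (μ := μ)
    ((FiniteValued.wordInfo hT hP (m + n)).sub (FiniteValued.wordInfo hT hP m))
    (wordInfo_le_add_right m n) (mul_nonneg (Nat.cast_nonneg n) logCard_nonneg)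
    (integral_exp_wordInfo_add_right_le hT hP m n) q
  refine le_trans (le_of_eq (integral_congr_ae ?_)) h
  filter_upwards [wordInfo_le_add_right (μ := μ) (T := T) (P := P) m n] with x hx
  rw [abs_of_nonneg hx]

lemma integral_wordInfo_add_left_pow_le (hT : MeasurePreserving T μ μ) (hP : Measurable P)
    (m n q : ℕ) :
    ∫ x, |wordInfo μ T P (m + n) x - wordInfo μ T P n (T^[m] x)| ^ q ∂μ ≤
      momentBound q (m * logCard ι) := by
  have h := integral_pow_le_of_integral_exp_le (μ := μ)
    ((FiniteValued.wordInfo hT.measurable hP (m + n)).sub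
      (FiniteValued.wordInfo_iterate hT.measurable hP m n))
    (wordInfo_le_add_left hT hP m n) (mul_nonneg (Nat.cast_nonneg m) logCard_nonneg)
    (integral_exp_wordInfo_add_left_le hT hP m n) q
  refine le_trans (le_of_eq (integral_congr_ae ?_)) h
  filter_upwards [wordInfo_le_add_left hT hP m n] with x hx
  rw [abs_of_nonneg hx]

lemma wordInfo_zero (x : Ω) : wordInfo μ T P 0 x = 0 := by
  have : {y | word T P 0 y = word T P 0 x} = Set.univ := by
    ext y; simp [word_eq_iff]
  simp [wordInfo, info, fiberProb, this]

lemma integral_wordInfo_pow_le (hT : Measurable T) (hP : Measurable P) (n q : ℕ) :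
    ∫ x, wordInfo μ T P n x ^ q ∂μ ≤ momentBound q (n * logCard ι) := by
  have h := integral_wordInfo_add_right_pow_le (μ := μ) hT hP 0 n q
  simp only [Nat.zero_add, wordInfo_zero, sub_zero, abs_of_nonneg (wordInfo_nonneg _ _)] at h
  exact h

lemma measureReal_wordInfo_add_right_le (hT : Measurable T) (hP : Measurable P) (m n : ℕ)
    (s : ℝ) : μ.real {x | n * logCard ι + s < wordInfo μ T P (m + n) x - wordInfo μ T P m x} ≤
      Real.exp (-s) :=
  measureReal_lt_le_of_integral_exp_le
    ((FiniteValued.wordInfo hT hP (m + n)).sub (FiniteValued.wordInfo hT hP m))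
    (integral_exp_wordInfo_add_right_le hT hP m n) s

lemma momentBound_le (q : ℕ) :
    ∃ C : ℝ, 0 ≤ C ∧ ∀ n : ℕ, 0 < n → momentBound q (n * logCard ι) ≤ C * (n : ℝ) ^ q := by
  refine ⟨2 ^ q * (logCard ι ^ q + 2 * q.factorial), ?_, fun n hn => ?_⟩
  · have := logCard_nonneg (ι := ι); positivity
  · have h1 : (1 : ℝ) ≤ (n : ℝ) ^ q := one_le_pow₀ (by exact_mod_cast hn)
    rw [momentBound, mul_pow, mul_assoc, add_mul, mul_comm (logCard ι ^ q)]
    have : (0 : ℝ) ≤ q.factorial := by positivity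
    refine mul_le_mul_of_nonneg_left (add_le_add le_rfl ?_) (by positivity)
    nlinarith

end Extension

/-- The excess of the information of a word of length `m + d + l` over the sum of the informations
of its first `m` and its last `l` letters. -/
noncomputable def gapDefect (μ : Measure Ω) (T : Ω → Ω) (P : Ω → ι) (m d l : ℕ)
    (x : Ω) : ℝ :=
  wordInfo μ T P (m + d + l) x - wordInfo μ T P m x - wordInfo μ T P l (T^[m + d] x)

/-- The standing hypotheses: a measure-preserving map, a measurable partition, and uniform strong
mixing. -/
structure IsMixingSystem (μ : Measure Ω) (T : Ω → Ω) (P : Ω → ι) (ψ : ℕ → ℝ) : Prop where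
  preserving : MeasurePreserving T μ μ
  measurable : Measurable P
  mixing : IsUniformlyStrongMixing T μ P ψ

lemma joinCylinder_eq_preimage (n : ℕ) (w : Fin n → ι) :
    joinCylinder T P n w = word T P n ⁻¹' {w} := by
  ext x
  simp [joinCylinder, word, funext_iff]

namespace IsMixingSystem

variable (h : IsMixingSystem μ T P ψ)
include h

lemma psi_nonneg (n : ℕ) : 0 ≤ ψ n := h.mixing.antitone.le_of_tendsto h.mixing.tendsto_zero n

lemma measurable_map : Measurable T := h.preserving.measurable

lemma measurable_word (n : ℕ) : Measurable (word T P n) :=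
  InfoCLT.measurable_word h.measurable_map h.measurable n

lemma measurable_word_iterate (m n : ℕ) : Measurable fun x => word T P n (T^[m] x) :=
  (h.measurable_word n).comp (h.measurable_map.iterate m)

lemma finiteValued_wordInfo (n : ℕ) : FiniteValued (wordInfo μ T P n) :=
  FiniteValued.wordInfo h.measurable_map h.measurable n

lemma finiteValued_wordInfo_iterate (m n : ℕ) :
    FiniteValued (fun x => wordInfo μ T P n (T^[m] x)) :=
  FiniteValued.wordInfo_iterate h.measurable_map h.measurable m n

/-- Two words that are separated by a gap of length `d` are nearly independent. -/
lemma nearlyIndep {m d l : ℕ} (hm : 0 < m) (hd : 0 < d) (hl : 0 < l) :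
    NearlyIndep μ (word T P m) (fun x => word T P l (T^[m + d] x)) (ψ d) := by
  intro S
  have := h.mixing.mixing m l d hm hl hd S
  simp only [joinCylinder_eq_preimage, add_comm d m] at this
  exact this

lemma finiteValued_gapDefect (m d l : ℕ) : FiniteValued (gapDefect μ T P m d l) :=
  ((h.finiteValued_wordInfo _).sub (h.finiteValued_wordInfo _)).sub
    (h.finiteValued_wordInfo_iterate _ _)

/-- The excess splits into the conditional information of the letters in the gap and the
information defect of the two outer words. -/
lemma exists_gapDefect_eq (m d l : ℕ) :
    ∃ J : Ω → ℝ, FiniteValued J ∧ (∀ᵐ x ∂μ, 0 ≤ J x) ∧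
      ∫ x, Real.exp (J x) ∂μ ≤ Real.exp (d * logCard ι) ∧
      ∀ x, gapDefect μ T P m d l x =
        J x + infoDefect μ (word T P m) (fun x => word T P l (T^[m + d] x)) x := by
  set f := fun y => word T P d (T^[m] y) with hf
  set g := fun y => (word T P m y, word T P l (T^[m + d] y)) with hg
  have hfm : Measurable f := h.measurable_word_iterate m d
  have hgm : Measurable g := (h.measurable_word m).prodMk (h.measurable_word_iterate _ l)
  have heq : wordInfo μ T P (m + d + l) = info μ (fun y => (f y, g y)) := by
    refine info_congr fun x y => ?_
    rw [hf, hg]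
    simp only [Prod.ext_iff]
    simp only [word_eq_iff (n := m + d + l), word_iterate_eq_iff, word_eq_iff (n := m)]
    refine ⟨fun h => ⟨fun j _ hj => h j (by omega), fun j hj => h j (by omega),
      fun j _ hj => h j hj⟩, fun h j hj => ?_⟩
    rcases lt_or_ge j m with h' | h'
    · exact h.2.1 j h'
    · rcases lt_or_ge j (m + d) with h'' | h''
      exacts [h.1 j h' h'', h.2.2 j h'' hj]
  refine ⟨fun x => info μ (fun y => (f y, g y)) x - info μ g x,
    (FiniteValued.info (hfm.prodMk hgm)).sub (FiniteValued.info hgm), info_le_info_prodMk f g,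
    (integral_exp_condInfo_le hfm hgm).trans (card_word_le_exp P μ d), fun x => ?_⟩
  rw [gapDefect, heq, infoDefect, info_word_iterate h.preserving h.measurable]
  simp only [wordInfo]
  ring

/-- Moments of the excess: the letters in the gap contribute `d ^ q`, and the dependence of the
outer words contributes `√(ψ d) * l ^ q`. -/
lemma integral_abs_gapDefect_pow_le {q : ℕ} (hq : q ≠ 0) :
    ∃ C : ℝ, 0 ≤ C ∧ ∀ m d l : ℕ, 0 < m → 0 < d → 0 < l →
      ∫ x, |gapDefect μ T P m d l x| ^ q ∂μ ≤ C * ((d : ℝ) ^ q + √(ψ d) * (l : ℝ) ^ q) := by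
  obtain ⟨C₁, hC₁, h₁⟩ := momentBound_le (ι := ι) q
  obtain ⟨C₂, hC₂, h₂⟩ := momentBound_le (ι := ι) (2 * q)
  set C₃ : ℝ := 2 ^ q * (1 + 2 * q.factorial) + 1 with hC₃
  have hC₃0 : 0 ≤ C₃ := by positivity
  refine ⟨2 ^ q * (C₁ + C₃ + √2 * √C₂), by positivity, fun m d l hm hd hl => ?_⟩
  obtain ⟨J, hJ, hJ0, hJe, heq⟩ := h.exists_gapDefect_eq m d l
  have hw := h.measurable_word m
  have hw' := h.measurable_word_iterate (m + d) l
  have hD := FiniteValued.infoDefect (μ := μ) hw hw'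
  have e1 : ∫ x, |gapDefect μ T P m d l x| ^ q ∂μ ≤
      ∫ x, 2 ^ q * (J x ^ q +
        |infoDefect μ (word T P m) (fun x => word T P l (T^[m + d] x)) x| ^ q) ∂μ := by
    refine integral_le_integral_of_ae ((h.finiteValued_gapDefect m d l).comp fun y => |y| ^ q)
      (((hJ.pow q).add (hD.comp fun y => |y| ^ q)).const_mul _) ?_
    filter_upwards [hJ0] with x hx
    rw [heq]
    refine le_trans ?_ (pow_add_le_two_pow hx (abs_nonneg _) q)
    gcongr
    exact (abs_add_le _ _).trans (by rw [abs_of_nonneg hx])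
  rw [integral_const_mul, (hJ.pow q).integral_add (hD.comp fun y => |y| ^ q)] at e1
  have e2 := (integral_pow_le_of_integral_exp_le hJ hJ0
    (mul_nonneg (Nat.cast_nonneg d) logCard_nonneg) hJe q).trans (h₁ d hd)
  have e3 := (h.nearlyIndep hm hd hl).integral_abs_infoDefect_pow_le hw hw' hq
  have e4 : ∫ x, info μ (fun x => word T P l (T^[m + d] x)) x ^ (2 * q) ∂μ ≤
      C₂ * (l : ℝ) ^ (2 * q) := by
    simp only [info_word_iterate h.preserving h.measurable]
    rw [((h.finiteValued_wordInfo l).pow (2 * q)).integral_comp_measurePreserving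
      (h.preserving.iterate (m + d))]
    exact (integral_wordInfo_pow_le h.measurable_map h.measurable l _).trans (h₂ l hl)
  have e5 : √(∫ x, info μ (fun x => word T P l (T^[m + d] x)) x ^ (2 * q) ∂μ) ≤
      √C₂ * (l : ℝ) ^ q := by
    refine (Real.sqrt_le_sqrt e4).trans (le_of_eq ?_)
    rw [Real.sqrt_mul hC₂, mul_comm 2 q, pow_mul, Real.sqrt_sq (by positivity)]
  rw [Real.sqrt_mul zero_le_two] at e3
  have hd1 : (1 : ℝ) ≤ (d : ℝ) ^ q := one_le_pow₀ (by exact_mod_cast hd)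
  have e6 : √2 * √(ψ d) * √(∫ x, info μ (fun x => word T P l (T^[m + d] x)) x ^ (2 * q) ∂μ) ≤
      √2 * √C₂ * (√(ψ d) * (l : ℝ) ^ q) := by
    calc _ ≤ √2 * √(ψ d) * (√C₂ * (l : ℝ) ^ q) := by gcongr
      _ = _ := by ring
  refine e1.trans ?_
  rw [mul_assoc]
  gcongr
  have e8 : 0 ≤ (C₁ + C₃) * (√(ψ d) * (l : ℝ) ^ q) := by positivity
  have e9 : 0 ≤ √2 * √C₂ * (d : ℝ) ^ q := by positivity
  nlinarith

/-- The excess is of the order of the gap with high probability. -/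
lemma measureReal_abs_gapDefect_le {m d l : ℕ} (hm : 0 < m) (hd : 0 < d) (hl : 0 < l) {s : ℝ}
    (hs : 0 ≤ s) :
    μ.real {x | d * logCard ι + 2 * s + Real.log 2 < |gapDefect μ T P m d l x|} ≤
      2 * Real.exp (-s) + 2 * ψ d := by
  obtain ⟨J, hJ, hJ0, hJe, heq⟩ := h.exists_gapDefect_eq m d l
  have hw := h.measurable_word m
  have hw' := h.measurable_word_iterate (m + d) l
  set D := infoDefect μ (word T P m) (fun x => word T P l (T^[m + d] x)) with hD
  have h1 := measureReal_lt_le_of_integral_exp_le hJ hJe s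
  have h2 := measureReal_lt_infoDefect_le (μ := μ) hw hw' s
  have h3 := (h.nearlyIndep hm hd hl).measureReal_infoDefect_lt_le hw hw'
  have h4 : μ.real {x | d * logCard ι + 2 * s + Real.log 2 < |gapDefect μ T P m d l x|} ≤
      μ.real ({x | d * logCard ι + s < J x} ∪ ({x | s < D x} ∪ {x | D x < -Real.log 2})) := by
    refine ENNReal.toReal_mono (measure_ne_top _ _) (measure_mono_ae ?_)
    filter_upwards [hJ0] with x hx hlt
    change d * logCard ι + 2 * s + Real.log 2 < |gapDefect μ T P m d l x| at hlt
    by_contra hcon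
    change ¬ (_ ∨ _ ∨ _) at hcon
    simp only [Set.mem_ofPred_eq, not_or, not_lt] at hcon
    obtain ⟨c1, c2, c3⟩ := hcon
    have hlog := Real.log_pos one_lt_two
    rw [heq] at hlt
    have : |J x + D x| ≤ d * logCard ι + 2 * s + Real.log 2 := by
      rw [abs_le]; constructor <;> linarith
    linarith
  have h5 := measureReal_union_le (μ := μ) {x | d * logCard ι + s < J x}
    ({x | s < D x} ∪ {x | D x < -Real.log 2})
  have h6 := measureReal_union_le (μ := μ) {x | s < D x} {x | D x < -Real.log 2}
  linarith

end IsMixingSystem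

end Words

/-! ### Almost additive sequences -/

/-- If the additivity defect of `a` is `O((m + n) ^ θ)` with `θ < 1`, then `a n` is linear up to an
error `O(n ^ θ)`. The slope is the limit of `a (2 ^ k n) / (2 ^ k n)`, which does not depend on
`n`. -/
lemma exists_linear_of_almost_additive {a : ℕ → ℝ} {C θ : ℝ} (hC : 0 ≤ C) (hθ : θ < 1)
    (h : ∀ m n : ℕ, 0 < m → 0 < n → |a (m + n) - a m - a n| ≤ C * ((m + n : ℕ) : ℝ) ^ θ) :
    ∃ L C' : ℝ, 0 ≤ C' ∧ ∀ n : ℕ, 0 < n → |a n - n * L| ≤ C' * (n : ℝ) ^ θ := by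
  set r : ℝ := 2 ^ (θ - 1) with hr
  have hr0 : 0 < r := Real.rpow_pos_of_pos two_pos _
  have hr1 : r < 1 := Real.rpow_lt_one_of_one_lt_of_neg one_lt_two (by linarith)
  have hpow : ∀ k n : ℕ, ((2 ^ k * n : ℕ) : ℝ) ^ θ / 2 ^ k = (n : ℝ) ^ θ * r ^ k := by
    intro k n
    have e1 : r ^ k = ((2 : ℝ) ^ k) ^ θ / 2 ^ k := by
      rw [hr, Real.rpow_sub two_pos, Real.rpow_one, div_pow, ← Real.rpow_natCast (2 ^ θ) k,
        ← Real.rpow_mul two_pos.le, mul_comm θ, Real.rpow_mul two_pos.le, Real.rpow_natCast]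
    rw [e1]
    push_cast
    rw [Real.mul_rpow (by positivity) (by positivity)]
    ring
  set b : ℕ → ℕ → ℝ := fun n k => a (2 ^ k * n) / 2 ^ k with hb
  have hstep : ∀ n, 0 < n → ∀ k, dist (b n k) (b n (k + 1)) ≤ (C * (n : ℝ) ^ θ * r) * r ^ k := by
    intro n hn k
    have hp : 0 < 2 ^ k * n := by positivity
    have h1 := h _ _ hp hp
    have e2 : 2 ^ k * n + 2 ^ k * n = 2 ^ (k + 1) * n := by ring
    rw [e2] at h1
    rw [dist_comm, Real.dist_eq, hb]
    have e3 : a (2 ^ (k + 1) * n) / 2 ^ (k + 1) - a (2 ^ k * n) / 2 ^ k =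
        (a (2 ^ (k + 1) * n) - a (2 ^ k * n) - a (2 ^ k * n)) / 2 ^ (k + 1) := by
      field_simp; ring
    simp only
    rw [e3, abs_div, abs_of_pos (by positivity : (0 : ℝ) < 2 ^ (k + 1))]
    calc _ ≤ C * ((2 ^ (k + 1) * n : ℕ) : ℝ) ^ θ / 2 ^ (k + 1) := by gcongr
      _ = C * (n : ℝ) ^ θ * r * r ^ k := by rw [mul_div_assoc, hpow]; ring
  have hlim : ∀ n, ∃ l, 0 < n → Tendsto (b n) atTop (𝓝 l) := by
    intro n
    by_cases hn : 0 < n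
    · obtain ⟨l, hl⟩ := cauchySeq_tendsto_of_complete
        (cauchySeq_of_le_geometric r _ hr1 (hstep n hn))
      exact ⟨l, fun _ => hl⟩
    · exact ⟨0, fun h => absurd h hn⟩
  choose L hL using hlim
  have hadd : ∀ m n, 0 < m → 0 < n → L (m + n) = L m + L n := by
    intro m n hm hn
    have t1 := ((hL (m + n) (by omega)).sub (hL m hm)).sub (hL n hn)
    have t2 : Tendsto (fun k => C * ((m + n : ℕ) : ℝ) ^ θ * r ^ k) atTop (𝓝 0) := by
      simpa using (tendsto_pow_atTop_nhds_zero_of_lt_one hr0.le hr1).const_mul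
        (C * ((m + n : ℕ) : ℝ) ^ θ)
    have t3 : Tendsto (fun k => b (m + n) k - b m k - b n k) atTop (𝓝 0) := by
      refine squeeze_zero_norm (fun k => ?_) t2
      have h1 := h (2 ^ k * m) (2 ^ k * n) (by positivity) (by positivity)
      rw [← mul_add] at h1
      rw [Real.norm_eq_abs, hb]
      simp only
      rw [← sub_div, ← sub_div, abs_div, abs_of_pos (by positivity : (0 : ℝ) < 2 ^ k)]
      calc _ ≤ C * ((2 ^ k * (m + n) : ℕ) : ℝ) ^ θ / 2 ^ k := by gcongr
        _ = _ := by rw [mul_div_assoc, hpow]; ring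
    have := tendsto_nhds_unique t1 t3
    linarith
  have hlin : ∀ n, L (n + 1) = ((n + 1 : ℕ) : ℝ) * L 1 := by
    intro n
    induction n with
    | zero => simp
    | succ n ih =>
      rw [hadd (n + 1) 1 (by omega) one_pos, ih]
      push_cast
      ring
  refine ⟨L 1, C * r / (1 - r), div_nonneg (by positivity) (by linarith), fun n hn => ?_⟩
  have h1 := dist_le_of_le_geometric_of_tendsto₀ r _ hr1 (hstep n hn) (hL n hn)
  obtain ⟨m, rfl⟩ := Nat.exists_eq_succ_of_ne_zero hn.ne'
  rw [Nat.succ_eq_add_one] at *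
  rw [← hlin m]
  have e4 : b (m + 1) 0 = a (m + 1) := by simp [hb]
  rw [e4, Real.dist_eq] at h1
  refine h1.trans (le_of_eq ?_)
  ring

/-- If the additivity defect of `a` is `O((m + n) ^ θ)` with `θ > 1`, then `a n = O(n ^ θ)`.
The proof is by induction, halving `n`. -/
lemma exists_bound_of_almost_additive {a : ℕ → ℝ} {C θ : ℝ} (hC : 0 ≤ C) (hθ : 1 < θ)
    (h : ∀ m n : ℕ, 0 < m → 0 < n → |a (m + n) - a m - a n| ≤ C * ((m + n : ℕ) : ℝ) ^ θ) :
    ∃ C' : ℝ, 0 ≤ C' ∧ ∀ n : ℕ, 0 < n → |a n| ≤ C' * (n : ℝ) ^ θ := by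
  -- both parts of `n` have length at most `2 / 3 * n`, which makes the sum of their `θ`-th powers
  -- smaller than `n ^ θ` by the factor `c`
  set c : ℝ := (2 / 3) ^ (θ - 1) with hc
  have hc1 : c < 1 := Real.rpow_lt_one (by norm_num) (by norm_num) (by linarith)
  set A : ℝ := |a 1| + C / (1 - c) with hA
  have hA0 : 0 ≤ A := add_nonneg (abs_nonneg _) (div_nonneg hC (by linarith))
  have hAC : A * c + C ≤ A := by
    have : C / (1 - c) * (1 - c) = C := div_mul_cancel₀ _ (by linarith)
    have h2 : C ≤ A * (1 - c) := by
      rw [hA, add_mul, this]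
      have := mul_nonneg (abs_nonneg (a 1)) (by linarith : 0 ≤ 1 - c)
      linarith
    linarith
  refine ⟨A, hA0, fun n => ?_⟩
  induction n using Nat.strong_induction_on with
  | _ n ih =>
    intro hn
    rcases Nat.lt_or_ge 1 n with hn1 | hn1
    · set m := n / 2 with hm
      set l := n - m with hl
      have hm0 : 0 < m := by omega
      have hl0 : 0 < l := by omega
      have hml : m + l = n := by omega
      have i1 := ih m (by omega) hm0
      have i2 := ih l (by omega) hl0
      have i3 := h m l hm0 hl0
      rw [hml] at i3
      have key : ∀ j : ℕ, 0 < j → 3 * j ≤ 2 * n → (j : ℝ) ^ θ ≤ j * (c * (n : ℝ) ^ (θ - 1)) := by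
        intro j hj hjn
        have hj' : (0 : ℝ) < j := by exact_mod_cast hj
        have hjn' : (j : ℝ) ≤ 2 / 3 * n := by
          have : (3 * j : ℝ) ≤ 2 * n := by exact_mod_cast hjn
          linarith
        have e5 : (j : ℝ) ^ θ = j * (j : ℝ) ^ (θ - 1) := by
          conv_lhs => rw [show θ = 1 + (θ - 1) by ring, Real.rpow_add hj', Real.rpow_one]
        rw [e5, hc, ← Real.mul_rpow (by norm_num) (by positivity)]
        have : 0 ≤ θ - 1 := by linarith
        gcongr
      have k1 := key m hm0 (by omega)
      have k2 := key l hl0 (by omega)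
      have hn' : (0 : ℝ) < n := by exact_mod_cast hn
      have hn2 : (n : ℝ) * (n : ℝ) ^ (θ - 1) = (n : ℝ) ^ θ := by
        conv_rhs => rw [show θ = 1 + (θ - 1) by ring, Real.rpow_add hn', Real.rpow_one]
      have hml' : (m : ℝ) + l = n := by exact_mod_cast hml
      have k3 : (m : ℝ) ^ θ + (l : ℝ) ^ θ ≤ c * (n : ℝ) ^ θ := by
        calc _ ≤ (m + l : ℝ) * (c * (n : ℝ) ^ (θ - 1)) := by linarith
          _ = c * (n * (n : ℝ) ^ (θ - 1)) := by rw [hml']; ring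
          _ = _ := by rw [hn2]
      have : |a n| ≤ |a n - a m - a l| + |a m| + |a l| := by
        have e : a n = (a n - a m - a l) + a m + a l := by ring
        calc |a n| = |(a n - a m - a l) + a m + a l| := by rw [← e]
          _ ≤ _ := (abs_add_le _ _).trans (add_le_add (abs_add_le _ _) le_rfl)
      calc |a n| ≤ A * ((m : ℝ) ^ θ + (l : ℝ) ^ θ) + C * (n : ℝ) ^ θ := by linarith
        _ ≤ A * (c * (n : ℝ) ^ θ) + C * (n : ℝ) ^ θ := by gcongr
        _ = (A * c + C) * (n : ℝ) ^ θ := by ring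
        _ ≤ A * (n : ℝ) ^ θ := by gcongr
    · have : n = 1 := by omega
      subst this
      simp only [Nat.cast_one, Real.one_rpow, mul_one, hA]
      have := div_nonneg hC (by linarith : 0 ≤ 1 - c)
      linarith

/-! ### Moments of the centred information -/

section Indep

variable {Ω α β : Type*} [MeasurableSpace Ω] {μ : Measure Ω} [IsProbabilityMeasure μ]
  [Fintype α] [MeasurableSpace α] [MeasurableSingletonClass α]
  [Fintype β] [MeasurableSpace β] [MeasurableSingletonClass β]
  {f : Ω → α} {g : Ω → β}

lemma indepExp_mono (hf : Measurable f) (hg : Measurable g) {F G : α → β → ℝ}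
    (h : ∀ a b, F a b ≤ G a b) : indepExp μ f g F ≤ indepExp μ f g G := by
  rw [indepExp_eq_sum hf hg, indepExp_eq_sum hf hg]
  exact Finset.sum_le_sum fun z _ => mul_le_mul_of_nonneg_left (h _ _)
    (mul_nonneg measureReal_nonneg measureReal_nonneg)

lemma indepExp_add (hf : Measurable f) (hg : Measurable g) (F G : α → β → ℝ) :
    indepExp μ f g (fun a b => F a b + G a b) = indepExp μ f g F + indepExp μ f g G := by
  rw [indepExp_eq_sum hf hg, indepExp_eq_sum hf hg, indepExp_eq_sum hf hg,
    ← Finset.sum_add_distrib]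
  exact Finset.sum_congr rfl fun z _ => by ring

lemma indepExp_mul (u : α → ℝ) (w : β → ℝ) :
    indepExp μ f g (fun a b => u a * w b) = (∫ x, u (f x) ∂μ) * ∫ x, w (g x) ∂μ := by
  simp only [indepExp, integral_const_mul, integral_mul_const]

end Indep

section Centred

variable {Ω ι : Type*} [MeasurableSpace Ω] {μ : Measure Ω} [IsProbabilityMeasure μ]
  [Fintype ι] [MeasurableSpace ι] [MeasurableSingletonClass ι] {T : Ω → Ω} {P : Ω → ι} {ψ : ℕ → ℝ}

/-- The mean of the information of `n` letters, i.e. the entropy of the `n`-th join. -/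
noncomputable def meanInfo (μ : Measure Ω) (T : Ω → Ω) (P : Ω → ι) (n : ℕ) : ℝ :=
  ∫ x, wordInfo μ T P n x ∂μ

/-- The centred information as a function of the word; `centred` is its composition with `word`. -/
noncomputable def wordCentred (μ : Measure Ω) (T : Ω → Ω) (P : Ω → ι) (n : ℕ) (w : Fin n → ι) :
    ℝ := -Real.log (μ.real (word T P n ⁻¹' {w})) - meanInfo μ T P n

/-- The centred information of the first `n` letters. -/
noncomputable def centred (μ : Measure Ω) (T : Ω → Ω) (P : Ω → ι) (n : ℕ) (x : Ω) : ℝ :=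
  wordInfo μ T P n x - meanInfo μ T P n

lemma centred_eq (n : ℕ) (x : Ω) : centred μ T P n x = wordCentred μ T P n (word T P n x) := rfl

/-- The variance of the information of `n` letters. -/
noncomputable def varInfo (μ : Measure Ω) (T : Ω → Ω) (P : Ω → ι) (n : ℕ) : ℝ :=
  ∫ x, centred μ T P n x ^ 2 ∂μ

lemma meanInfo_nonneg (n : ℕ) : 0 ≤ meanInfo μ T P n :=
  integral_nonneg fun x => wordInfo_nonneg n x

lemma varInfo_nonneg (n : ℕ) : 0 ≤ varInfo μ T P n := integral_nonneg fun _ => sq_nonneg _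

namespace IsMixingSystem

variable (h : IsMixingSystem μ T P ψ)
include h

lemma finiteValued_centred (n : ℕ) : FiniteValued (centred μ T P n) :=
  (h.finiteValued_wordInfo n).comp (· - _)

lemma finiteValued_centred_iterate (m n : ℕ) : FiniteValued (fun x => centred μ T P n (T^[m] x)) :=
  (h.finiteValued_centred n).comp_measurable (h.measurable_map.iterate m)

lemma integral_centred (n : ℕ) : ∫ x, centred μ T P n x ∂μ = 0 := by
  simp only [centred]
  rw [(h.finiteValued_wordInfo n).integral_sub (FiniteValued.const _)]
  simp [meanInfo]

lemma integral_comp_centred_iterate (G : ℝ → ℝ) (m n : ℕ) :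
    ∫ x, G (centred μ T P n (T^[m] x)) ∂μ = ∫ x, G (centred μ T P n x) ∂μ :=
  ((h.finiteValued_centred n).comp G).integral_comp_measurePreserving (h.preserving.iterate m)

lemma meanInfo_le : ∃ C : ℝ, 0 ≤ C ∧ ∀ n : ℕ, 0 < n → meanInfo μ T P n ≤ C * n := by
  obtain ⟨C, hC, hC'⟩ := momentBound_le (ι := ι) 1
  refine ⟨C, hC, fun n hn => ?_⟩
  have := (integral_wordInfo_pow_le (μ := μ) h.measurable_map h.measurable n 1).trans (hC' n hn)
  simpa [meanInfo] using this

lemma integral_abs_centred_pow_le (q : ℕ) :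
    ∃ C : ℝ, 0 ≤ C ∧ ∀ n : ℕ, 0 < n → ∫ x, |centred μ T P n x| ^ q ∂μ ≤ C * (n : ℝ) ^ q := by
  obtain ⟨C₁, hC₁, h₁⟩ := momentBound_le (ι := ι) q
  obtain ⟨C₂, hC₂, h₂⟩ := h.meanInfo_le
  refine ⟨2 ^ q * (C₁ + C₂ ^ q), by positivity, fun n hn => ?_⟩
  have hI := (h.finiteValued_wordInfo n).pow q
  have e1 : ∫ x, |centred μ T P n x| ^ q ∂μ ≤
      ∫ x, 2 ^ q * (wordInfo μ T P n x ^ q + (C₂ * n) ^ q) ∂μ := by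
    refine integral_le_integral_of_ae ((h.finiteValued_centred n).comp fun y => |y| ^ q)
      ((hI.add (FiniteValued.const _)).const_mul _) (ae_of_all _ fun x => ?_)
    have h0 := wordInfo_nonneg (μ := μ) (T := T) (P := P) n x
    have h1 := meanInfo_nonneg (μ := μ) (T := T) (P := P) n
    refine le_trans ?_ (pow_add_le_two_pow h0 (by positivity) q)
    gcongr
    rw [centred, abs_le]
    constructor <;> linarith [h₂ n hn]
  rw [integral_const_mul, hI.integral_add (FiniteValued.const _)] at e1
  refine e1.trans ?_
  have e2 := (integral_wordInfo_pow_le (μ := μ) h.measurable_map h.measurable n q).trans (h₁ n hn)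
  simp only [integral_const, probReal_univ, one_smul]
  rw [mul_assoc]
  gcongr
  rw [add_mul, mul_pow]
  linarith

/-- Decoupling of two words that are separated by a gap, for functions of polynomial growth. -/
lemma abs_integral_centred_sub_le (q : ℕ) :
    ∃ C : ℝ, 0 ≤ C ∧ ∀ F : ℝ → ℝ → ℝ, (∀ x y, |F x y| ≤ (|x| + |y|) ^ q) →
      ∀ m d l n : ℕ, 0 < m → 0 < d → 0 < l → m ≤ n → l ≤ n →
      |∫ x, F (centred μ T P m x) (centred μ T P l (T^[m + d] x)) ∂μ -
        indepExp μ (word T P m) (fun x => word T P l (T^[m + d] x))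
          (fun a b => F (wordCentred μ T P m a) (wordCentred μ T P l b))| ≤
      C * (√(ψ d) * (n : ℝ) ^ q) := by
  obtain ⟨C₁, hC₁, h₁⟩ := h.integral_abs_centred_pow_le (2 * q)
  refine ⟨√2 * √(2 * (2 ^ (2 * q) * (C₁ + C₁))), by positivity,
    fun F hF m d l n hm hd hl hmn hln => ?_⟩
  have hw := h.measurable_word m
  have hw' := h.measurable_word_iterate (m + d) l
  have key := (h.nearlyIndep hm hd hl).abs_integral_sub_indepExp_le_sqrt hw hw'
    (fun a b => F (wordCentred μ T P m a) (wordCentred μ T P l b))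
  have hF2 : ∀ x y, F x y ^ 2 ≤ 2 ^ (2 * q) * |x| ^ (2 * q) + 2 ^ (2 * q) * |y| ^ (2 * q) := by
    intro x y
    rw [← sq_abs, ← mul_add]
    refine le_trans ?_ (pow_add_le_two_pow (abs_nonneg x) (abs_nonneg y) (2 * q))
    rw [mul_comm 2 q, pow_mul]
    gcongr
    exact hF x y
  have b1 : ∫ x, |centred μ T P m x| ^ (2 * q) ∂μ ≤ C₁ * (n : ℝ) ^ (2 * q) :=
    (h₁ m hm).trans (by gcongr)
  have b2 : ∫ x, |centred μ T P l (T^[m + d] x)| ^ (2 * q) ∂μ ≤ C₁ * (n : ℝ) ^ (2 * q) := by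
    rw [h.integral_comp_centred_iterate (fun y => |y| ^ (2 * q))]
    exact (h₁ l hl).trans (by gcongr)
  have hX := (h.finiteValued_centred m).comp fun y => 2 ^ (2 * q) * |y| ^ (2 * q)
  have hY := (h.finiteValued_centred_iterate (m + d) l).comp fun y => 2 ^ (2 * q) * |y| ^ (2 * q)
  have k1 : ∫ x, F (centred μ T P m x) (centred μ T P l (T^[m + d] x)) ^ 2 ∂μ ≤
      2 ^ (2 * q) * (C₁ + C₁) * (n : ℝ) ^ (2 * q) := by
    refine (integral_le_integral_of_ae (((h.finiteValued_centred m).comp₂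
      (h.finiteValued_centred_iterate (m + d) l) F).pow 2) (hX.add hY)
      (ae_of_all _ fun x => hF2 _ _)).trans ?_
    rw [hX.integral_add hY, integral_const_mul, integral_const_mul, ← mul_add, mul_assoc]
    gcongr
    linarith
  have k2 : indepExp μ (word T P m) (fun x => word T P l (T^[m + d] x))
      (fun a b => F (wordCentred μ T P m a) (wordCentred μ T P l b) ^ 2) ≤
      2 ^ (2 * q) * (C₁ + C₁) * (n : ℝ) ^ (2 * q) := by
    refine (indepExp_mono hw hw' fun a b => hF2 _ _).trans ?_
    rw [indepExp_add hw hw' (fun a _ => 2 ^ (2 * q) * |wordCentred μ T P m a| ^ (2 * q))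
      (fun _ b => 2 ^ (2 * q) * |wordCentred μ T P l b| ^ (2 * q))]
    simp only [indepExp, integral_const, probReal_univ, one_smul, integral_const_mul]
    rw [← mul_add, mul_assoc]
    have : (∫ x, |wordCentred μ T P m (word T P m x)| ^ (2 * q) ∂μ) +
        ∫ x, |wordCentred μ T P l (word T P l (T^[m + d] x))| ^ (2 * q) ∂μ ≤
        (C₁ + C₁) * (n : ℝ) ^ (2 * q) := by rw [add_mul]; exact add_le_add b1 b2
    gcongr
  refine key.trans ?_
  rw [Real.sqrt_mul zero_le_two]
  have k3 : √(∫ x, F (centred μ T P m x) (centred μ T P l (T^[m + d] x)) ^ 2 ∂μ +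
      indepExp μ (word T P m) (fun x => word T P l (T^[m + d] x))
      (fun a b => F (wordCentred μ T P m a) (wordCentred μ T P l b) ^ 2)) ≤
      √(2 * (2 ^ (2 * q) * (C₁ + C₁))) * (n : ℝ) ^ q := by
    rw [← Real.sqrt_sq (by positivity : (0 : ℝ) ≤ (n : ℝ) ^ q), ← Real.sqrt_mul (by positivity)]
    refine Real.sqrt_le_sqrt ?_
    rw [← pow_mul, mul_comm q 2]
    linarith
  calc _ ≤ √2 * √(ψ d) * (√(2 * (2 ^ (2 * q) * (C₁ + C₁))) * (n : ℝ) ^ q) := by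
        gcongr
        exact k3
    _ = _ := by ring

end IsMixingSystem

end Centred

/-! ### Growth of the entropy and of the variance -/

/-- A gap of length about `n ^ a`. -/
noncomputable def gapLength (a : ℝ) (n : ℕ) : ℕ := ⌈(n : ℝ) ^ a⌉₊

lemma gapLength_pos {a : ℝ} {n : ℕ} (hn : 0 < n) : 0 < gapLength a n :=
  Nat.ceil_pos.2 (Real.rpow_pos_of_pos (by exact_mod_cast hn) _)

lemma rpow_le_gapLength (a : ℝ) (n : ℕ) : (n : ℝ) ^ a ≤ gapLength a n := Nat.le_ceil _

lemma gapLength_le {a : ℝ} (ha : 0 ≤ a) {n : ℕ} (hn : 0 < n) :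
    (gapLength a n : ℝ) ≤ 2 * (n : ℝ) ^ a := by
  have h1 : (1 : ℝ) ≤ (n : ℝ) ^ a := Real.one_le_rpow (by exact_mod_cast hn) ha
  have := (Nat.ceil_lt_add_one (by positivity : 0 ≤ (n : ℝ) ^ a)).le
  rw [gapLength]
  linarith

/-- For a gap of length about `n ^ a` with `q * (1 - a) ≤ p * a / 2`, the dependence of the outer
words contributes to the `q`-th moment of the excess no more than the letters in the gap. -/
lemma sqrt_rate_mul_le {ψ : ℕ → ℝ} {Cψ p : ℝ} (hCψ : 0 ≤ Cψ) (hp : 0 ≤ p)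
    (hψ : ∀ d : ℕ, 0 < d → ψ d ≤ Cψ * (d : ℝ) ^ (-p)) {a : ℝ} {q : ℕ}
    (haq : q * (1 - a) ≤ p * a / 2) {n : ℕ} (hn : 0 < n) :
    √(ψ (gapLength a n)) * (n : ℝ) ^ q ≤ √Cψ * (n : ℝ) ^ (a * q) := by
  have hn0 : (0 : ℝ) < n := by exact_mod_cast hn
  have hn1 : (1 : ℝ) ≤ n := by exact_mod_cast hn
  have h1 : ψ (gapLength a n) ≤ Cψ * ((n : ℝ) ^ (-(a * p / 2))) ^ 2 := by
    refine (hψ _ (gapLength_pos hn)).trans (mul_le_mul_of_nonneg_left ?_ hCψ)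
    calc (gapLength a n : ℝ) ^ (-p) ≤ ((n : ℝ) ^ a) ^ (-p) :=
          Real.rpow_le_rpow_of_nonpos (by positivity) (rpow_le_gapLength a n) (by linarith)
      _ = _ := by
          rw [← Real.rpow_mul hn0.le, ← Real.rpow_natCast, ← Real.rpow_mul hn0.le]
          congr 1
          push_cast
          ring
  have h2 : √(ψ (gapLength a n)) ≤ √Cψ * (n : ℝ) ^ (-(a * p / 2)) := by
    refine (Real.sqrt_le_sqrt h1).trans (le_of_eq ?_)
    rw [Real.sqrt_mul hCψ, Real.sqrt_sq (by positivity)]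
  calc _ ≤ √Cψ * (n : ℝ) ^ (-(a * p / 2)) * (n : ℝ) ^ q := by gcongr
    _ = √Cψ * (n : ℝ) ^ (-(a * p / 2) + q) := by
        rw [Real.rpow_add hn0, Real.rpow_natCast, mul_assoc]
    _ ≤ _ := by
        gcongr
        linarith

section Rates

variable {Ω ι : Type*} [MeasurableSpace Ω] {μ : Measure Ω} [IsProbabilityMeasure μ]
  [Fintype ι] [MeasurableSpace ι] [MeasurableSingletonClass ι] {T : Ω → Ω} {P : Ω → ι} {ψ : ℕ → ℝ}

lemma integral_sub_mean_sq_le {Y : Ω → ℝ} (hY : FiniteValued Y) :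
    ∫ x, (Y x - ∫ y, Y y ∂μ) ^ 2 ∂μ ≤ ∫ x, Y x ^ 2 ∂μ := by
  set c := ∫ y, Y y ∂μ with hc
  have e : ∀ x, (Y x - c) ^ 2 = Y x ^ 2 - (2 * c * Y x - c ^ 2) := fun x => by ring
  simp only [e]
  rw [(hY.pow 2).integral_sub ((hY.const_mul _).sub (FiniteValued.const _)),
    (hY.const_mul _).integral_sub (FiniteValued.const _), integral_const_mul]
  simp only [integral_const, probReal_univ, one_smul, ← hc]
  nlinarith [sq_nonneg c]

/-- Effect of a perturbation on a second moment. -/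
lemma abs_integral_sq_sub_le {Z S R : Ω → ℝ} (hS : FiniteValued S) (hR : FiniteValued R)
    (hZ : ∀ x, Z x = S x + R x) {A B : ℝ} (hA : ∫ x, S x ^ 2 ∂μ ≤ A) (hB : ∫ x, R x ^ 2 ∂μ ≤ B) :
    |∫ x, Z x ^ 2 ∂μ - ∫ x, S x ^ 2 ∂μ| ≤ 2 * (√A * √B) + B := by
  have e : ∀ x, Z x ^ 2 = S x ^ 2 + (2 * (S x * R x) + R x ^ 2) := fun x => by rw [hZ]; ring
  simp only [e]
  rw [(hS.pow 2).integral_add (((hS.mul hR).const_mul 2).add (hR.pow 2)),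
    ((hS.mul hR).const_mul 2).integral_add (hR.pow 2), integral_const_mul, add_sub_cancel_left]
  have h1 := integral_mul_le_sqrt (μ := μ) hS hR
  have h2 : √(∫ x, S x ^ 2 ∂μ) * √(∫ x, R x ^ 2 ∂μ) ≤ √A * √B := by gcongr
  have h3 : 0 ≤ ∫ x, R x ^ 2 ∂μ := integral_nonneg fun x => sq_nonneg _
  refine (abs_add_le _ _).trans ?_
  rw [abs_mul, abs_of_nonneg h3, abs_of_pos (two_pos : (0 : ℝ) < 2)]
  linarith

namespace IsMixingSystem

variable (h : IsMixingSystem μ T P ψ)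
include h

lemma integral_abs_gapDefect_pow_le_rpow {Cψ p : ℝ} (hCψ : 0 ≤ Cψ) (hp : 0 ≤ p)
    (hψ : ∀ d : ℕ, 0 < d → ψ d ≤ Cψ * (d : ℝ) ^ (-p)) {a : ℝ} (ha : 0 ≤ a) {q : ℕ} (hq : q ≠ 0)
    (haq : q * (1 - a) ≤ p * a / 2) :
    ∃ C : ℝ, 0 ≤ C ∧ ∀ n m l : ℕ, 0 < n → 0 < m → 0 < l → l ≤ n →
      ∫ x, |gapDefect μ T P m (gapLength a n) l x| ^ q ∂μ ≤ C * (n : ℝ) ^ (a * q) := by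
  obtain ⟨C, hC, hC'⟩ := h.integral_abs_gapDefect_pow_le hq
  refine ⟨C * (2 ^ q + √Cψ), by positivity, fun n m l hn hm hl hln => ?_⟩
  refine (hC' m _ l hm (gapLength_pos hn) hl).trans ?_
  rw [mul_assoc, add_mul]
  refine mul_le_mul_of_nonneg_left (add_le_add ?_ ?_) hC
  · calc (gapLength a n : ℝ) ^ q ≤ (2 * (n : ℝ) ^ a) ^ q := by
          gcongr
          exact gapLength_le ha hn
      _ = _ := by rw [mul_pow, ← Real.rpow_natCast ((n : ℝ) ^ a), ← Real.rpow_mul (by positivity)]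
  · refine le_trans ?_ (sqrt_rate_mul_le hCψ hp hψ haq hn)
    gcongr

lemma meanInfo_gap (m d l : ℕ) : meanInfo μ T P (m + d + l) - meanInfo μ T P m -
    meanInfo μ T P l = ∫ x, gapDefect μ T P m d l x ∂μ := by
  simp only [gapDefect]
  rw [((h.finiteValued_wordInfo _).sub (h.finiteValued_wordInfo _)).integral_sub
    (h.finiteValued_wordInfo_iterate _ _), (h.finiteValued_wordInfo _).integral_sub
    (h.finiteValued_wordInfo _), (h.finiteValued_wordInfo l).integral_comp_measurePreserving
      (h.preserving.iterate (m + d))]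
  rfl

lemma abs_integral_gapDefect_le (m d l : ℕ) :
    |∫ x, gapDefect μ T P m d l x ∂μ| ≤ ∫ x, |gapDefect μ T P m d l x| ^ 1 ∂μ := by
  simp only [pow_one]
  exact abs_integral_le_integral_abs

lemma abs_meanInfo_add_right_sub_le : ∃ C : ℝ, 0 ≤ C ∧ ∀ m d : ℕ, 0 < d →
    |meanInfo μ T P (m + d) - meanInfo μ T P m| ≤ C * d := by
  obtain ⟨C, hC, hC'⟩ := momentBound_le (ι := ι) 1
  refine ⟨C, hC, fun m d hd => ?_⟩
  have h1 := (integral_wordInfo_add_right_pow_le (μ := μ) h.measurable_map h.measurable m d 1).trans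
    (hC' d hd)
  simp only [pow_one] at h1
  rw [meanInfo, meanInfo, ← (h.finiteValued_wordInfo _).integral_sub (h.finiteValued_wordInfo _)]
  exact abs_integral_le_integral_abs.trans h1

/-- The entropy of the joins grows linearly with a small error: it is almost additive, as a gap of
length about `n ^ (1 / 3)` between two words changes the entropy by no more than its length. -/
lemma exists_meanInfo_linear {Cψ p : ℝ} (hCψ : 0 ≤ Cψ) (hp : 8 ≤ p)
    (hψ : ∀ d : ℕ, 0 < d → ψ d ≤ Cψ * (d : ℝ) ^ (-p)) :
    ∃ L C : ℝ, 0 ≤ C ∧ ∀ n : ℕ, 0 < n →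
      |meanInfo μ T P n - n * L| ≤ C * (n : ℝ) ^ (1 / 3 : ℝ) := by
  obtain ⟨C₁, hC₁, h₁⟩ := h.integral_abs_gapDefect_pow_le_rpow hCψ (by linarith) hψ
    (a := 1 / 3) (q := 1) (by norm_num) one_ne_zero (by norm_num; linarith)
  obtain ⟨C₂, hC₂, h₂⟩ := h.abs_meanInfo_add_right_sub_le
  obtain ⟨C₃, hC₃, h₃⟩ := h.meanInfo_le
  refine exists_linear_of_almost_additive (C := C₁ + (C₂ + C₃) * 2) (by positivity) (by norm_num)
    fun m l hm hl => ?_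
  set n := m + l with hn
  have hn0 : 0 < n := by omega
  set d := gapLength (1 / 3) n with hd
  have hd0 : 0 < d := gapLength_pos hn0
  have hd2 : (d : ℝ) ≤ 2 * (n : ℝ) ^ (1 / 3 : ℝ) := gapLength_le (by norm_num) hn0
  have hnn : 0 ≤ (n : ℝ) ^ (1 / 3 : ℝ) := by positivity
  -- the gap consists of the last `d` letters of the first word, unless that word is short
  rcases lt_or_ge d m with hdm | hdm
  · obtain ⟨m', hm'⟩ : ∃ m', m = m' + d := ⟨m - d, by omega⟩
    have hn' : m' + d + l = n := by omega
    have e1 := h₁ n m' l hn0 (by omega) hl (by omega)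
    have e2 := (h.abs_integral_gapDefect_le m' d l).trans e1
    rw [← h.meanInfo_gap, hn'] at e2
    have e3 := h₂ m' d hd0
    have e4 : meanInfo μ T P n - meanInfo μ T P m - meanInfo μ T P l =
      (meanInfo μ T P n - meanInfo μ T P m' - meanInfo μ T P l) -
      (meanInfo μ T P (m' + d) - meanInfo μ T P m') := by rw [hm']; ring
    rw [e4]
    refine (abs_sub _ _).trans ?_
    simp only [Nat.cast_one, mul_one] at e2
    have : C₂ * d ≤ C₂ * (2 * (n : ℝ) ^ (1 / 3 : ℝ)) := by gcongr
    nlinarith [mul_nonneg hC₃ hnn]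
  · have e1 : |meanInfo μ T P n - meanInfo μ T P l| ≤ C₂ * m := by
      rw [hn, add_comm m l]; exact h₂ l m hm
    have e2 := h₃ m hm
    have e3 := meanInfo_nonneg (μ := μ) (T := T) (P := P) m
    have e4 : (m : ℝ) ≤ 2 * (n : ℝ) ^ (1 / 3 : ℝ) := le_trans (by exact_mod_cast hdm) hd2
    have e5 : meanInfo μ T P n - meanInfo μ T P m - meanInfo μ T P l =
      (meanInfo μ T P n - meanInfo μ T P l) - meanInfo μ T P m := by ring
    rw [e5]
    refine (abs_sub _ _).trans ?_
    rw [abs_of_nonneg e3]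
    have : (C₂ + C₃) * m ≤ (C₂ + C₃) * (2 * (n : ℝ) ^ (1 / 3 : ℝ)) := by gcongr
    nlinarith [mul_nonneg hC₁ hnn]

/-- The sum of the centred informations of two words separated by a gap has almost the variance of
a sum of independent variables. -/
lemma abs_integral_centred_add_sq_le : ∃ C : ℝ, 0 ≤ C ∧ ∀ m d l n : ℕ, 0 < m → 0 < d → 0 < l →
    m ≤ n → l ≤ n →
    |∫ x, (centred μ T P m x + centred μ T P l (T^[m + d] x)) ^ 2 ∂μ -
      (varInfo μ T P m + varInfo μ T P l)| ≤ C * (√(ψ d) * (n : ℝ) ^ 2) := by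
  obtain ⟨C, hC, hC'⟩ := h.abs_integral_centred_sub_le 2
  refine ⟨2 * C, by positivity, fun m d l n hm hd hl hmn hln => ?_⟩
  have h1 := hC' (fun x y => x * y) (fun x y => by
    rw [abs_mul]; nlinarith [abs_nonneg x, abs_nonneg y, mul_nonneg (abs_nonneg x) (abs_nonneg y),
      sq_nonneg (|x| - |y|)]) m d l n hm hd hl hmn hln
  rw [indepExp_mul] at h1
  have h2 : ∫ x, wordCentred μ T P m (word T P m x) ∂μ = 0 := h.integral_centred m
  rw [h2, zero_mul, sub_zero] at h1
  have hX := h.finiteValued_centred m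
  have hY := h.finiteValued_centred_iterate (m + d) l
  have e : ∀ x, (centred μ T P m x + centred μ T P l (T^[m + d] x)) ^ 2 =
      centred μ T P m x ^ 2 + centred μ T P l (T^[m + d] x) ^ 2 +
      2 * (centred μ T P m x * centred μ T P l (T^[m + d] x)) := fun x => by ring
  simp only [e]
  rw [((hX.pow 2).add (hY.pow 2)).integral_add ((hX.mul hY).const_mul 2),
    (hX.pow 2).integral_add (hY.pow 2), h.integral_comp_centred_iterate (fun y => y ^ 2),
    integral_const_mul]
  rw [show ∀ a b c : ℝ, a + b + c - (varInfo μ T P m + varInfo μ T P l) =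
    (a - varInfo μ T P m) + (b - varInfo μ T P l) + c by intros; ring]
  simp only [varInfo, sub_self, zero_add, abs_mul, abs_two]
  linarith

lemma centred_eq_add (m d l : ℕ) (x : Ω) : centred μ T P (m + d + l) x =
    (centred μ T P m x + centred μ T P l (T^[m + d] x)) +
      (gapDefect μ T P m d l x - ∫ y, gapDefect μ T P m d l y ∂μ) := by
  rw [← h.meanInfo_gap, gapDefect]
  simp only [centred]
  ring

lemma varInfo_le_sq : ∃ C : ℝ, 0 ≤ C ∧ ∀ n : ℕ, 0 < n → varInfo μ T P n ≤ C * (n : ℝ) ^ 2 := by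
  obtain ⟨C, hC, hC'⟩ := h.integral_abs_centred_pow_le 2
  exact ⟨C, hC, fun n hn => by simpa only [sq_abs, varInfo] using hC' n hn⟩

/-- Removing letters at the end of a word changes the centred information by little. -/
lemma exists_centred_add_right_eq : ∃ C : ℝ, 0 ≤ C ∧ ∀ m d : ℕ, 0 < d →
    ∃ R : Ω → ℝ, FiniteValued R ∧ ∫ x, R x ^ 2 ∂μ ≤ C * (d : ℝ) ^ 2 ∧
      ∀ x, centred μ T P (m + d) x = centred μ T P m x + R x := by
  obtain ⟨C, hC, hC'⟩ := momentBound_le (ι := ι) 2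
  refine ⟨C, hC, fun m d hd => ?_⟩
  have hF := (h.finiteValued_wordInfo (m + d)).sub (h.finiteValued_wordInfo m)
  refine ⟨_, hF.sub (FiniteValued.const (∫ y, wordInfo μ T P (m + d) y - wordInfo μ T P m y ∂μ)),
    (integral_sub_mean_sq_le hF).trans ?_, fun x => ?_⟩
  · simpa only [sq_abs] using (integral_wordInfo_add_right_pow_le (μ := μ) h.measurable_map
      h.measurable m d 2).trans (hC' d hd)
  · rw [(h.finiteValued_wordInfo _).integral_sub (h.finiteValued_wordInfo _)]
    simp only [centred, meanInfo]
    ring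

/-- Removing letters at the start of a word changes the centred information by little. -/
lemma exists_centred_add_left_eq : ∃ C : ℝ, 0 ≤ C ∧ ∀ m l : ℕ, 0 < m →
    ∃ R : Ω → ℝ, FiniteValued R ∧ ∫ x, R x ^ 2 ∂μ ≤ C * (m : ℝ) ^ 2 ∧
      ∀ x, centred μ T P (m + l) x = centred μ T P l (T^[m] x) + R x := by
  obtain ⟨C, hC, hC'⟩ := momentBound_le (ι := ι) 2
  refine ⟨C, hC, fun m l hm => ?_⟩
  have hF := (h.finiteValued_wordInfo (m + l)).sub (h.finiteValued_wordInfo_iterate m l)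
  refine ⟨_, hF.sub (FiniteValued.const
    (∫ y, wordInfo μ T P (m + l) y - wordInfo μ T P l (T^[m] y) ∂μ)),
    (integral_sub_mean_sq_le hF).trans ?_, fun x => ?_⟩
  · simpa only [sq_abs] using (integral_wordInfo_add_left_pow_le (μ := μ) h.preserving
      h.measurable m l 2).trans (hC' m hm)
  · rw [(h.finiteValued_wordInfo _).integral_sub (h.finiteValued_wordInfo_iterate _ _),
      (h.finiteValued_wordInfo l).integral_comp_measurePreserving (h.preserving.iterate m)]
    simp only [centred, meanInfo]
    ring

end IsMixingSystem

end Rates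

section Variance

variable {Ω ι : Type*} [MeasurableSpace Ω] {μ : Measure Ω} [IsProbabilityMeasure μ]
  [Fintype ι] [MeasurableSpace ι] [MeasurableSingletonClass ι] {T : Ω → Ω} {P : Ω → ι} {ψ : ℕ → ℝ}

namespace IsMixingSystem

variable (h : IsMixingSystem μ T P ψ)
include h

/-- A growth bound for the variance improves the bound on its additivity defect. A gap of length
about `n ^ (1 / 3)` perturbs a variable of variance `O(n ^ θ)` by one of variance `O(n ^ (2 / 3))`,
and the exponent `θ / 2 + 1 / 3` comes from the Cauchy–Schwarz inequality. -/
lemma abs_varInfo_add_sub_le {Cψ p : ℝ} (hCψ : 0 ≤ Cψ) (hp : 8 ≤ p)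
    (hψ : ∀ d : ℕ, 0 < d → ψ d ≤ Cψ * (d : ℝ) ^ (-p)) {θ Cv : ℝ} (hθ : 2 / 3 ≤ θ) (hCv : 0 ≤ Cv)
    (hv : ∀ n : ℕ, 0 < n → varInfo μ T P n ≤ Cv * (n : ℝ) ^ θ) :
    ∃ C : ℝ, 0 ≤ C ∧ ∀ m l : ℕ, 0 < m → 0 < l →
      |varInfo μ T P (m + l) - varInfo μ T P m - varInfo μ T P l| ≤
        C * ((m + l : ℕ) : ℝ) ^ (θ / 2 + 1 / 3) := by
  obtain ⟨C₁, hC₁, h₁⟩ := h.integral_abs_gapDefect_pow_le_rpow hCψ (by linarith) hψ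
    (a := 1 / 3) (q := 2) (by norm_num) two_ne_zero (by norm_num; linarith)
  obtain ⟨C₂, hC₂, h₂⟩ := h.exists_centred_add_right_eq
  obtain ⟨C₃, hC₃, h₃⟩ := h.exists_centred_add_left_eq
  obtain ⟨C₄, hC₄, h₄⟩ := h.abs_integral_centred_add_sq_le
  obtain ⟨C₅, hC₅, h₅⟩ := h.varInfo_le_sq
  set A : ℝ := 2 * Cv + C₄ * √Cψ with hA
  set B : ℝ := C₁ + 4 * C₂ + 4 * C₃ with hB
  have hA0 : 0 ≤ A := by positivity
  have hB0 : 0 ≤ B := by positivity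
  refine ⟨2 * (2 * (√A * √B) + B) + C₄ * √Cψ + 4 * C₅, by positivity, fun m l hm hl => ?_⟩
  set n := m + l with hn
  have hn0 : 0 < n := by omega
  have hnr : (0 : ℝ) < n := by exact_mod_cast hn0
  have hn1 : (1 : ℝ) ≤ n := by exact_mod_cast hn0
  set d := gapLength (1 / 3) n with hd
  have hd0 : 0 < d := gapLength_pos hn0
  have hd2 : (d : ℝ) ≤ 2 * (n : ℝ) ^ (1 / 3 : ℝ) := gapLength_le (by norm_num) hn0
  set e : ℝ := (n : ℝ) ^ (2 / 3 : ℝ) with he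
  have hde : (d : ℝ) ^ 2 ≤ 4 * e := by
    have e1 : ((n : ℝ) ^ (1 / 3 : ℝ)) ^ 2 = e := by
      rw [← Real.rpow_natCast, ← Real.rpow_mul hnr.le]; norm_num [he]
    calc (d : ℝ) ^ 2 ≤ (2 * (n : ℝ) ^ (1 / 3 : ℝ)) ^ 2 := by gcongr
      _ = 4 * e := by rw [mul_pow, e1]; norm_num
  set E : ℝ := (n : ℝ) ^ (θ / 2 + 1 / 3) with hE
  have heE : e ≤ E := Real.rpow_le_rpow_of_exponent_le hn1 (by linarith)
  set N : ℝ := (n : ℝ) ^ θ with hN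
  have heN : e ≤ N := Real.rpow_le_rpow_of_exponent_le hn1 hθ
  have hvN : ∀ j, 0 < j → j ≤ n → varInfo μ T P j ≤ Cv * N := by
    intro j hj hjn
    refine (hv j hj).trans ?_
    have : 0 ≤ θ := by linarith
    rw [hN]
    gcongr
  -- perturbation bound with a main term of second moment `A N` and an error of second moment `B e`
  have hpert : ∀ {Z S R : Ω → ℝ}, FiniteValued S → FiniteValued R → (∀ x, Z x = S x + R x) →
      ∫ x, S x ^ 2 ∂μ ≤ A * N → ∫ x, R x ^ 2 ∂μ ≤ B * e →
      |∫ x, Z x ^ 2 ∂μ - ∫ x, S x ^ 2 ∂μ| ≤ (2 * (√A * √B) + B) * E := by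
    intro Z S R hS hR hZ hSA hRB
    refine (abs_integral_sq_sub_le hS hR hZ hSA hRB).trans ?_
    have e1 : √(A * N) * √(B * e) = √A * √B * E := by
      rw [Real.sqrt_mul hA0, Real.sqrt_mul hB0]
      have e2 : √N * √e = E := by
        rw [← Real.sqrt_mul (by positivity), hN, he, ← Real.rpow_add hnr, Real.sqrt_eq_rpow,
          ← Real.rpow_mul hnr.le, hE]
        congr 1
        ring
      rw [← e2]
      ring
    rw [e1, add_mul]
    have : B * e ≤ B * E := by gcongr
    linarith
  -- the gap consists of the last `d` letters of the first word, unless that word is short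
  rcases lt_or_ge d m with hdm | hdm
  · obtain ⟨m', hm'⟩ : ∃ m', m = m' + d := ⟨m - d, by omega⟩
    have hn' : m' + d + l = n := by omega
    have hm0 : 0 < m' := by omega
    have hY := h.finiteValued_gapDefect m' d l
    have hYB : ∫ x, (gapDefect μ T P m' d l x - ∫ y, gapDefect μ T P m' d l y ∂μ) ^ 2 ∂μ ≤
        B * e := by
      refine (integral_sub_mean_sq_le hY).trans ?_
      have := h₁ n m' l hn0 hm0 hl (by omega)
      simp only [sq_abs] at this
      norm_num at this
      refine this.trans ?_
      gcongr
      linarith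
    have hψe : √(ψ d) * (n : ℝ) ^ 2 ≤ √Cψ * e := by
      have := sqrt_rate_mul_le hCψ (by linarith) hψ (a := 1 / 3) (q := 2)
        (by norm_num; linarith) hn0
      norm_num at this
      exact this
    have hS := h₄ m' d l n hm0 hd0 hl (by omega) (by omega)
    have hS' : C₄ * (√(ψ d) * (n : ℝ) ^ 2) ≤ C₄ * √Cψ * e := by
      rw [mul_assoc]; gcongr
    have hSA : ∫ x, (centred μ T P m' x + centred μ T P l (T^[m' + d] x)) ^ 2 ∂μ ≤ A * N := by
      have e1 := (abs_le.1 hS).2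
      have e2 := hvN m' hm0 (by omega)
      have e3 := hvN l hl (by omega)
      have e4 : C₄ * √Cψ * e ≤ C₄ * √Cψ * N := by gcongr
      rw [hA]
      linarith
    have k1 := hpert ((h.finiteValued_centred m').add (h.finiteValued_centred_iterate (m' + d) l))
      (hY.sub (FiniteValued.const _)) (h.centred_eq_add m' d l) hSA hYB
    obtain ⟨R, hR, hRB, hRe⟩ := h₂ m' d hd0
    have k2 := hpert (h.finiteValued_centred m') hR hRe
      ((hvN m' hm0 (by omega)).trans (by
        have : 0 ≤ C₄ * √Cψ := by positivity
        gcongr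
        linarith)) (hRB.trans (by
        calc C₂ * (d : ℝ) ^ 2 ≤ C₂ * (4 * e) := by gcongr
          _ = (4 * C₂) * e := by ring
          _ ≤ B * e := by gcongr; linarith))
    rw [hn', ← varInfo] at k1
    rw [← hm', ← varInfo, ← varInfo] at k2
    set V := ∫ x, (centred μ T P m' x + centred μ T P l (T^[m' + d] x)) ^ 2 ∂μ with hV
    have e5 : varInfo μ T P n - varInfo μ T P m - varInfo μ T P l =
        (varInfo μ T P n - V) + (V - (varInfo μ T P m' + varInfo μ T P l)) -
        (varInfo μ T P m - varInfo μ T P m') := by ring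
    rw [e5]
    refine (abs_sub _ _).trans (le_trans (add_le_add (abs_add_le _ _) le_rfl) ?_)
    have e6 : C₄ * √Cψ * e ≤ C₄ * √Cψ * E := by gcongr
    have e7 : 0 ≤ C₅ * E := by positivity
    rw [add_mul, add_mul]
    linarith
  · obtain ⟨R, hR, hRB, hRe⟩ := h₃ m l hm
    have hm2 : (m : ℝ) ^ 2 ≤ 4 * e := by
      refine le_trans ?_ hde
      have : (m : ℝ) ≤ d := by exact_mod_cast hdm
      gcongr
    have k := hpert (h.finiteValued_centred_iterate m l) hR hRe
      (by
        rw [h.integral_comp_centred_iterate (fun y => y ^ 2)]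
        refine (hvN l hl (by omega)).trans ?_
        have : 0 ≤ C₄ * √Cψ := by positivity
        gcongr
        linarith) (hRB.trans (by
        calc C₃ * (m : ℝ) ^ 2 ≤ C₃ * (4 * e) := by gcongr
          _ = (4 * C₃) * e := by ring
          _ ≤ B * e := by gcongr; linarith))
    rw [h.integral_comp_centred_iterate (fun y => y ^ 2), ← hn, ← varInfo, ← varInfo] at k
    have e1 := h₅ m hm
    have e2 := varInfo_nonneg (μ := μ) (T := T) (P := P) m
    have e5 : varInfo μ T P n - varInfo μ T P m - varInfo μ T P l =
      (varInfo μ T P n - varInfo μ T P l) - varInfo μ T P m := by ring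
    rw [e5]
    refine (abs_sub _ _).trans ?_
    rw [abs_of_nonneg e2]
    have e6 : C₅ * (m : ℝ) ^ 2 ≤ C₅ * (4 * E) := by gcongr; linarith
    have e7 : 0 ≤ C₄ * √Cψ * E := by positivity
    have e8 : 0 ≤ (2 * (√A * √B) + B) * E := by positivity
    rw [add_mul, add_mul]
    linarith

/-- The variance grows linearly, up to an error of order `n ^ (5 / 6)`. The exponent in the growth
bound is improved step by step along `2`, `4 / 3`, `7 / 6`, `1`. -/
lemma exists_varInfo_linear {Cψ p : ℝ} (hCψ : 0 ≤ Cψ) (hp : 8 ≤ p)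
    (hψ : ∀ d : ℕ, 0 < d → ψ d ≤ Cψ * (d : ℝ) ^ (-p)) :
    ∃ L C : ℝ, 0 ≤ C ∧ ∀ n : ℕ, 0 < n →
      |varInfo μ T P n - n * L| ≤ C * (n : ℝ) ^ (5 / 6 : ℝ) := by
  obtain ⟨C₀, hC₀, h₀⟩ := h.varInfo_le_sq
  obtain ⟨C₁, hC₁, h₁⟩ := h.abs_varInfo_add_sub_le hCψ hp hψ (θ := 2) (by norm_num) hC₀
    (fun n hn => by exact_mod_cast h₀ n hn)
  obtain ⟨C₂, hC₂, h₂⟩ := exists_bound_of_almost_additive hC₁ (by norm_num) h₁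
  obtain ⟨C₃, hC₃, h₃⟩ := h.abs_varInfo_add_sub_le hCψ hp hψ (θ := 2 / 2 + 1 / 3) (by norm_num) hC₂
    (fun n hn => (le_abs_self _).trans (h₂ n hn))
  obtain ⟨C₄, hC₄, h₄⟩ := exists_bound_of_almost_additive (θ := 7 / 6) hC₃ (by norm_num)
    fun m n hm hn => (h₃ m n hm hn).trans (by
      have : (1 : ℝ) ≤ ((m + n : ℕ) : ℝ) := by exact_mod_cast (by omega : 1 ≤ m + n)
      gcongr
      norm_num)
  obtain ⟨C₅, hC₅, h₅⟩ := h.abs_varInfo_add_sub_le hCψ hp hψ (θ := 7 / 6) (by norm_num) hC₄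
    (fun n hn => (le_abs_self _).trans (h₄ n hn))
  obtain ⟨L, C₆, hC₆, h₆⟩ := exists_linear_of_almost_additive hC₅ (by norm_num) h₅
  obtain ⟨C₇, hC₇, h₇⟩ := h.abs_varInfo_add_sub_le hCψ hp hψ (θ := 1) (Cv := |L| + C₆)
    (by norm_num) (by positivity) (fun n hn => by
      have e1 := (abs_le.1 (h₆ n hn)).2
      have hn1 : (1 : ℝ) ≤ n := by exact_mod_cast hn
      have e2 : (n : ℝ) ^ ((7 / 6 : ℝ) / 2 + 1 / 3) ≤ n := by
        conv_rhs => rw [← Real.rpow_one (n : ℝ)]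
        gcongr
        norm_num
      rw [Real.rpow_one]
      have e3 : n * L ≤ n * |L| := by gcongr; exact le_abs_self L
      have e4 : C₆ * (n : ℝ) ^ ((7 / 6 : ℝ) / 2 + 1 / 3) ≤ C₆ * n := by gcongr
      linarith)
  have e : (1 : ℝ) / 2 + 1 / 3 = 5 / 6 := by norm_num
  rw [e] at h₇
  exact exists_linear_of_almost_additive hC₇ (by norm_num) h₇

end IsMixingSystem

end Variance

/-! ### The third absolute moment -/

/-- The constant of the main term is close enough to one for an induction over halves, since
`2 * (1 / 2) ^ (3 / 2) * (5 / 4) < 1`. -/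
lemma abs_add_cube_le (s r : ℝ) : |s + r| ^ 3 ≤ 5 / 4 * |s| ^ 3 + 3375 * |r| ^ 3 := by
  refine (pow_le_pow_left₀ (abs_nonneg _) (abs_add_le s r) 3).trans ?_
  rcases le_total (14 * |r|) |s| with hc | hc
  · have : (|s| + |r|) ^ 3 ≤ (15 / 14 * |s|) ^ 3 := by gcongr; linarith
    have h3 : 0 ≤ |s| ^ 3 := by positivity
    have h4 : 0 ≤ |r| ^ 3 := by positivity
    rw [mul_pow] at this
    linarith
  · have : (|s| + |r|) ^ 3 ≤ (15 * |r|) ^ 3 := by gcongr; linarith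
    have h3 : 0 ≤ |s| ^ 3 := by positivity
    rw [mul_pow] at this
    linarith

section ThirdMoment

variable {Ω ι : Type*} [MeasurableSpace Ω] {μ : Measure Ω} [IsProbabilityMeasure μ]
  [Fintype ι] [MeasurableSpace ι] [MeasurableSingletonClass ι] {T : Ω → Ω} {P : Ω → ι} {ψ : ℕ → ℝ}

/-- The third absolute moment of the centred information of `n` letters. -/
noncomputable def thirdMoment (μ : Measure Ω) (T : Ω → Ω) (P : Ω → ι) (n : ℕ) : ℝ :=
  ∫ x, |centred μ T P n x| ^ 3 ∂μ

namespace IsMixingSystem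

variable (h : IsMixingSystem μ T P ψ)
include h

lemma integral_abs_centred_le_sqrt (n : ℕ) :
    ∫ x, |centred μ T P n x| ∂μ ≤ √(varInfo μ T P n) := by
  have := integral_mul_le_sqrt (μ := μ) ((h.finiteValued_centred n).comp fun y => |y|)
    (FiniteValued.const (1 : ℝ))
  simp only [mul_one, sq_abs, one_pow, integral_const, probReal_univ, smul_eq_mul,
    Real.sqrt_one] at this
  exact (le_abs_self _).trans this

/-- The third absolute moment of a sum of two independent centred informations. -/
lemma indepExp_abs_add_cube_le (m k l : ℕ) :
    indepExp μ (word T P m) (fun x => word T P l (T^[k] x))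
      (fun a b => |wordCentred μ T P m a + wordCentred μ T P l b| ^ 3) ≤
    thirdMoment μ T P m + thirdMoment μ T P l + 3 * (varInfo μ T P m * √(varInfo μ T P l)) +
      3 * (√(varInfo μ T P m) * varInfo μ T P l) := by
  have hw := h.measurable_word m
  have hw' := h.measurable_word_iterate k l
  set u := wordCentred μ T P m with hu
  set w := wordCentred μ T P l with hw₀
  have e : ∀ a b, |u a + w b| ^ 3 ≤
      ((|u a| ^ 3 * 1 + 1 * |w b| ^ 3) + (3 * u a ^ 2) * |w b|) + (3 * |u a|) * w b ^ 2 := by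
    intro a b
    calc |u a + w b| ^ 3 ≤ (|u a| + |w b|) ^ 3 := by gcongr; exact abs_add_le _ _
      _ = _ := by rw [← sq_abs (u a), ← sq_abs (w b)]; ring
  refine (indepExp_mono hw hw' e).trans ?_
  rw [indepExp_add hw hw' (fun a b => (|u a| ^ 3 * 1 + 1 * |w b| ^ 3) + (3 * u a ^ 2) * |w b|),
    indepExp_add hw hw' (fun a b => |u a| ^ 3 * 1 + 1 * |w b| ^ 3),
    indepExp_add hw hw' (fun a _ => |u a| ^ 3 * 1),
    indepExp_mul (fun a => |u a| ^ 3) (fun _ => 1), indepExp_mul (fun _ => 1) (fun b => |w b| ^ 3),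
    indepExp_mul (fun a => 3 * u a ^ 2) (fun b => |w b|),
    indepExp_mul (fun a => 3 * |u a|) (fun b => w b ^ 2), integral_const_mul, integral_const_mul]
  have i1 : ∫ x, |w (word T P l (T^[k] x))| ^ 3 ∂μ = thirdMoment μ T P l :=
    h.integral_comp_centred_iterate (fun y => |y| ^ 3) k l
  have i2 : ∫ x, |w (word T P l (T^[k] x))| ∂μ ≤ √(varInfo μ T P l) :=
    (h.integral_comp_centred_iterate (fun y => |y|) k l).le.trans (h.integral_abs_centred_le_sqrt l)
  have i3 : ∫ x, w (word T P l (T^[k] x)) ^ 2 ∂μ = varInfo μ T P l :=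
    h.integral_comp_centred_iterate (fun y => y ^ 2) k l
  have i4 : ∫ x, |u (word T P m x)| ^ 3 ∂μ = thirdMoment μ T P m := rfl
  have i5 : ∫ x, |u (word T P m x)| ∂μ ≤ √(varInfo μ T P m) := h.integral_abs_centred_le_sqrt m
  have i6 : ∫ x, u (word T P m x) ^ 2 ∂μ = varInfo μ T P m := rfl
  rw [i1, i3, i4, i6]
  simp only [integral_const, probReal_univ, one_smul, mul_one, one_mul]
  have v1 := varInfo_nonneg (μ := μ) (T := T) (P := P) m
  have v2 := varInfo_nonneg (μ := μ) (T := T) (P := P) l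
  have j1 := mul_le_mul_of_nonneg_left i2 v1
  have j2 := mul_le_mul_of_nonneg_right i5 v2
  linarith

/-- The third absolute moment is of the order `n ^ (3 / 2)`, by induction on `n`: a word is cut
into two halves that are separated by a gap of length about `n ^ (3 / 7)`. -/
lemma exists_thirdMoment_le {Cψ p : ℝ} (hCψ : 0 ≤ Cψ) (hp : 8 ≤ p)
    (hψ : ∀ d : ℕ, 0 < d → ψ d ≤ Cψ * (d : ℝ) ^ (-p)) {Cv : ℝ} (hCv : 0 ≤ Cv)
    (hv : ∀ n : ℕ, 0 < n → varInfo μ T P n ≤ Cv * n) :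
    ∃ C : ℝ, 0 ≤ C ∧ ∀ n : ℕ, 0 < n → thirdMoment μ T P n ≤ C * (n : ℝ) ^ (3 / 2 : ℝ) := by
  obtain ⟨C₁, hC₁, h₁⟩ := h.integral_abs_gapDefect_pow_le_rpow hCψ (by linarith) hψ
    (a := 3 / 7) (q := 3) (by norm_num) three_ne_zero (by norm_num; linarith)
  obtain ⟨C₂, hC₂, h₂⟩ := h.integral_abs_gapDefect_pow_le_rpow hCψ (by linarith) hψ
    (a := 3 / 7) (q := 1) (by norm_num) one_ne_zero (by norm_num; linarith)
  obtain ⟨C₃, hC₃, h₃⟩ := h.abs_integral_centred_sub_le 3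
  obtain ⟨C₄, hC₄, h₄⟩ := h.integral_abs_centred_pow_le 3
  set K : ℝ := 5 / 4 * (6 * (Cv * √Cv) + C₃ * √Cψ) + 3375 * (8 * (C₁ + C₂ ^ 3)) with hK
  have hK0 : 0 ≤ K := by positivity
  set A : ℝ := 10 * K + 64 * C₄ with hA
  have hA0 : 0 ≤ A := by positivity
  refine ⟨A, hA0, fun n => ?_⟩
  induction n using Nat.strong_induction_on with
  | _ n ih =>
    intro hn
    have hnr : (0 : ℝ) < n := by exact_mod_cast hn
    have hn1 : (1 : ℝ) ≤ n := by exact_mod_cast hn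
    set s : ℝ := (n : ℝ) ^ (3 / 2 : ℝ) with hs
    have hs0 : 0 < s := by positivity
    have hss : (n : ℝ) ^ 3 = s * s := by
      rw [hs, ← Real.rpow_add hnr, ← Real.rpow_natCast]; norm_num
    have hsq : (n : ℝ) * √n = s := by
      rw [hs, Real.sqrt_eq_rpow]
      conv_lhs => rw [← Real.rpow_one (n : ℝ), ← Real.rpow_mul hnr.le, ← Real.rpow_add hnr]
      norm_num
    rcases lt_or_ge n 16 with hsmall | hbig
    · refine (h₄ n hn).trans ?_
      have e1 : s ≤ 64 := by
        have hn16 : (n : ℝ) ≤ 16 := by exact_mod_cast hsmall.le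
        have : √(n : ℝ) ≤ 4 := by
          rw [Real.sqrt_le_left (by norm_num)]; linarith
        rw [← hsq]
        nlinarith [Real.sqrt_nonneg (n : ℝ)]
      rw [hss]
      calc C₄ * (s * s) ≤ C₄ * (64 * s) := by gcongr
        _ ≤ A * s := by rw [hA]; nlinarith [mul_nonneg hK0 hs0.le]
    · set d := gapLength (3 / 7) n with hd
      have hd0 : 0 < d := gapLength_pos hn
      have hd2 : (d : ℝ) ≤ 2 * (n : ℝ) ^ (3 / 7 : ℝ) := gapLength_le (by norm_num) hn
      have hdn : d + 2 ≤ n := by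
        have e1 : (n : ℝ) ^ (3 / 7 : ℝ) ≤ √n := by
          rw [Real.sqrt_eq_rpow]
          exact Real.rpow_le_rpow_of_exponent_le hn1 (by norm_num)
        have e2 : 4 ≤ √(n : ℝ) := Real.le_sqrt_of_sq_le (by
          have : (16 : ℝ) ≤ n := by exact_mod_cast hbig
          linarith)
        have e3 := Real.mul_self_sqrt hnr.le
        have : (d : ℝ) + 2 ≤ n := by nlinarith
        exact_mod_cast this
      set m := (n - d) / 2 with hm
      set l := n - d - m with hl
      have hm0 : 0 < m := by omega
      have hl0 : 0 < l := by omega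
      have hn' : m + d + l = n := by omega
      have hhalf : ∀ j : ℕ, 0 < j → 2 * j ≤ n → thirdMoment μ T P j ≤ A * (36 / 100 * s) := by
        intro j hj hjn
        refine (ih j (by omega) hj).trans (mul_le_mul_of_nonneg_left ?_ hA0)
        have hj2 : (j : ℝ) ≤ 1 / 2 * n := by
          have : (2 * j : ℝ) ≤ n := by exact_mod_cast hjn
          linarith
        have e1 : (1 / 2 : ℝ) ^ (3 / 2 : ℝ) ≤ 36 / 100 := by
          have e2 : (1 / 2 : ℝ) ^ (3 / 2 : ℝ) = 1 / 2 * √(1 / 2) := by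
            rw [Real.sqrt_eq_rpow]
            conv_rhs => rw [← Real.rpow_one_add' (by norm_num) (by norm_num)]
            norm_num
          have e3 : √(1 / 2 : ℝ) ≤ 72 / 100 := by
            rw [Real.sqrt_le_left (by norm_num)]; norm_num
          rw [e2]
          linarith
        calc (j : ℝ) ^ (3 / 2 : ℝ) ≤ (1 / 2 * n : ℝ) ^ (3 / 2 : ℝ) := by gcongr
          _ = (1 / 2 : ℝ) ^ (3 / 2 : ℝ) * s := by rw [Real.mul_rpow (by norm_num) hnr.le]
          _ ≤ _ := by gcongr
      have b1 := hhalf m hm0 (by omega)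
      have b2 := hhalf l hl0 (by omega)
      have hg : (n : ℝ) ^ (3 / 7 * (3 : ℕ) : ℝ) ≤ s := by
        exact Real.rpow_le_rpow_of_exponent_le hn1 (by norm_num)
      have y1 : ∫ x, |gapDefect μ T P m d l x| ^ 3 ∂μ ≤ C₁ * s :=
        (h₁ n m l hn hm0 hl0 (by omega)).trans (by gcongr)
      have y2 : |∫ x, gapDefect μ T P m d l x ∂μ| ^ 3 ≤ C₂ ^ 3 * s := by
        have e1 := (h.abs_integral_gapDefect_le m d l).trans (h₂ n m l hn hm0 hl0 (by omega))
        calc _ ≤ (C₂ * (n : ℝ) ^ (3 / 7 * (1 : ℕ) : ℝ)) ^ 3 := by gcongr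
          _ = C₂ ^ 3 * (n : ℝ) ^ (3 / 7 * (3 : ℕ) : ℝ) := by
            rw [mul_pow, ← Real.rpow_natCast ((n : ℝ) ^ _), ← Real.rpow_mul hnr.le]
            norm_num
          _ ≤ _ := by gcongr
      set c := ∫ x, gapDefect μ T P m d l x ∂μ with hc
      have hY := h.finiteValued_gapDefect m d l
      have hS := (h.finiteValued_centred m).add (h.finiteValued_centred_iterate (m + d) l)
      have hS3 := (hS.comp fun y => |y| ^ 3).const_mul (5 / 4)
      have hY3 := (((hY.comp fun y => |y| ^ 3).add
        (FiniteValued.const (|c| ^ 3))).const_mul 8).const_mul 3375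
      have z1 : thirdMoment μ T P n ≤
          5 / 4 * ∫ x, |centred μ T P m x + centred μ T P l (T^[m + d] x)| ^ 3 ∂μ +
          3375 * (8 * (∫ x, |gapDefect μ T P m d l x| ^ 3 ∂μ + |c| ^ 3)) := by
        have := integral_le_integral_of_ae (μ := μ)
          ((h.finiteValued_centred n).comp fun y => |y| ^ 3) (hS3.add hY3)
          (ae_of_all _ fun x => by
            have e1 := h.centred_eq_add m d l x
            rw [hn'] at e1
            rw [e1]
            refine (abs_add_cube_le _ _).trans ?_
            have e2 := pow_add_le_two_pow (abs_nonneg (gapDefect μ T P m d l x)) (abs_nonneg c) 3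
            have e3 : |gapDefect μ T P m d l x - c| ^ 3 ≤
              (|gapDefect μ T P m d l x| + |c|) ^ 3 := by gcongr; exact abs_sub _ _
            rw [show (2 : ℝ) ^ 3 = 8 by norm_num] at e2
            linarith)
        rw [hS3.integral_add hY3, integral_const_mul, integral_const_mul, integral_const_mul,
          (hY.comp fun y => |y| ^ 3).integral_add (FiniteValued.const _)] at this
        simpa [thirdMoment] using this
      have z2 := (abs_le.1 (h₃ (fun x y => |x + y| ^ 3) (fun x y => by
        rw [abs_of_nonneg (by positivity)]
        gcongr
        exact abs_add_le _ _) m d l n hm0 hd0 hl0 (by omega) (by omega))).2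
      have z3 := h.indepExp_abs_add_cube_le m (m + d) l
      have hψe : C₃ * (√(ψ d) * (n : ℝ) ^ 3) ≤ C₃ * √Cψ * s := by
        have := sqrt_rate_mul_le hCψ (by linarith) hψ (a := 3 / 7) (q := 3)
          (by norm_num; linarith) hn
        rw [mul_assoc]
        refine mul_le_mul_of_nonneg_left (this.trans ?_) hC₃
        gcongr
      have hvn : ∀ j, 0 < j → j ≤ n → varInfo μ T P j ≤ Cv * n := fun j hj hjn =>
        (hv j hj).trans (by gcongr)
      have hsn : ∀ j, 0 < j → j ≤ n → √(varInfo μ T P j) ≤ √Cv * √n := fun j hj hjn => by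
        rw [← Real.sqrt_mul hCv]
        exact Real.sqrt_le_sqrt (hvn j hj hjn)
      have w1 : varInfo μ T P m * √(varInfo μ T P l) ≤ Cv * √Cv * s := by
        rw [← hsq]
        calc _ ≤ (Cv * n) * (√Cv * √n) := by
              gcongr
              exacts [hvn m hm0 (by omega), hsn l hl0 (by omega)]
          _ = _ := by ring
      have w2 : √(varInfo μ T P m) * varInfo μ T P l ≤ Cv * √Cv * s := by
        rw [← hsq]
        calc _ ≤ (√Cv * √n) * (Cv * n) := by
              gcongr
              exacts [varInfo_nonneg l, hsn m hm0 (by omega), hvn l hl0 (by omega)]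
          _ = _ := by ring
      -- the two halves contribute `5 / 4 * (2 * (36 / 100)) = 9 / 10` of the bound
      have fin : thirdMoment μ T P n ≤ 9 / 10 * (A * s) + K * s := by
        rw [hK]
        linarith
      have : K * s ≤ A / 10 * s := by
        gcongr
        rw [hA]
        linarith
      linarith

end IsMixingSystem

end ThirdMoment

/-! ### The Kolmogorov–Sinai theorem -/

section KolmogorovSinai

variable {Ω α β ι κ : Type*} [MeasurableSpace Ω] {μ : Measure Ω} [IsProbabilityMeasure μ]
  [Fintype α] [MeasurableSpace α] [MeasurableSingletonClass α]
  [Fintype β] [MeasurableSpace β] [MeasurableSingletonClass β]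
  [Fintype ι] [MeasurableSpace ι] [MeasurableSingletonClass ι]
  [Fintype κ] [MeasurableSpace κ] [MeasurableSingletonClass κ]
  {T : Ω → Ω} {P : Ω → ι} {Q : Ω → κ}

lemma infoMoment_eq_integral (hT : Measurable T) (hP : Measurable P) (q n : ℕ) :
    infoMoment T μ P q n = ∫ x, wordInfo μ T P n x ^ q ∂μ := by
  have h1 := integral_comp_eq_sum (μ := μ) (measurable_word hT hP n)
    (fun w => (-Real.log (μ.real (word T P n ⁻¹' {w}))) ^ q)
  have h2 : ∫ x, wordInfo μ T P n x ^ q ∂μ = _ := h1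
  rw [h2, infoMoment]
  refine Finset.sum_congr rfl fun w _ => ?_
  rw [joinCylinder_eq_preimage, Real.rpow_natCast, abs_of_nonpos]
  exact Real.log_nonpos measureReal_nonneg measureReal_le_one

lemma joinEntropy_eq_meanInfo (hT : Measurable T) (hP : Measurable P) (n : ℕ) :
    joinEntropy T μ P n = meanInfo μ T P n := by
  have := infoMoment_eq_integral (μ := μ) hT hP 1 n
  simpa only [joinEntropy, meanInfo, Nat.cast_one, pow_one] using this

/-- Gibbs' inequality: the entropy of `f` is at most the entropy of `g` plus the expected code
length of `f` given `g`, for any sub-Markov kernel `Θ`. -/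
lemma integral_info_le_add_kernel {f : Ω → α} {g : Ω → β} (hf : Measurable f) (hg : Measurable g)
    {Θ : α → β → ℝ} (hpos : ∀ a b, 0 < Θ a b) (hsum : ∀ b, ∑ a, Θ a b ≤ 1) :
    ∫ x, info μ f x ∂μ ≤ ∫ x, info μ g x ∂μ + ∫ x, -Real.log (Θ (f x) (g x)) ∂μ := by
  have hF := FiniteValued.info (μ := μ) hf
  have hG := FiniteValued.info (μ := μ) hg
  have hΘ : FiniteValued (fun x => Θ (f x) (g x)) :=
    (FiniteValued.of_finite (hf.prodMk hg)).comp fun z => Θ z.1 z.2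
  have hL := hΘ.comp fun y => -Real.log y
  have hE := ((hF.sub hG).sub hL)
  have h1 : ∫ x, Real.exp (info μ f x - info μ g x - -Real.log (Θ (f x) (g x))) ∂μ ≤ 1 := by
    have h2 : ∀ᵐ x ∂μ, Real.exp (info μ f x - info μ g x - -Real.log (Θ (f x) (g x))) ≤
        fiberProb μ g x * Θ (f x) (g x) / fiberProb μ f x := by
      filter_upwards [fiberProb_pos_ae (μ := μ) f, fiberProb_pos_ae (μ := μ) g] with x hx hy
      rw [info, info, show ∀ a b c : ℝ, -a - -b - -c = b + c - a by intros; ring,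
        Real.exp_sub, Real.exp_add, Real.exp_log hx, Real.exp_log hy, Real.exp_log (hpos _ _)]
    refine (integral_le_integral_of_ae (hE.comp Real.exp)
      (((FiniteValued.fiberProb hg).mul hΘ).comp₂ (FiniteValued.fiberProb hf) (· / ·)) h2).trans ?_
    have h3 := integral_prodMk_eq_sum (μ := μ) hf hg (fun a b => μ.real (g ⁻¹' {b}) * Θ a b /
      μ.real (f ⁻¹' {a}))
    have h4 : ∫ x, fiberProb μ g x * Θ (f x) (g x) / fiberProb μ f x ∂μ = _ := h3
    rw [h4, Fintype.sum_prod_type_right]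
    calc _ ≤ ∑ b, ∑ a, μ.real (g ⁻¹' {b}) * Θ a b := by
          refine Finset.sum_le_sum fun b _ => Finset.sum_le_sum fun a _ => ?_
          have hb : 0 ≤ μ.real (g ⁻¹' {b}) * Θ a b :=
            mul_nonneg measureReal_nonneg (hpos a b).le
          rw [mul_div_left_comm]
          refine mul_le_of_le_one_right hb (div_le_one_of_le₀ ?_ measureReal_nonneg)
          exact measureReal_mono Set.inter_subset_left
      _ ≤ ∑ b, μ.real (g ⁻¹' {b}) := by
          refine Finset.sum_le_sum fun b _ => ?_
          rw [← Finset.mul_sum]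
          exact mul_le_of_le_one_right measureReal_nonneg (hsum b)
      _ = 1 := sum_measureReal_preimage hg
  have h5 : ∫ x, (info μ f x - info μ g x - -Real.log (Θ (f x) (g x)) + 1) ∂μ ≤ 1 :=
    (integral_le_integral_of_ae (hE.add (FiniteValued.const _)) (hE.comp Real.exp)
      (ae_of_all _ fun x => Real.add_one_le_exp _)).trans h1
  rw [hE.integral_add (FiniteValued.const _), (hF.sub hG).integral_sub hL,
    hF.integral_sub hG] at h5
  simp only [integral_const, probReal_univ, one_smul] at h5
  linarith

/-- If the partition `Q` agrees with a function of `r` letters of `P` outside a set of measure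
`ε`, then the entropy of `Q` exceeds that of `P` by little. -/
lemma meanInfo_le_of_approx (hT : MeasurePreserving T μ μ) (hP : Measurable P) (hQ : Measurable Q)
    {r : ℕ} {g : (Fin r → ι) → κ} {ε : ℝ} (hε : 0 < ε) (hε1 : ε < 1)
    (hg : μ.real {x | Q x ≠ g (word T P r x)} ≤ ε) (n : ℕ) :
    meanInfo μ T Q n ≤ meanInfo μ T P (n + r) +
      n * (-Real.log (1 - ε) + ε * (Real.log (Fintype.card κ) - Real.log ε)) := by
  classical
  have hne : Nonempty κ := (nonempty_of_isProbabilityMeasure μ).map Q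
  have hK1 : (1 : ℝ) ≤ Fintype.card κ := by exact_mod_cast Fintype.card_pos (α := κ)
  have hK : (0 : ℝ) < Fintype.card κ := by linarith
  -- the code gives weight `1 - ε` to the guess `g` and spreads `ε` uniformly over all values
  set θ : κ → κ → ℝ := fun i c => if i = c then 1 - ε else ε / Fintype.card κ with hθ
  have hθpos : ∀ i c, 0 < θ i c := by
    intro i c
    simp only [hθ]
    split_ifs
    · linarith
    · positivity
  have hθsum : ∀ c, ∑ i, θ i c ≤ 1 := by
    intro c
    calc ∑ i, θ i c ≤ ∑ i, ((if i = c then 1 - ε else 0) + ε / Fintype.card κ) := by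
          refine Finset.sum_le_sum fun i _ => ?_
          simp only [hθ]
          split_ifs
          · have : 0 < ε / Fintype.card κ := by positivity
            linarith
          · linarith
      _ = 1 := by
          rw [Finset.sum_add_distrib]
          simp
          field_simp
          ring
  set sub : (Fin (n + r) → ι) → Fin n → Fin r → ι := fun b j i => b ⟨j + i, by omega⟩ with hsub
  have hsubw : ∀ x (j : Fin n), sub (word T P (n + r) x) j = word T P r (T^[(j : ℕ)] x) := by
    intro x j
    funext i
    simp only [hsub, word]
    rw [← Function.iterate_add_apply, add_comm]
  have key := integral_info_le_add_kernel (μ := μ) (measurable_word hT.measurable hQ n)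
    (measurable_word hT.measurable hP (n + r)) (Θ := fun a b => ∏ j, θ (a j) (g (sub b j)))
    (fun a b => Finset.prod_pos fun j _ => hθpos _ _) (fun b => by
      rw [← Fintype.prod_sum (fun j i => θ i (g (sub b j)))]
      exact Finset.prod_le_one (fun j _ => Finset.sum_nonneg fun i _ => (hθpos _ _).le)
        fun j _ => hθsum _)
  refine key.trans (add_le_add le_rfl ?_)
  have hbad : FiniteValued fun x => θ (Q x) (g (word T P r x)) :=
    ((FiniteValued.of_finite hQ).prodMk (FiniteValued.of_finite
      (measurable_word hT.measurable hP r))).comp fun z => θ z.1 (g z.2)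
  have hlog := hbad.comp fun y => -Real.log y
  have e1 : ∀ x, -Real.log (∏ j, θ (word T Q n x j) (g (sub (word T P (n + r) x) j))) =
      ∑ j : Fin n, -Real.log (θ (Q (T^[(j : ℕ)] x)) (g (word T P r (T^[(j : ℕ)] x)))) := by
    intro x
    rw [Real.log_prod fun j _ => (hθpos _ _).ne', ← Finset.sum_neg_distrib]
    simp only [hsubw]
    rfl
  simp only [e1]
  rw [integral_finsetSum (f := fun (j : Fin n) x =>
    -Real.log (θ (Q (T^[(j : ℕ)] x)) (g (word T P r (T^[(j : ℕ)] x))))) _ fun j _ =>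
    (hlog.comp_measurable (hT.measurable.iterate (j : ℕ))).integrable]
  have e2 : ∀ j : Fin n, ∫ x, -Real.log (θ (Q (T^[(j : ℕ)] x)) (g (word T P r (T^[(j : ℕ)] x)))) ∂μ
      = ∫ x, -Real.log (θ (Q x) (g (word T P r x))) ∂μ := fun j =>
    hlog.integral_comp_measurePreserving (hT.iterate j)
  simp only [e2, Finset.sum_const, Finset.card_univ, Fintype.card_fin, nsmul_eq_mul]
  refine mul_le_mul_of_nonneg_left ?_ (Nat.cast_nonneg n)
  have hc : 0 ≤ Real.log (Fintype.card κ) - Real.log ε := by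
    have := Real.log_nonneg hK1
    have := Real.log_nonpos hε.le hε1.le
    linarith
  have hind : FiniteValued fun x => if Q x ≠ g (word T P r x) then (1 : ℝ) else 0 :=
    ((FiniteValued.of_finite hQ).prodMk (FiniteValued.of_finite
      (measurable_word hT.measurable hP r))).comp fun z => if z.1 ≠ g z.2 then (1 : ℝ) else 0
  have e3 : ∫ x, -Real.log (θ (Q x) (g (word T P r x))) ∂μ ≤
      ∫ x, (-Real.log (1 - ε) + (Real.log (Fintype.card κ) - Real.log ε) *
        if Q x ≠ g (word T P r x) then (1 : ℝ) else 0) ∂μ := by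
    refine integral_le_integral_of_ae hlog
      ((FiniteValued.const _).add (hind.const_mul _)) (ae_of_all _ fun x => ?_)
    have hl : 0 ≤ -Real.log (1 - ε) :=
      neg_nonneg.2 (Real.log_nonpos (by linarith) (by linarith))
    simp only [hθ]
    by_cases h1 : Q x = g (word T P r x)
    · simp [h1]
    · simp only [h1, if_false, ne_eq, not_false_eq_true, if_true]
      rw [Real.log_div hε.ne' hK.ne']
      linarith
  refine e3.trans ?_
  rw [(FiniteValued.const _).integral_add (hind.const_mul _), integral_const_mul]
  have e4 : ∫ x, (if Q x ≠ g (word T P r x) then (1 : ℝ) else 0) ∂μ ≤ ε := by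
    refine le_trans (le_of_eq ?_) hg
    rw [← integral_indicator_one]
    · congr 1
      funext x
      simp [Set.indicator]
    · have := hind.measurable (measurableSet_singleton 1)
      refine this.congr ?_
      ext x
      simp
  simp only [integral_const, probReal_univ, one_smul]
  rw [mul_comm ε]
  gcongr

/-- The σ-algebra of a standard Borel space is generated by the words of a generating partition. -/
lemma generateFrom_words_eq [StandardBorelSpace Ω] (hT : Measurable T)
    (hP : Measurable P) (hgen : IsGenerating T P) :
    (inferInstance : MeasurableSpace Ω) = MeasurableSpace.generateFrom
      {A | ∃ (r : ℕ) (S : Set (Fin r → ι)), A = word T P r ⁻¹' S} := by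
  refine le_antisymm ?_ (MeasurableSpace.generateFrom_le ?_)
  · set φ : Ω → ℕ → ι := fun x j => P (T^[j] x) with hφ
    have hφm : Measurable φ := measurable_pi_lambda _ fun j => hP.comp (hT.iterate j)
    have hφi : Function.Injective φ := by
      intro x y hxy
      have : x ∈ {z | ∀ j : ℕ, P (T^[j] z) = P (T^[j] y)} := fun j => congrFun hxy j
      rw [hgen y] at this
      exact this
    have hemb := hφm.measurableEmbedding hφi
    rw [← hemb.comap_eq]
    rw [← measurable_iff_comap_le]
    refine @measurable_pi_lambda _ _ _ (MeasurableSpace.generateFrom _) _ _ fun j => ?_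
    intro s _
    refine MeasurableSpace.measurableSet_generateFrom ⟨j + 1, {w | w ⟨j, by omega⟩ ∈ s}, ?_⟩
    ext x
    simp [hφ, word]
  · rintro _ ⟨r, S, rfl⟩
    exact measurable_word hT hP r (Set.toFinite S).measurableSet

lemma isSetRing_words : IsSetRing
    {A | ∃ (r : ℕ) (S : Set (Fin r → ι)), A = word T P r ⁻¹' S} := by
  have hlift : ∀ {r r' : ℕ} (_ : r ≤ r') (S : Set (Fin r → ι)), ∃ S' : Set (Fin r' → ι),
      word T P r ⁻¹' S = word T P r' ⁻¹' S' := fun {r r'} hr S =>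
    ⟨{w | (fun i : Fin r => w ⟨i, by omega⟩) ∈ S}, by ext x; rfl⟩
  refine ⟨⟨0, ∅, by simp⟩, ?_, ?_⟩
  · rintro _ _ ⟨r, S, rfl⟩ ⟨r', S', rfl⟩
    obtain ⟨A, hA⟩ := hlift (le_max_left r r') S
    obtain ⟨B, hB⟩ := hlift (le_max_right r r') S'
    exact ⟨max r r', A ∪ B, by rw [hA, hB, Set.preimage_union]⟩
  · rintro _ _ ⟨r, S, rfl⟩ ⟨r', S', rfl⟩
    obtain ⟨A, hA⟩ := hlift (le_max_left r r') S
    obtain ⟨B, hB⟩ := hlift (le_max_right r r') S'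
    exact ⟨max r r', A \ B, by rw [hA, hB]; rfl⟩

/-- Every finite partition is approximated by functions of finitely many letters of a generating
partition. -/
lemma exists_word_approx [StandardBorelSpace Ω] (hT : Measurable T)
    (hP : Measurable P) (hgen : IsGenerating T P) (hQ : Measurable Q) {ε : ℝ} (hε : 0 < ε) :
    ∃ (r : ℕ) (g : (Fin r → ι) → κ), μ.real {x | Q x ≠ g (word T P r x)} ≤ ε := by
  classical
  have hne : Nonempty κ := (nonempty_of_isProbabilityMeasure μ).map Q
  have h1 : ∀ i : κ, ∃ (r : ℕ) (S : Set (Fin r → ι)),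
      μ.real (symmDiff (word T P r ⁻¹' S) (Q ⁻¹' {i})) ≤ ε / Fintype.card κ := by
    intro i
    obtain ⟨t, ⟨r, S, rfl⟩, hlt⟩ := exists_measure_symmDiff_lt_of_generateFrom_isSetRing (μ := μ)
      (isSetRing_words (T := T) (P := P))
      ⟨{Set.univ}, Set.countable_singleton _, by
        rintro _ rfl; exact ⟨0, Set.univ, by simp⟩, by simp⟩
      (generateFrom_words_eq hT hP hgen) (hQ (measurableSet_singleton i))
      (ε := ENNReal.ofReal (ε / Fintype.card κ)) (ENNReal.ofReal_pos.2 (by positivity))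
    refine ⟨r, S, ?_⟩
    rw [measureReal_def]
    exact ENNReal.toReal_le_of_le_ofReal (by positivity) hlt.le
  choose r S hS using h1
  set R := Finset.univ.sup r with hR
  have hrR : ∀ i, r i ≤ R := fun i => Finset.le_sup (Finset.mem_univ i)
  set mem : κ → (Fin R → ι) → Prop := fun i w =>
    (fun j : Fin (r i) => w ⟨j, j.2.trans_le (hrR i)⟩) ∈ S i with hmem
  have hmemw : ∀ i x, mem i (word T P R x) ↔ x ∈ word T P (r i) ⁻¹' S i := fun i x => Iff.rfl
  refine ⟨R, fun w => if hw : ∃ i, mem i w then hw.choose else hne.some, ?_⟩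
  have hsub : {x | Q x ≠ (fun w => if hw : ∃ i, mem i w then hw.choose else hne.some)
      (word T P R x)} ⊆ ⋃ i, symmDiff (word T P (r i) ⁻¹' S i) (Q ⁻¹' {i}) := by
    intro x hx
    by_contra hcon
    simp only [Set.mem_iUnion, not_exists, Set.mem_symmDiff, not_or, not_and, not_not] at hcon
    have hm : ∀ i, mem i (word T P R x) ↔ Q x = i := fun i => by
      rw [hmemw]
      exact ⟨fun h => (hcon i).1 h, fun h => (hcon i).2 h⟩
    have hex : ∃ i, mem i (word T P R x) := ⟨Q x, (hm _).2 rfl⟩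
    apply hx
    simp only [dif_pos hex]
    exact (hm _).1 hex.choose_spec
  calc _ ≤ μ.real (⋃ i, symmDiff (word T P (r i) ⁻¹' S i) (Q ⁻¹' {i})) := measureReal_mono hsub
    _ ≤ ∑ i, μ.real (symmDiff (word T P (r i) ⁻¹' S i) (Q ⁻¹' {i})) :=
        measureReal_iUnion_fintype_le _
    _ ≤ ∑ _i : κ, ε / Fintype.card κ := Finset.sum_le_sum fun i _ => hS i
    _ = ε := by
      simp only [Finset.sum_const, Finset.card_univ, nsmul_eq_mul]
      field_simp

/-- The cost per letter in `meanInfo_le_of_approx` vanishes as `ε → 0`. -/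
lemma exists_small_code_length (c : ℝ) {η : ℝ} (hη : 0 < η) :
    ∃ ε : ℝ, 0 < ε ∧ ε < 1 ∧ -Real.log (1 - ε) + ε * (c - Real.log ε) < η := by
  have h1 : Tendsto (fun ε : ℝ => -Real.log (1 - ε) + (ε * c - ε * Real.log ε)) (𝓝 0) (𝓝 0) := by
    have e1 : ContinuousAt (fun ε : ℝ => -Real.log (1 - ε) + (ε * c - ε * Real.log ε)) 0 := by
      refine ContinuousAt.add (ContinuousAt.neg (ContinuousAt.log (by fun_prop) (by norm_num)))
        (ContinuousAt.sub (by fun_prop) Real.continuous_mul_log.continuousAt)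
    simpa [ContinuousAt] using e1
  have h2 := (h1.mono_left (nhdsWithin_le_nhds (s := Set.Ioi 0))).eventually (gt_mem_nhds hη)
  have h3 : ∀ᶠ ε : ℝ in 𝓝[>] 0, ε ∈ Set.Ioo (0 : ℝ) 1 := Ioo_mem_nhdsGT one_pos
  obtain ⟨ε, hlt, hmem⟩ := (h2.and h3).exists
  exact ⟨ε, hmem.1, hmem.2, by linarith⟩

/-- The metric entropy is the entropy of a generating partition: any other partition is nearly a
function of finitely many of its letters, so that its entropy is not larger. -/
lemma metricEntropy_eq [StandardBorelSpace Ω] {k : ℕ} {P : Ω → Fin k}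
    (hT : MeasurePreserving T μ μ) (hP : Measurable P) (hgen : IsGenerating T P) {L : ℝ}
    (hL : Tendsto (fun n : ℕ => meanInfo μ T P n / n) atTop (𝓝 L)) :
    metricEntropy T μ = ENNReal.ofReal L := by
  have hPe : partitionEntropy T μ P = ENNReal.ofReal L := by
    rw [partitionEntropy]
    simp only [joinEntropy_eq_meanInfo hT.measurable hP]
    exact ((ENNReal.continuous_ofReal.tendsto L).comp hL).limsup_eq
  refine le_antisymm ?_ ?_
  · rw [metricEntropy]
    refine iSup_le fun k' => iSup_le fun Q => iSup_le fun hQ => ?_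
    refine ENNReal.le_of_forall_pos_le_add fun η hη _ => ?_
    obtain ⟨ε, hε, hε1, hεη⟩ := exists_small_code_length (Real.log (Fintype.card (Fin k')))
      (NNReal.coe_pos.2 hη)
    obtain ⟨r, g, hg⟩ := exists_word_approx (μ := μ) hT.measurable hP hgen hQ hε
    have hbound : ∀ n : ℕ, 0 < n → joinEntropy T μ Q n / n ≤
        meanInfo μ T P (n + r) / ((n + r : ℕ) : ℝ) * (((n + r : ℕ) : ℝ) / n) + η := by
      intro n hn
      have hn' : (0 : ℝ) < n := by exact_mod_cast hn
      have hnr : (0 : ℝ) < ((n + r : ℕ) : ℝ) := by exact_mod_cast (by omega : 0 < n + r)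
      rw [joinEntropy_eq_meanInfo hT.measurable hQ, div_mul_div_cancel₀ hnr.ne',
        div_le_iff₀ hn', add_mul, div_mul_cancel₀ _ hn'.ne']
      have := meanInfo_le_of_approx hT hP hQ hε hε1 hg n
      have h2 := mul_le_mul_of_nonneg_left hεη.le hn'.le
      linarith
    have hlim : Tendsto (fun n : ℕ => meanInfo μ T P (n + r) / ((n + r : ℕ) : ℝ) *
        (((n + r : ℕ) : ℝ) / n) + η) atTop (𝓝 (L * 1 + η)) := by
      refine Tendsto.add_const _ (Tendsto.mul (hL.comp (tendsto_add_atTop_nat r)) ?_)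
      have h1 : Tendsto (fun n : ℕ => 1 + (r : ℝ) / n) atTop (𝓝 (1 + 0)) :=
        (tendsto_const_div_atTop_nhds_zero_nat (r : ℝ)).const_add 1
      rw [add_zero] at h1
      refine h1.congr' ?_
      filter_upwards [eventually_gt_atTop 0] with n hn
      have hn' : (n : ℝ) ≠ 0 := by exact_mod_cast hn.ne'
      push_cast
      rw [add_div, div_self hn']
    have hL0 : 0 ≤ L := ge_of_tendsto' hL fun n =>
      div_nonneg (meanInfo_nonneg n) (Nat.cast_nonneg n)
    have hlim' := (ENNReal.continuous_ofReal.tendsto _).comp hlim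
    calc partitionEntropy T μ Q ≤ limsup (fun n : ℕ => ENNReal.ofReal
          (meanInfo μ T P (n + r) / ((n + r : ℕ) : ℝ) * (((n + r : ℕ) : ℝ) / n) + η)) atTop := by
          refine limsup_le_limsup ?_
          filter_upwards [eventually_gt_atTop 0] with n hn
          exact ENNReal.ofReal_le_ofReal (hbound n hn)
      _ = ENNReal.ofReal (L * 1 + η) := hlim'.limsup_eq
      _ = ENNReal.ofReal L + η := by
          rw [mul_one, ENNReal.ofReal_add hL0 η.coe_nonneg, ENNReal.ofReal_coe_nnreal]
  · rw [← hPe, metricEntropy]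
    exact le_iSup_of_le k (le_iSup_of_le P (le_iSup_of_le hP le_rfl))

end KolmogorovSinai

/-! ### The normal distribution function -/

/-- The standard normal density. -/
noncomputable def normalDensity (x : ℝ) : ℝ := 1 / √(2 * Real.pi) * Real.exp (-x ^ 2 / 2)

lemma integrable_exp_neg_sq_div_two : Integrable fun s : ℝ => Real.exp (-s ^ 2 / 2) := by
  have := integrable_exp_neg_mul_sq (b := 1 / 2) (by norm_num)
  refine this.congr (ae_of_all _ fun s => ?_)
  simp only
  congr 1
  ring

lemma integral_exp_neg_sq_div_two : ∫ s : ℝ, Real.exp (-s ^ 2 / 2) = √(2 * Real.pi) := by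
  have := integral_gaussian (1 / 2)
  rw [show Real.pi / (1 / 2) = 2 * Real.pi by ring] at this
  rw [← this]
  congr 1
  funext s
  congr 1
  ring

lemma sqrt_two_pi_pos : 0 < √(2 * Real.pi) := Real.sqrt_pos.2 (by positivity)

lemma two_le_sqrt_two_pi : 2 ≤ √(2 * Real.pi) :=
  Real.le_sqrt_of_sq_le (by linarith [Real.pi_gt_three])

lemma normalDensity_nonneg (x : ℝ) : 0 ≤ normalDensity x := by
  unfold normalDensity; positivity

lemma normalDensity_le_exp (x : ℝ) : normalDensity x ≤ Real.exp (-x ^ 2 / 2) := by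
  refine mul_le_of_le_one_left (Real.exp_pos _).le ?_
  rw [div_le_one sqrt_two_pi_pos]
  linarith [two_le_sqrt_two_pi]

lemma hasDerivAt_normalDensity (x : ℝ) : HasDerivAt normalDensity (-x * normalDensity x) x := by
  have h1 : HasDerivAt (fun x : ℝ => -x ^ 2 / 2) (-x) x := by
    have := ((hasDerivAt_pow 2 x).neg).div_const 2
    exact this.congr_deriv (by simp; ring)
  have h2 := (h1.exp).const_mul (1 / √(2 * Real.pi))
  exact h2.congr_deriv (by unfold normalDensity; ring)

lemma hasDerivAt_neg_mul_normalDensity (x : ℝ) :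
    HasDerivAt (fun x => -x * normalDensity x) ((x ^ 2 - 1) * normalDensity x) x := by
  have := (hasDerivAt_id x).neg.mul (hasDerivAt_normalDensity x)
  exact this.congr_deriv (by simp; ring)

lemma hasDerivAt_normalDistribution (x : ℝ) :
    HasDerivAt normalDistribution (normalDensity x) x := by
  have hI := integrable_exp_neg_sq_div_two
  have hc : Continuous fun s : ℝ => Real.exp (-s ^ 2 / 2) := by fun_prop
  have h1 : HasDerivAt (fun t => ∫ s in (0 : ℝ)..t, Real.exp (-s ^ 2 / 2))
      (Real.exp (-x ^ 2 / 2)) x :=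
    intervalIntegral.integral_hasDerivAt_right (hc.intervalIntegrable _ _)
      (hc.stronglyMeasurableAtFilter _ _) hc.continuousAt
  have h2 : normalDistribution = fun t => 1 / √(2 * Real.pi) *
      ((∫ s in Set.Iic (0 : ℝ), Real.exp (-s ^ 2 / 2)) +
        ∫ s in (0 : ℝ)..t, Real.exp (-s ^ 2 / 2)) := by
    funext t
    rw [normalDistribution, ← intervalIntegral.integral_Iic_sub_Iic hI.integrableOn hI.integrableOn]
    ring
  rw [h2]
  exact (h1.const_add _).const_mul _

lemma normalDistribution_mono : Monotone normalDistribution :=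
  monotone_of_hasDerivAt_nonneg hasDerivAt_normalDistribution normalDensity_nonneg

lemma normalDistribution_nonneg (x : ℝ) : 0 ≤ normalDistribution x :=
  mul_nonneg (by positivity) (integral_nonneg fun s => (Real.exp_pos _).le)

lemma normalDistribution_add_neg (x : ℝ) : normalDistribution x + normalDistribution (-x) = 1 := by
  have h1 := intervalIntegral.integral_Iic_add_Ioi (b := x)
    (integrable_exp_neg_sq_div_two.integrableOn)
    (integrable_exp_neg_sq_div_two.integrableOn)
  have h2 := integral_comp_neg_Iic (-x) fun s : ℝ => Real.exp (-s ^ 2 / 2)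
  simp only [neg_neg, neg_sq] at h2
  rw [integral_exp_neg_sq_div_two] at h1
  rw [normalDistribution, normalDistribution, h2, ← mul_add, h1]
  exact one_div_mul_cancel sqrt_two_pi_pos.ne'

lemma normalDistribution_le_one (x : ℝ) : normalDistribution x ≤ 1 := by
  have := normalDistribution_add_neg x
  linarith [normalDistribution_nonneg (-x)]

lemma abs_normalDistribution_le_one (x : ℝ) : |normalDistribution x| ≤ 1 := by
  rw [abs_of_nonneg (normalDistribution_nonneg x)]
  exact normalDistribution_le_one x

lemma normalDistribution_neg_le (K : ℝ) : normalDistribution (-K) ≤ Real.exp (-K) := by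
  have h1 : ∫ s in Set.Iic (-K), Real.exp (-s ^ 2 / 2) ≤
      ∫ s in Set.Iic (-K), Real.exp (1 / 2) * Real.exp s := by
    refine setIntegral_mono integrable_exp_neg_sq_div_two.integrableOn
      ((integrableOn_exp_Iic _).const_mul _) fun s => ?_
    simp only
    rw [← Real.exp_add]
    -- `-s ^ 2 / 2 ≤ 1 / 2 + s`
    exact Real.exp_le_exp.2 (by nlinarith [sq_nonneg (s + 1)])
  rw [integral_const_mul, integral_exp_Iic] at h1
  have h2 : Real.exp (1 / 2) ≤ 2 := by
    rw [← Real.le_log_iff_exp_le two_pos]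
    linarith [Real.log_two_gt_d9]
  have h3 := two_le_sqrt_two_pi
  rw [normalDistribution, one_div, inv_mul_le_iff₀ sqrt_two_pi_pos]
  refine h1.trans (mul_le_mul_of_nonneg_right (h2.trans h3) (Real.exp_pos _).le)

lemma sq_mul_normalDensity_le (x : ℝ) : x ^ 2 * normalDensity x ≤ 2 := by
  have h1 := normalDensity_le_exp x
  have h2 := Real.add_one_le_exp (x ^ 2 / 2)
  have h3 : Real.exp (-x ^ 2 / 2) * Real.exp (x ^ 2 / 2) = 1 := by
    rw [← Real.exp_add]; simp [neg_div]
  have h4 : x ^ 2 * Real.exp (-x ^ 2 / 2) ≤ 2 := by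
    nlinarith
  exact (mul_le_mul_of_nonneg_left h1 (sq_nonneg x)).trans h4

lemma normalDensity_le_one (x : ℝ) : normalDensity x ≤ 1 :=
  (normalDensity_le_exp x).trans (Real.exp_le_one_iff.2 (by nlinarith [sq_nonneg x]))

lemma abs_mul_normalDensity_le (x : ℝ) : |x| * normalDensity x ≤ 2 := by
  have h1 := normalDensity_nonneg x
  have h2 := sq_mul_normalDensity_le x
  have h3 := normalDensity_le_one x
  rw [← sq_abs] at h2
  nlinarith [sq_nonneg (|x| - 1)]

lemma abs_cube_mul_normalDensity_le (x : ℝ) : |x| ^ 3 * normalDensity x ≤ 10 := by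
  have h1 := normalDensity_le_exp x
  have h2 := Real.quadratic_le_exp_of_nonneg (by positivity : 0 ≤ x ^ 2 / 2)
  have h3 : Real.exp (-x ^ 2 / 2) * Real.exp (x ^ 2 / 2) = 1 := by
    rw [← Real.exp_add]; simp [neg_div]
  have h4 : |x| ^ 3 ≤ 10 * Real.exp (x ^ 2 / 2) := by
    rw [← sq_abs] at h2 ⊢
    nlinarith [sq_nonneg (|x| ^ 2 - |x|), sq_nonneg (|x| ^ 2), sq_nonneg (|x| - 1), abs_nonneg x]
  calc _ ≤ (10 * Real.exp (x ^ 2 / 2)) * Real.exp (-x ^ 2 / 2) :=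
        mul_le_mul h4 h1 (normalDensity_nonneg x) (by positivity)
    _ = 10 := by rw [mul_assoc, mul_comm (Real.exp _), h3, mul_one]

lemma abs_sub_le_of_hasDerivAt {f f' : ℝ → ℝ} {a b M : ℝ}
    (hf : ∀ x ∈ Set.uIcc a b, HasDerivAt f (f' x) x) (hM : ∀ x ∈ Set.uIcc a b, |f' x| ≤ M) :
    |f b - f a| ≤ M * |b - a| :=
  (convex_uIcc a b).norm_image_sub_le_of_norm_hasDerivWithin_le
    (fun x hx => (hf x hx).hasDerivWithinAt) hM Set.left_mem_uIcc Set.right_mem_uIcc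

lemma abs_normalDistribution_sub_le (x y : ℝ) :
    |normalDistribution y - normalDistribution x| ≤ |y - x| := by
  have := abs_sub_le_of_hasDerivAt (a := x) (b := y) (M := 1)
    (fun z _ => hasDerivAt_normalDistribution z)
    (fun z _ => by rw [abs_of_nonneg (normalDensity_nonneg z)]; exact normalDensity_le_one z)
  linarith

lemma abs_le_of_mem_uIcc_zero {u z : ℝ} (hz : z ∈ Set.uIcc 0 u) : |z| ≤ |u| := by
  have := Set.abs_sub_left_of_mem_uIcc hz
  simpa using this

/-- Second-order Taylor expansion of the normal distribution function: the bound for the third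
derivative is integrated three times. -/
lemma abs_normalDistribution_taylor_le (x u : ℝ) :
    |normalDistribution (x + u) - normalDistribution x - normalDensity x * u +
      x * normalDensity x * u ^ 2 / 2| ≤ 3 * |u| ^ 3 := by
  have b3 : ∀ z, |(z ^ 2 - 1) * normalDensity z| ≤ 3 := by
    intro z
    have h1 := sq_mul_normalDensity_le z
    have h2 := normalDensity_le_one z
    have h3 := normalDensity_nonneg z
    have h4 := mul_nonneg (sq_nonneg z) h3
    rw [abs_le]
    constructor <;> linarith
  have s2 : ∀ z, |-(x + z) * normalDensity (x + z) + x * normalDensity x| ≤ 3 * |z| := by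
    intro z
    have := abs_sub_le_of_hasDerivAt (a := x) (b := x + z)
      (fun y _ => hasDerivAt_neg_mul_normalDensity y) (fun y _ => b3 y)
    rw [add_sub_cancel_left] at this
    refine le_trans (le_of_eq ?_) this
    congr 1
    ring
  have s1 : ∀ z, |normalDensity (x + z) - normalDensity x + x * normalDensity x * z| ≤
      3 * |z| ^ 2 := by
    intro z
    have := abs_sub_le_of_hasDerivAt (a := 0) (b := z) (M := 3 * |z|)
      (f := fun y => normalDensity (x + y) - normalDensity x + x * normalDensity x * y)
      (f' := fun y => -(x + y) * normalDensity (x + y) + x * normalDensity x)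
      (fun y _ => by
        have h1 := (hasDerivAt_normalDensity (x + y)).comp_const_add x y
        have h2 := (h1.sub_const (normalDensity x)).add
          ((hasDerivAt_id y).const_mul (x * normalDensity x))
        exact h2.congr_deriv (by simp))
      (fun y hy => (s2 y).trans (by have := abs_le_of_mem_uIcc_zero hy; linarith))
    simp only [add_zero, mul_zero, sub_self, sub_zero] at this
    refine this.trans (le_of_eq (by ring))
  have := abs_sub_le_of_hasDerivAt (a := 0) (b := u) (M := 3 * |u| ^ 2)
    (f := fun y => normalDistribution (x + y) - normalDistribution x - normalDensity x * y +
      x * normalDensity x * y ^ 2 / 2)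
    (f' := fun y => normalDensity (x + y) - normalDensity x + x * normalDensity x * y)
    (fun y _ => by
      have h1 := (hasDerivAt_normalDistribution (x + y)).comp_const_add x y
      have h2 := ((h1.sub_const (normalDistribution x)).sub
        ((hasDerivAt_id y).const_mul (normalDensity x))).add
        (((hasDerivAt_pow 2 y).const_mul (x * normalDensity x)).div_const 2)
      exact h2.congr_deriv (by simp; ring))
    (fun y hy => (s1 y).trans (by
      have := abs_le_of_mem_uIcc_zero hy
      gcongr))
  simp only [add_zero, mul_zero, sub_self, sub_zero, zero_pow two_ne_zero, zero_div] at this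
  refine this.trans (le_of_eq (by ring))

lemma hasDerivAt_div_sqrt (s : ℝ) {w : ℝ} (hw : 0 < w) :
    HasDerivAt (fun w => s / √w) (-(s / √w) / (2 * w)) w := by
  have h1 := (Real.hasDerivAt_sqrt hw.ne').inv (Real.sqrt_pos.2 hw).ne'
  have h2 := h1.const_mul s
  refine h2.congr_deriv ?_
  rw [Real.sq_sqrt hw.le]
  field_simp

/-- First-order expansion of `Φ (s / √w)` in the variance `w`. By the heat equation its linear term
is the expectation of the quadratic term in the Taylor expansion of `Φ ((s - X) / √w)` for a centred
`X` of variance `v`. -/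
lemma abs_normalDistribution_heat_le (s : ℝ) {w v : ℝ} (hw : 0 < w) (hv : 0 ≤ v) :
    |normalDistribution (s / √(w + v)) - normalDistribution (s / √w) +
      s / √w * normalDensity (s / √w) * v / (2 * w)| ≤ 4 * v ^ 2 / w ^ 2 := by
  set F' : ℝ → ℝ := fun w => -(s / √w * normalDensity (s / √w)) / (2 * w) with hF'
  have d1 : ∀ z, 0 < z → HasDerivAt (fun w => normalDistribution (s / √w)) (F' z) z := by
    intro z hz
    have := (hasDerivAt_normalDistribution (s / √z)).comp z (hasDerivAt_div_sqrt s hz)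
    exact this.congr_deriv (by simp only [hF']; ring)
  have d2 : ∀ z, 0 < z → HasDerivAt F'
      ((3 * (s / √z) - (s / √z) ^ 3) * normalDensity (s / √z) / (4 * z ^ 2)) z := by
    intro z hz
    have h1 := (hasDerivAt_neg_mul_normalDensity (s / √z)).comp z (hasDerivAt_div_sqrt s hz)
    have h2 := h1.div ((hasDerivAt_id z).const_mul 2) (by simpa using hz.ne')
    have h3 : F' = fun w => (-(s / √w) * normalDensity (s / √w)) / (2 * w) := by
      funext y
      simp only [hF']
      ring
    rw [h3]
    refine h2.congr_deriv ?_
    simp only [Function.comp, id]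
    field_simp
    ring
  have b2 : ∀ z, w ≤ z →
      |(3 * (s / √z) - (s / √z) ^ 3) * normalDensity (s / √z) / (4 * z ^ 2)| ≤ 4 / w ^ 2 := by
    intro z hz
    have hz0 := hw.trans_le hz
    set y := s / √z
    have h1 := abs_mul_normalDensity_le y
    have h2 := abs_cube_mul_normalDensity_le y
    have h0 := normalDensity_nonneg y
    have h3 : |(3 * y - y ^ 3) * normalDensity y| ≤ 16 := by
      rw [abs_mul, abs_of_nonneg h0]
      calc _ ≤ (3 * |y| + |y| ^ 3) * normalDensity y := by
            gcongr
            refine (abs_sub _ _).trans (le_of_eq ?_)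
            rw [abs_mul, abs_pow, abs_of_pos (by norm_num : (0 : ℝ) < 3)]
        _ ≤ 16 := by linarith
    rw [abs_div, abs_of_pos (by positivity : 0 < 4 * z ^ 2), div_le_div_iff₀ (by positivity)
      (by positivity)]
    have : w ^ 2 ≤ z ^ 2 := by gcongr
    calc _ ≤ 16 * w ^ 2 := by gcongr
      _ ≤ _ := by linarith
  have hz : ∀ {u z : ℝ}, 0 ≤ u → z ∈ Set.uIcc 0 u → 0 ≤ z ∧ z ≤ u := by
    intro u z hu hz
    rwa [Set.uIcc_of_le hu] at hz
  have s1 : ∀ u, 0 ≤ u → |F' (w + u) - F' w| ≤ 4 / w ^ 2 * u := by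
    intro u hu
    have := abs_sub_le_of_hasDerivAt (a := w) (b := w + u) (M := 4 / w ^ 2)
      (fun z hz' => d2 z (by rw [Set.uIcc_of_le (by linarith)] at hz'; linarith [hz'.1]))
      (fun z hz' => b2 z (by rw [Set.uIcc_of_le (by linarith)] at hz'; exact hz'.1))
    rwa [add_sub_cancel_left, abs_of_nonneg hu] at this
  have := abs_sub_le_of_hasDerivAt (a := 0) (b := v) (M := 4 / w ^ 2 * v)
    (f := fun y => normalDistribution (s / √(w + y)) - normalDistribution (s / √w) - F' w * y)
    (f' := fun y => F' (w + y) - F' w)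
    (fun y hy => by
      have h1 := (d1 (w + y) (by linarith [(hz hv hy).1])).comp_const_add w y
      have h2 := (h1.sub_const (normalDistribution (s / √w))).sub
        ((hasDerivAt_id y).const_mul (F' w))
      exact h2.congr_deriv (by simp))
    (fun y hy => (s1 y (hz hv hy).1).trans (by
      have := (hz hv hy).2
      gcongr))
  simp only [add_zero, mul_zero, sub_self, sub_zero, abs_of_nonneg hv] at this
  refine le_trans (le_of_eq ?_) (this.trans (le_of_eq (by ring)))
  congr 1
  simp only [hF']
  ring

/-- Dependence of `Φ (s / √w)` on the variance, uniformly in `s`. -/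
lemma abs_normalDistribution_scale_le (s : ℝ) {w w' : ℝ} (hw : 0 < w) (hw' : 0 < w') :
    |normalDistribution (s / √w') - normalDistribution (s / √w)| ≤ 4 * |w' - w| / w := by
  by_cases hc : w / 2 ≤ w'
  · have := abs_sub_le_of_hasDerivAt (a := w) (b := w') (M := 2 / w)
      (f := fun w => normalDistribution (s / √w))
      (f' := fun w => normalDensity (s / √w) * (-(s / √w) / (2 * w)))
      (fun z hz => by
        have hz0 : 0 < z := lt_of_lt_of_le (lt_min hw hw') hz.1
        exact HasDerivAt.comp (h₂ := normalDistribution) z (hasDerivAt_normalDistribution (s / √z))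
          (hasDerivAt_div_sqrt s hz0))
      (fun z hz => by
        have hz1 : w / 2 ≤ z := le_trans (le_min (by linarith) hc) hz.1
        have hz0 : 0 < z := by linarith
        have h1 := abs_mul_normalDensity_le (s / √z)
        rw [abs_mul, abs_of_nonneg (normalDensity_nonneg _), abs_div, abs_neg,
          abs_of_pos (by linarith : 0 < 2 * z), ← mul_div_assoc, mul_comm (normalDensity _)]
        exact div_le_div₀ (by norm_num) h1 hw (by linarith))
    refine this.trans ?_
    rw [div_mul_eq_mul_div]
    gcongr
    norm_num
  · have h1 : w / 2 ≤ |w' - w| := by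
      rw [abs_of_neg (by linarith)]
      linarith
    have h2 : |normalDistribution (s / √w') - normalDistribution (s / √w)| ≤ 1 := by
      have a1 := normalDistribution_nonneg (s / √w')
      have a2 := normalDistribution_nonneg (s / √w)
      have a3 := normalDistribution_le_one (s / √w')
      have a4 := normalDistribution_le_one (s / √w)
      rw [abs_le]
      constructor <;> linarith
    refine h2.trans ?_
    rw [le_div_iff₀ hw]
    linarith

/-! ### Lindeberg's method for separated blocks -/

section Lindeberg

variable {Ω ι : Type*} [MeasurableSpace Ω] {μ : Measure Ω} [IsProbabilityMeasure μ]
  [Fintype ι] [MeasurableSpace ι] [MeasurableSingletonClass ι] {T : Ω → Ω} {P : Ω → ι} {ψ : ℕ → ℝ}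

/-- Replacing a centred variable of variance `v` by a Gaussian one, in a smoothed indicator. -/
lemma abs_integral_normalDistribution_sub_le {X : Ω → ℝ} (hX : FiniteValued X)
    (h0 : ∫ x, X x ∂μ = 0) (s : ℝ) {w : ℝ} (hw : 0 < w) :
    |∫ x, normalDistribution ((s - X x) / √w) ∂μ -
      normalDistribution (s / √(w + ∫ x, X x ^ 2 ∂μ))| ≤
      3 * (∫ x, |X x| ^ 3 ∂μ) / √w ^ 3 + 4 * (∫ x, X x ^ 2 ∂μ) ^ 2 / w ^ 2 := by
  set v := ∫ x, X x ^ 2 ∂μ with hv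
  have hv0 : 0 ≤ v := integral_nonneg fun x => sq_nonneg _
  set y := s / √w with hy
  have hsw := Real.sqrt_pos.2 hw
  have hXc := hX.const_mul (normalDensity y / √w)
  have hX2 := (hX.pow 2).const_mul (y * normalDensity y / (2 * w))
  have hN := hX.comp fun z => normalDistribution ((s - z) / √w)
  have hA := (hN.add hXc).add hX2
  have e1 : ∀ x, |(normalDistribution ((s - X x) / √w) + normalDensity y / √w * X x +
      y * normalDensity y / (2 * w) * X x ^ 2) - normalDistribution y| ≤
      3 / √w ^ 3 * |X x| ^ 3 := by
    intro x
    have := abs_normalDistribution_taylor_le y (-X x / √w)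
    have e2 : y + -X x / √w = (s - X x) / √w := by rw [hy]; ring
    rw [e2, abs_div, abs_neg, abs_of_pos hsw] at this
    refine le_trans (le_of_eq ?_) (this.trans (le_of_eq (by ring)))
    congr 1
    rw [div_pow, Real.sq_sqrt hw.le]
    field_simp
    ring
  have e3 : |∫ x, ((normalDistribution ((s - X x) / √w) + normalDensity y / √w * X x +
      y * normalDensity y / (2 * w) * X x ^ 2) - normalDistribution y) ∂μ| ≤
      ∫ x, 3 / √w ^ 3 * |X x| ^ 3 ∂μ :=
    abs_integral_le_integral_abs.trans (integral_le_integral_of_ae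
      ((hA.sub (FiniteValued.const _)).comp fun z => |z|)
      ((hX.comp fun z => |z| ^ 3).const_mul _) (ae_of_all _ e1))
  rw [hA.integral_sub (FiniteValued.const _), (hN.add hXc).integral_add hX2,
    hN.integral_add hXc, integral_const_mul, integral_const_mul, integral_const_mul, h0, ← hv] at e3
  simp only [integral_const, probReal_univ, one_smul, mul_zero, add_zero] at e3
  have e4 := abs_normalDistribution_heat_le s hw hv0
  rw [← hy] at e4
  set I := ∫ x, normalDistribution ((s - X x) / √w) ∂μ
  have e5 : I - normalDistribution (s / √(w + v)) =
      (I + y * normalDensity y / (2 * w) * v - normalDistribution y) -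
      (normalDistribution (s / √(w + v)) - normalDistribution y +
        y * normalDensity y * v / (2 * w)) := by ring
  rw [e5]
  refine (abs_sub _ _).trans (add_le_add (e3.trans (le_of_eq (by ring))) e4)

/-- The sum of the centred informations of the first `j` blocks of length `l`, where the gaps
between the blocks have length `d`. -/
noncomputable def blockSum (μ : Measure Ω) (T : Ω → Ω) (P : Ω → ι) (l d j : ℕ) (x : Ω) : ℝ :=
  ∑ i ∈ Finset.range j, centred μ T P l (T^[i * (l + d)] x)

/-- Telescoping, as `x ^ (-3 / 2)` is at most a multiple of the decrement of `x ^ (-1 / 2)`. -/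
lemma sum_inv_sqrt_cube_le {c : ℝ} (hc : 1 ≤ c) (n : ℕ) :
    ∑ i ∈ Finset.range n, 1 / √(c + i) ^ 3 ≤ 6 / √c := by
  have key : ∀ n : ℕ, ∑ i ∈ Finset.range n, 1 / √(c + i) ^ 3 ≤ 6 / √c - 6 / √(c + n) := by
    intro n
    induction n with
    | zero => simp
    | succ n ih =>
      rw [Finset.sum_range_succ]
      set a := √(c + n) with ha
      set b := √(c + (n + 1 : ℕ)) with hb
      have ha2 : a ^ 2 = c + n := Real.sq_sqrt (by linarith)
      have hb2 : b ^ 2 = a ^ 2 + 1 := by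
        rw [ha2, hb, Real.sq_sqrt (by push_cast; linarith)]; push_cast; ring
      have ha0 : 0 < a := Real.sqrt_pos.2 (by linarith)
      have hb0 : 0 < b := Real.sqrt_pos.2 (by push_cast; linarith)
      have hba : b ≤ 3 / 2 * a := by
        refine le_of_sq_le_sq ?_ (by positivity)
        nlinarith
      have h1 : 1 / a ^ 3 ≤ 6 / a - 6 / b := by
        have h2 : 6 / a - 6 / b = 6 / (a * b * (a + b)) := by
          field_simp
          linarith
        rw [h2, div_le_div_iff₀ (by positivity) (by positivity)]
        nlinarith
      linarith
  have := key n
  have h2 : 0 ≤ 6 / √(c + n) := by positivity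
  linarith

namespace IsMixingSystem

variable (h : IsMixingSystem μ T P ψ)
include h

lemma finiteValued_blockSum (l d j : ℕ) : FiniteValued (blockSum μ T P l d j) :=
  FiniteValued.sum _ fun i _ => h.finiteValued_centred_iterate (i * (l + d)) l

omit h in
/-- The sum of the first `j` blocks depends only on the letters up to the end of the `j`-th
block. -/
lemma blockSum_factors {l d j m : ℕ} (hm : j * (l + d) ≤ m + d) {x y : Ω}
    (hxy : word T P m x = word T P m y) : blockSum μ T P l d j x = blockSum μ T P l d j y := by
  refine Finset.sum_congr rfl fun i hi => ?_
  rw [centred_eq, centred_eq]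
  congr 1
  rw [word_iterate_eq_iff]
  rw [word_eq_iff] at hxy
  intro t _ ht
  refine hxy t ?_
  have : (i + 1) * (l + d) ≤ j * (l + d) := Nat.mul_le_mul_right _ (Finset.mem_range.1 hi)
  have e : (i + 1) * (l + d) = i * (l + d) + (l + d) := by ring
  omega

/-- One step of Lindeberg's replacement: the last block is decoupled from the previous ones and
replaced by a Gaussian variable of the same variance. -/
lemma abs_integral_blockSum_step_le {l d : ℕ} (hl : 0 < l) (hd : 0 < d) (j : ℕ) (t : ℝ) {w : ℝ}
    (hw : 0 < w) :
    |∫ x, normalDistribution ((t - blockSum μ T P l d (j + 1) x) / √w) ∂μ -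
      ∫ x, normalDistribution ((t - blockSum μ T P l d j x) / √(w + varInfo μ T P l)) ∂μ| ≤
      2 * ψ d + (3 * thirdMoment μ T P l / √w ^ 3 + 4 * varInfo μ T P l ^ 2 / w ^ 2) := by
  have hstep : ∀ s k, |∫ y, normalDistribution ((s - centred μ T P l (T^[k] y)) / √w) ∂μ -
      normalDistribution (s / √(w + varInfo μ T P l))| ≤
      3 * thirdMoment μ T P l / √w ^ 3 + 4 * varInfo μ T P l ^ 2 / w ^ 2 := by
    intro s k
    rw [h.integral_comp_centred_iterate (fun z => normalDistribution ((s - z) / √w))]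
    exact abs_integral_normalDistribution_sub_le (h.finiteValued_centred l)
      (h.integral_centred l) s hw
  have hψ0 := h.psi_nonneg d
  rcases Nat.eq_zero_or_pos j with rfl | hj
  · simp only [blockSum, Finset.range_one, Finset.sum_singleton, Finset.range_zero,
      Finset.sum_empty, sub_zero, zero_add, integral_const, probReal_univ, one_smul]
    have := hstep t (0 * (l + d))
    linarith
  · obtain ⟨i, rfl⟩ := Nat.exists_eq_succ_of_ne_zero hj.ne'
    set m := i * (l + d) + l with hm
    have hm0 : 0 < m := by omega
    have hmd : (i + 1) * (l + d) = m + d := by rw [hm]; ring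
    have hfac : Function.FactorsThrough (blockSum μ T P l d (i + 1)) (word T P m) :=
      fun x y hxy => blockSum_factors hmd.le hxy
    set u : (Fin m → ι) → ℝ := Function.extend (word T P m) (blockSum μ T P l d (i + 1)) 0 with hu
    have hux : ∀ x, u (word T P m x) = blockSum μ T P l d (i + 1) x := fun x =>
      hfac.extend_apply _ x
    set F : (Fin m → ι) → (Fin l → ι) → ℝ := fun a b =>
      normalDistribution ((t - u a - wordCentred μ T P l b) / √w) with hF
    have e1 := (h.nearlyIndep hm0 hd hl).abs_integral_sub_indepExp_le (h.measurable_word m)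
      (h.measurable_word_iterate (m + d) l) (F := F) (M := 1)
      (fun a b => abs_normalDistribution_le_one _)
    have e2 : ∀ x, F (word T P m x) (word T P l (T^[m + d] x)) =
        normalDistribution ((t - blockSum μ T P l d (i + 1 + 1) x) / √w) := by
      intro x
      simp only [hF, hux, ← centred_eq]
      conv_rhs => rw [blockSum, Finset.sum_range_succ, ← blockSum, hmd, ← sub_sub]
    simp only [e2] at e1
    have e3 : indepExp μ (word T P m) (fun x => word T P l (T^[m + d] x)) F =
        ∫ x, ∫ y, normalDistribution
          ((t - blockSum μ T P l d (i + 1) x - centred μ T P l (T^[m + d] y)) / √w) ∂μ ∂μ := by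
      simp only [indepExp, hF, hux, ← centred_eq]
    have hS := h.finiteValued_blockSum l d (i + 1)
    have hG := hS.comp fun z => ∫ y, normalDistribution
          ((t - z - centred μ T P l (T^[m + d] y)) / √w) ∂μ
    have hG' := hS.comp fun z => normalDistribution ((t - z) / √(w + varInfo μ T P l))
    have e4 : |∫ x, (∫ y, normalDistribution
          ((t - blockSum μ T P l d (i + 1) x - centred μ T P l (T^[m + d] y)) / √w) ∂μ -
          normalDistribution ((t - blockSum μ T P l d (i + 1) x) / √(w + varInfo μ T P l))) ∂μ| ≤
        3 * thirdMoment μ T P l / √w ^ 3 + 4 * varInfo μ T P l ^ 2 / w ^ 2 := by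
      refine abs_integral_le_integral_abs.trans ((integral_le_integral_of_ae
        ((hG.sub hG').comp fun z => |z|) (FiniteValued.const _)
        (ae_of_all _ fun x => hstep _ _)).trans ?_)
      simp
    rw [hG.integral_sub hG', ← e3] at e4
    have e5 := abs_sub_le (∫ x, normalDistribution ((t - blockSum μ T P l d (i + 1 + 1) x) / √w) ∂μ)
      (indepExp μ (word T P m) (fun x => word T P l (T^[m + d] x)) F)
      (∫ x, normalDistribution ((t - blockSum μ T P l d (i + 1) x) / √(w + varInfo μ T P l)) ∂μ)
    rw [Nat.succ_eq_add_one]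
    linarith

/-- Lindeberg's replacement of all blocks, from the last to the first. After `i` steps the Gaussian
part has variance `w + i * varInfo μ T P l`. -/
lemma abs_integral_blockSum_sub_le_sum {l d : ℕ} (hl : 0 < l) (hd : 0 < d) (j : ℕ) (t : ℝ) {w : ℝ}
    (hw : 0 < w) :
    |∫ x, normalDistribution ((t - blockSum μ T P l d j x) / √w) ∂μ -
      normalDistribution (t / √(w + j * varInfo μ T P l))| ≤
      ∑ i ∈ Finset.range j, (2 * ψ d + (3 * thirdMoment μ T P l / √(w + i * varInfo μ T P l) ^ 3 +
        4 * varInfo μ T P l ^ 2 / (w + i * varInfo μ T P l) ^ 2)) := by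
  induction j generalizing w with
  | zero => simp [blockSum]
  | succ j ih =>
    have hv := varInfo_nonneg (μ := μ) (T := T) (P := P) l
    have e1 := h.abs_integral_blockSum_step_le hl hd j t hw
    have e2 := ih (w := w + varInfo μ T P l) (by linarith)
    rw [Finset.sum_range_succ']
    have e3 : ∀ i : ℕ, w + varInfo μ T P l + i * varInfo μ T P l =
        w + ((i + 1 : ℕ) : ℝ) * varInfo μ T P l := fun i => by push_cast; ring
    simp only [e3] at e2
    simp only [Nat.cast_zero, zero_mul, add_zero]
    have e4 := abs_sub_le
      (∫ x, normalDistribution ((t - blockSum μ T P l d (j + 1) x) / √w) ∂μ)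
      (∫ x, normalDistribution ((t - blockSum μ T P l d j x) / √(w + varInfo μ T P l)) ∂μ)
      (normalDistribution (t / √(w + ((j + 1 : ℕ) : ℝ) * varInfo μ T P l)))
    linarith

/-- The smoothed distribution function of the block sum is close to a normal one, when the
smoothing parameter is `v √N`. -/
lemma abs_integral_blockSum_sub_le {l d N : ℕ} (hl : 0 < l) (hd : 0 < d) (hN : 0 < N) {B : ℝ}
    (hv : 0 < varInfo μ T P l) (hB : thirdMoment μ T P l ≤ B * √(varInfo μ T P l) ^ 3) (t : ℝ) :
    |∫ x, normalDistribution ((t - blockSum μ T P l d N x) / √(varInfo μ T P l * √N)) ∂μ -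
      normalDistribution (t / √(varInfo μ T P l * √N + N * varInfo μ T P l))| ≤
      2 * ψ d * N + 6 * (3 * B + 4) / √√N := by
  set v := varInfo μ T P l with hv'
  have hc : 1 ≤ √(N : ℝ) := Real.one_le_sqrt.2 (by exact_mod_cast hN)
  have hB0 : 0 ≤ B := by
    have h1 : 0 ≤ thirdMoment μ T P l := integral_nonneg fun x => by positivity
    have h2 : 0 < √v ^ 3 := by positivity
    by_contra hcon
    have := mul_neg_of_neg_of_pos (not_le.1 hcon) h2
    linarith
  refine (h.abs_integral_blockSum_sub_le_sum hl hd N t (w := v * √N) (by positivity)).trans ?_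
  rw [Finset.sum_add_distrib]
  refine add_le_add (by simp [mul_comm]) ?_
  have e1 : ∀ i ∈ Finset.range N, 3 * thirdMoment μ T P l / √(v * √N + i * v) ^ 3 +
      4 * v ^ 2 / (v * √N + i * v) ^ 2 ≤ (3 * B + 4) * (1 / √(√N + i) ^ 3) := by
    intro i _
    set y := √(N : ℝ) + i with hy
    have hy1 : 1 ≤ y := by have := Nat.cast_nonneg (α := ℝ) i; linarith
    have hy0 : 0 < y := by linarith
    have e2 : v * √N + i * v = v * y := by rw [hy]; ring
    have hsy : 1 ≤ √y := Real.one_le_sqrt.2 hy1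
    rw [e2, Real.sqrt_mul hv.le, mul_pow, add_mul]
    refine add_le_add ?_ ?_
    · have h3 : 0 < √v ^ 3 := by positivity
      rw [mul_one_div, div_le_div_iff₀ (by positivity) (by positivity)]
      calc 3 * thirdMoment μ T P l * √y ^ 3 ≤ 3 * (B * √v ^ 3) * √y ^ 3 := by gcongr
        _ = _ := by ring
    · rw [mul_one_div, div_le_div_iff₀ (by positivity) (by positivity)]
      have h4 : √y ^ 3 ≤ y ^ 2 := by
        have h5 : y ^ 2 = √y ^ 3 * √y := by
          conv_lhs => rw [← Real.sq_sqrt hy0.le]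
          ring
        rw [h5]
        exact le_mul_of_one_le_right (by positivity) hsy
      rw [mul_pow, ← mul_assoc]
      gcongr
  refine (Finset.sum_le_sum e1).trans ?_
  rw [← Finset.mul_sum]
  calc _ ≤ (3 * B + 4) * (6 / √√N) := by
        gcongr
        exact sum_inv_sqrt_cube_le hc N
    _ = _ := by ring

end IsMixingSystem

end Lindeberg

/-! ### From the block sums to the information function -/

section Comparison

variable {Ω ι : Type*} [MeasurableSpace Ω] {μ : Measure Ω} [IsProbabilityMeasure μ]
  [Fintype ι] [MeasurableSpace ι] [MeasurableSingletonClass ι] {T : Ω → Ω} {P : Ω → ι} {ψ : ℕ → ℝ}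

/-- The information of `k + 1` blocks of length `l` that are separated by gaps of length `d` is
the sum of the informations of the blocks, up to the gap defects. -/
lemma wordInfo_blocks_eq (l d k : ℕ) (x : Ω) :
    wordInfo μ T P (k * (l + d) + l) x =
      ∑ i ∈ Finset.range (k + 1), wordInfo μ T P l (T^[i * (l + d)] x) +
        ∑ j ∈ Finset.range k, gapDefect μ T P (j * (l + d) + l) d l x := by
  induction k with
  | zero => simp
  | succ k ih =>
    rw [Finset.sum_range_succ _ (k + 1),
      Finset.sum_range_succ (fun j => gapDefect μ T P (j * (l + d) + l) d l x) k]
    have e1 : (k + 1) * (l + d) + l = k * (l + d) + l + d + l := by ring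
    have e2 : (k + 1) * (l + d) = k * (l + d) + l + d := by ring
    have e3 : gapDefect μ T P (k * (l + d) + l) d l x = wordInfo μ T P ((k + 1) * (l + d) + l) x -
        wordInfo μ T P (k * (l + d) + l) x - wordInfo μ T P l (T^[(k + 1) * (l + d)] x) := by
      rw [e1, e2]; rfl
    linarith

/-- If `Y` is close to `S` off a small set, then its distribution function is squeezed between
smoothed distribution functions of `S`: shifting the argument by `K * ε` makes the smoothed
indicator dominate the sharp one up to `Φ (-K)`. -/
lemma abs_measureReal_le_sub_le_of_close {Y S : Ω → ℝ} (hY : FiniteValued Y) (hS : FiniteValued S)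
    {E K ε q R W V : ℝ} (hE : 0 ≤ E) (hK : 0 ≤ K) (hε : 0 < ε) (hW : 0 < W) (hV : 0 < V)
    (hq : μ.real {x | E < |Y x - S x|} ≤ q)
    (hR : ∀ t, |∫ x, normalDistribution ((t - S x) / ε) ∂μ - normalDistribution (t / √W)| ≤ R)
    (u : ℝ) :
    |μ.real {x | Y x ≤ u} - normalDistribution (u / √V)| ≤
      q + normalDistribution (-K) + R + (E + K * ε) / √V + 4 * |W - V| / V := by
  have hmu : MeasurableSet {x | Y x ≤ u} := measurableSet_le hY.measurable measurable_const
  have hmb : MeasurableSet {x | E < |Y x - S x|} :=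
    measurableSet_lt measurable_const ((hY.sub hS).comp fun z => |z|).measurable
  set A := {x | Y x ≤ u}
  set B := {x | E < |Y x - S x|}
  have hΦ : ∀ t, FiniteValued fun x => normalDistribution ((t - S x) / ε) := fun t =>
    hS.comp fun z => normalDistribution ((t - z) / ε)
  have hIA : Integrable (A.indicator fun _ => (1 : ℝ)) μ := (integrable_const 1).indicator hmu
  have hIB : Integrable (B.indicator fun _ => (1 : ℝ)) μ := (integrable_const 1).indicator hmb
  have eA : ∫ x, A.indicator (fun _ => (1 : ℝ)) x ∂μ = μ.real A := by
    rw [integral_indicator_const _ hmu]; simp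
  have eB : ∫ x, B.indicator (fun _ => (1 : ℝ)) x ∂μ = μ.real B := by
    rw [integral_indicator_const _ hmb]; simp
  have hK' := normalDistribution_add_neg K
  have hsV := Real.sqrt_pos.2 hV
  have hup : μ.real A ≤ ∫ x, normalDistribution ((u + (E + K * ε) - S x) / ε) ∂μ +
      normalDistribution (-K) + μ.real B := by
    have hi := ((hΦ (u + (E + K * ε))).integrable (μ := μ)).add
      (integrable_const (normalDistribution (-K)))
    have e : ∫ x, ((normalDistribution ((u + (E + K * ε) - S x) / ε) + normalDistribution (-K)) +
        B.indicator (fun _ => (1 : ℝ)) x) ∂μ =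
      ∫ x, normalDistribution ((u + (E + K * ε) - S x) / ε) ∂μ +
        normalDistribution (-K) + μ.real B := by
      rw [integral_add (by exact hi) hIB, integral_add (hΦ _).integrable (integrable_const _), eB]
      simp
    rw [← e, ← eA]
    refine integral_mono hIA (hi.add hIB) fun x => ?_
    have h0 := normalDistribution_nonneg ((u + (E + K * ε) - S x) / ε)
    have h1 := normalDistribution_nonneg (-K)
    by_cases hB : x ∈ B
    · have : A.indicator (fun _ => (1 : ℝ)) x ≤ 1 := Set.indicator_le_self' (by simp) x
      simp only [Set.indicator_of_mem hB]
      linarith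
    · by_cases hA : x ∈ A
      · simp only [Set.indicator_of_notMem hB, Set.indicator_of_mem hA]
        have h2 : |Y x - S x| ≤ E := not_lt.1 hB
        have h3 : Y x ≤ u := hA
        have h4 : K ≤ (u + (E + K * ε) - S x) / ε := by
          rw [le_div_iff₀ hε]
          have := neg_le_of_abs_le h2
          linarith
        have := normalDistribution_mono h4
        linarith
      · simp only [Set.indicator_of_notMem hB, Set.indicator_of_notMem hA]
        linarith
  have hlo : ∫ x, normalDistribution ((u - (E + K * ε) - S x) / ε) ∂μ ≤ μ.real A +
      normalDistribution (-K) + μ.real B := by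
    have hi := hIA.add (integrable_const (normalDistribution (-K)))
    have e : ∫ x, ((A.indicator (fun _ => (1 : ℝ)) x + normalDistribution (-K)) +
        B.indicator (fun _ => (1 : ℝ)) x) ∂μ = μ.real A + normalDistribution (-K) + μ.real B := by
      rw [integral_add (by exact hi) hIB, integral_add hIA (integrable_const _), eA, eB]
      simp
    rw [← e]
    refine integral_mono (hΦ _).integrable (hi.add hIB) fun x => ?_
    have h0 := normalDistribution_le_one ((u - (E + K * ε) - S x) / ε)
    have h1 := normalDistribution_nonneg (-K)
    have hA0 : 0 ≤ A.indicator (fun _ => (1 : ℝ)) x := Set.indicator_nonneg (by simp) x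
    by_cases hB : x ∈ B
    · simp only [Set.indicator_of_mem hB]
      linarith
    · by_cases hA : x ∈ A
      · simp only [Set.indicator_of_notMem hB, Set.indicator_of_mem hA]
        linarith
      · simp only [Set.indicator_of_notMem hB, Set.indicator_of_notMem hA]
        have h2 : |Y x - S x| ≤ E := not_lt.1 hB
        have h3 : u < Y x := not_le.1 hA
        have h4 : (u - (E + K * ε) - S x) / ε ≤ -K := by
          rw [div_le_iff₀ hε]
          have := le_of_abs_le h2
          linarith
        have := normalDistribution_mono h4
        linarith
  have hF : 0 ≤ E + K * ε := by positivity
  have hcmp : ∀ s, |s - u| ≤ E + K * ε →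
      |∫ x, normalDistribution ((s - S x) / ε) ∂μ - normalDistribution (u / √V)| ≤
        R + 4 * |W - V| / V + (E + K * ε) / √V := by
    intro s hs
    have h1 := hR s
    have h2 := abs_normalDistribution_scale_le s hV hW
    have h3 := abs_normalDistribution_sub_le (u / √V) (s / √V)
    have h4 : |s / √V - u / √V| ≤ (E + K * ε) / √V := by
      rw [← sub_div, abs_div, abs_of_pos hsV]
      gcongr
    calc _ = |(∫ x, normalDistribution ((s - S x) / ε) ∂μ - normalDistribution (s / √W)) +
          (normalDistribution (s / √W) - normalDistribution (s / √V)) +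
          (normalDistribution (s / √V) - normalDistribution (u / √V))| := by congr 1; ring
      _ ≤ _ := (abs_add_three _ _ _).trans (by linarith)
  have h1 := hcmp (u + (E + K * ε)) (by rw [add_sub_cancel_left, abs_of_nonneg hF])
  have h2 := hcmp (u - (E + K * ε)) (by rw [sub_sub_cancel_left, abs_neg, abs_of_nonneg hF])
  rw [abs_le] at h1 h2 ⊢
  constructor <;> linarith [h1.1, h1.2, h2.1, h2.2]

namespace IsMixingSystem

variable (h : IsMixingSystem μ T P ψ)
include h

/-- Off a set of small measure, the information of `n` letters is the sum of the informations
of the blocks, up to the letters in the gaps and the remaining `r` letters. -/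
lemma measureReal_wordInfo_sub_blockSum_le {l d k r n : ℕ} (hl : 0 < l) (hd : 0 < d)
    (hn : n = k * (l + d) + l + r) {s c η : ℝ} (hs : 0 ≤ s)
    (hη : |(k + 1) * meanInfo μ T P l - c| ≤ η) :
    μ.real {x | k * (d * logCard ι + 2 * s + Real.log 2) + (r * logCard ι + s) + η <
      |(wordInfo μ T P n x - c) - blockSum μ T P l d (k + 1) x|} ≤
      k * (2 * Real.exp (-s) + 2 * ψ d) + Real.exp (-s) := by
  set m := k * (l + d) + l with hm
  subst hn
  set g := d * logCard ι + 2 * s + Real.log 2 with hg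
  set Bad : ℕ → Set Ω := fun j => {x | g < |gapDefect μ T P (j * (l + d) + l) d l x|} with hBad
  set Z := {x | r * logCard ι + s < wordInfo μ T P (m + r) x - wordInfo μ T P m x} with hZ
  have hae := wordInfo_le_add_right (μ := μ) (T := T) (P := P) m r
  have hsub : ∀ᵐ x ∂μ, x ∈ {x | k * g + (r * logCard ι + s) + η <
      |(wordInfo μ T P (m + r) x - c) - blockSum μ T P l d (k + 1) x|} →
      x ∈ (⋃ j ∈ Finset.range k, Bad j) ∪ Z := by
    filter_upwards [hae] with x hx hxE
    by_contra hcon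
    simp only [Set.mem_union, Set.mem_iUnion, not_or, not_exists, hBad, hZ, Set.mem_ofPred_eq,
      not_lt] at hcon
    obtain ⟨h1, h2⟩ := hcon
    refine absurd hxE (not_lt.2 ?_)
    have h3 : |∑ j ∈ Finset.range k, gapDefect μ T P (j * (l + d) + l) d l x| ≤ k * g := by
      refine (Finset.abs_sum_le_sum_abs _ _).trans ((Finset.sum_le_sum h1).trans (le_of_eq ?_))
      simp
    have h4 : wordInfo μ T P (m + r) x - c - blockSum μ T P l d (k + 1) x =
        ∑ j ∈ Finset.range k, gapDefect μ T P (j * (l + d) + l) d l x +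
        (wordInfo μ T P (m + r) x - wordInfo μ T P m x) +
        ((k + 1) * meanInfo μ T P l - c) := by
      rw [hm, wordInfo_blocks_eq]
      simp only [blockSum, centred, Finset.sum_sub_distrib, Finset.sum_const, Finset.card_range,
        nsmul_eq_mul]
      push_cast
      ring
    rw [h4]
    refine (abs_add_three _ _ _).trans ?_
    rw [abs_of_nonneg hx]
    linarith
  have h1 : μ.real {x | k * g + (r * logCard ι + s) + η <
      |(wordInfo μ T P (m + r) x - c) - blockSum μ T P l d (k + 1) x|} ≤
      μ.real ((⋃ j ∈ Finset.range k, Bad j) ∪ Z) :=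
    ENNReal.toReal_mono (measure_ne_top _ _) (measure_mono_ae hsub)
  refine h1.trans ((measureReal_union_le _ _).trans (add_le_add ?_ ?_))
  · refine (measureReal_biUnion_finset_le _ _).trans ?_
    refine (Finset.sum_le_sum fun j _ => h.measureReal_abs_gapDefect_le (by omega) hd hl hs).trans
      (le_of_eq ?_)
    rw [Finset.sum_const, Finset.card_range, nsmul_eq_mul]
  · exact measureReal_wordInfo_add_right_le h.measurable_map h.measurable m r s

/-- Normal approximation of the information of `n` letters, with all error terms explicit: `s` is
the deviation allowed in each gap defect, `η` bounds the error in the centring, and `K` is the shift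
of the argument in units of the smoothing parameter. -/
lemma abs_measureReal_wordInfo_le_sub_le {l d k r n : ℕ} (hl : 0 < l) (hd : 0 < d)
    (hn : n = k * (l + d) + l + r) {s c η K V B : ℝ} (hs : 0 ≤ s) (hη0 : 0 ≤ η)
    (hη : |(k + 1) * meanInfo μ T P l - c| ≤ η) (hK : 0 ≤ K) (hV : 0 < V)
    (hv : 0 < varInfo μ T P l) (hB : thirdMoment μ T P l ≤ B * √(varInfo μ T P l) ^ 3) (u : ℝ) :
    |μ.real {x | wordInfo μ T P n x - c ≤ u} - normalDistribution (u / √V)| ≤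
      (k * (2 * Real.exp (-s) + 2 * ψ d) + Real.exp (-s)) + normalDistribution (-K) +
      (2 * ψ d * (k + 1 : ℕ) + 6 * (3 * B + 4) / √√((k + 1 : ℕ) : ℝ)) +
      ((k * (d * logCard ι + 2 * s + Real.log 2) + (r * logCard ι + s) + η) +
        K * √(varInfo μ T P l * √((k + 1 : ℕ) : ℝ))) / √V +
      4 * |(varInfo μ T P l * √((k + 1 : ℕ) : ℝ) + (k + 1 : ℕ) * varInfo μ T P l) - V| / V := by
  have hc := logCard_nonneg (ι := ι)
  exact abs_measureReal_le_sub_le_of_close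
    ((h.finiteValued_wordInfo n).sub (FiniteValued.const c)) (h.finiteValued_blockSum l d (k + 1))
    (by positivity) hK (by positivity) (by positivity) hV
    (h.measureReal_wordInfo_sub_blockSum_le hl hd hn hs hη)
    (h.abs_integral_blockSum_sub_le hl hd k.succ_pos hv hB) u

/-- The centring of the block sum differs from `n * L` only through the gaps, the remaining `r`
letters, and the error in the growth of the entropy. -/
lemma abs_block_mean_sub_le {l d k r n : ℕ} (hl : 0 < l)
    (hn : n = k * (l + d) + l + r) (hr : 0 < r) {L C₁ C₂ C₃ e₁ e₂ : ℝ}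
    (h₁ : |meanInfo μ T P n - n * L| ≤ C₁ * e₁)
    (h₂ : ∀ m, 0 < m → |meanInfo μ T P (m + d + l) - meanInfo μ T P m -
      meanInfo μ T P l| ≤ C₂ * e₂)
    (h₃ : ∀ m d, 0 < d → |meanInfo μ T P (m + d) - meanInfo μ T P m| ≤ C₃ * d) :
    |(k + 1) * meanInfo μ T P l - n * L| ≤ C₁ * e₁ + k * (C₂ * e₂) + C₃ * r := by
  have key : ∀ j ≤ k, |meanInfo μ T P (j * (l + d) + l) - (j + 1) * meanInfo μ T P l| ≤
      j * (C₂ * e₂) := by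
    intro j
    induction j with
    | zero => intro _; simp
    | succ j ih =>
      intro hj
      have h4 := h₂ (j * (l + d) + l) (by omega)
      have e1 : j * (l + d) + l + d + l = (j + 1) * (l + d) + l := by ring
      rw [e1] at h4
      have h5 := ih (by omega)
      push_cast
      rw [abs_le] at h4 h5 ⊢
      constructor <;> linarith [h4.1, h4.2, h5.1, h5.2]
  have h4 := key k le_rfl
  have h5 := h₃ (k * (l + d) + l) r hr
  rw [← hn] at h5
  rw [abs_le] at h₁ h4 h5 ⊢
  constructor <;> linarith [h₁.1, h₁.2, h4.1, h4.2, h5.1, h5.2]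

end IsMixingSystem

end Comparison

/-! ### Choice of the block lengths -/

section Rate

variable {Ω ι : Type*} [MeasurableSpace Ω] {μ : Measure Ω} [IsProbabilityMeasure μ]
  [Fintype ι] [MeasurableSpace ι] [MeasurableSingletonClass ι] {T : Ω → Ω} {P : Ω → ι} {ψ : ℕ → ℝ}

lemma le_mul_rpow_of_le_rpow {x z α β κ : ℝ} (hx : 1 ≤ x) (hz : z ≤ x ^ α) (h : α ≤ β - κ) :
    z ≤ x ^ β * x ^ (-κ) := by
  rw [← Real.rpow_add (by linarith)]
  exact hz.trans (Real.rpow_le_rpow_of_exponent_le hx (by linarith))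

/-- With `N` about `x ^ (4 * κ)` blocks of length `l` and gaps of length `d` about `x ^ a`, where
`ρ` is the mixing rate over a gap, all error terms are of order `x ^ (-κ)` relative to their scale:
`x` for counts of letters in the variance, and `√x` for deviations. -/
lemma block_rates {x a p κ Cψ ρ N d l : ℝ} (hx1 : 1 ≤ x) (ha0 : 0 < a) (hκ0 : 0 < κ)
    (hκ' : 5 * κ + 3 / 2 * a ≤ 1 / 2) (hp : 0 ≤ p) (hap : a * (p + 2) = 2) (hCψ : 0 ≤ Cψ)
    (hN1' : 1 ≤ N) (hNle : N ≤ x ^ (4 * κ)) (hNge : x ^ (4 * κ) ≤ 16 * N) (hdge : x ^ a ≤ d)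
    (hdle : d ≤ 2 * x ^ a) (hl0 : 0 ≤ l) (hNl : N * l ≤ x) (hρ : ρ ≤ Cψ * d ^ (-p)) :
    N ≤ x * x ^ (-κ) ∧ N * ρ ≤ Cψ * x ^ (-κ) ∧ 1 / √√N ≤ 2 * x ^ (-κ) ∧
      N * d ≤ 2 * (√x * x ^ (-κ)) ∧ x ^ (1 / 3 : ℝ) ≤ √x * x ^ (-κ) ∧
      N * l ^ (5 / 6 : ℝ) ≤ x * x ^ (-κ) := by
  have hx0 : 0 < x := by linarith
  obtain ⟨y, hy⟩ : ∃ y, y = x ^ (-κ) := ⟨_, rfl⟩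
  have hy0 : 0 < y := hy ▸ Real.rpow_pos_of_pos hx0 _
  have hd0 : 0 ≤ d := (Real.rpow_nonneg hx0.le a).trans hdge
  rw [← hy]
  have g1 : N ≤ x * y := by
    simpa [hy] using le_mul_rpow_of_le_rpow (β := 1) (κ := κ) hx1 hNle (by linarith)
  have g2 : N * ρ ≤ Cψ * y := by
    have e1 : d ^ (-p) ≤ x ^ (-(a * p)) := by
      refine (Real.rpow_le_rpow_of_nonpos (by positivity) hdge (by linarith)).trans (le_of_eq ?_)
      rw [← Real.rpow_mul hx0.le]
      ring_nf
    have e2 : N * d ^ (-p) ≤ x ^ (4 * κ - a * p) := by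
      rw [sub_eq_add_neg, Real.rpow_add hx0]
      gcongr
    have e3 := le_mul_rpow_of_le_rpow (β := 0) (κ := κ) hx1 e2 (by linarith)
    rw [← hy, Real.rpow_zero, one_mul] at e3
    calc N * ρ ≤ N * (Cψ * d ^ (-p)) := by gcongr
      _ = Cψ * (N * d ^ (-p)) := by ring
      _ ≤ _ := by gcongr
  have g4 : 1 / √√N ≤ 2 * y := by
    have e1 : x ^ κ ≤ 2 * √√N := by
      have e2 : √√(x ^ (4 * κ)) = x ^ κ := by
        rw [Real.sqrt_eq_rpow, Real.sqrt_eq_rpow, ← Real.rpow_mul hx0.le, ← Real.rpow_mul hx0.le]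
        ring_nf
      have e3 : √√(16 * N) = 2 * √√N := by
        rw [Real.sqrt_mul (by norm_num), Real.sqrt_mul (by positivity),
          show (16 : ℝ) = (2 ^ 2) ^ 2 by norm_num, Real.sqrt_sq (by norm_num),
          Real.sqrt_sq (by norm_num)]
      rw [← e2, ← e3]
      exact Real.sqrt_le_sqrt (Real.sqrt_le_sqrt hNge)
    have e4 : x ^ κ * y = 1 := by rw [hy, ← Real.rpow_add hx0]; simp
    rw [div_le_iff₀ (by positivity)]
    linarith [mul_le_mul_of_nonneg_right e1 hy0.le]
  have g5 : N * d ≤ 2 * (√x * y) := by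
    have e1 : x ^ (4 * κ) * x ^ a ≤ √x * y := by
      rw [Real.sqrt_eq_rpow, hy, ← Real.rpow_add hx0]
      exact le_mul_rpow_of_le_rpow hx1 le_rfl (by linarith)
    calc N * d ≤ x ^ (4 * κ) * (2 * x ^ a) := by gcongr
      _ = 2 * (x ^ (4 * κ) * x ^ a) := by ring
      _ ≤ _ := by gcongr
  have g6 : x ^ (1 / 3 : ℝ) ≤ √x * y := by
    rw [Real.sqrt_eq_rpow, hy]
    exact le_mul_rpow_of_le_rpow hx1 le_rfl (by linarith)
  have g7 : N * l ^ (5 / 6 : ℝ) ≤ x * y := by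
    have e1 : N * l ^ (5 / 6 : ℝ) = N ^ (1 / 6 : ℝ) * (N * l) ^ (5 / 6 : ℝ) := by
      rw [Real.mul_rpow (by positivity) (by positivity), ← mul_assoc,
        ← Real.rpow_add (by positivity)]
      norm_num
    have e2 : N * l ^ (5 / 6 : ℝ) ≤ x ^ (4 * κ * (1 / 6) + 5 / 6) := by
      rw [e1, Real.rpow_add hx0, Real.rpow_mul hx0.le]
      gcongr
    simpa [hy] using le_mul_rpow_of_le_rpow (β := 1) (κ := κ) hx1 e2 (by linarith)
  exact ⟨g1, g2, g4, g5, g6, g7⟩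

/-- The contribution of the gaps, of the centring and of the smoothing. -/
lemma centring_error_le {x y c C₁ C₂ C₃ e N d k r G S v w : ℝ} (hx1 : 1 ≤ x) (hy0 : 0 < y)
    (hc : 0 ≤ c) (hC₁ : 0 ≤ C₁) (hC₂ : 0 ≤ C₂) (hC₃ : 0 ≤ C₃) (hd1 : 1 ≤ d)
    (hkN : k ≤ N) (hk0 : 0 ≤ k) (hG : G = N * d) (hG1 : 1 ≤ G) (hr2 : r ≤ 2 * G)
    (he0 : 0 ≤ e) (hdge : e ≤ d) (hS : 0 < S) (g5 : G ≤ 2 * (√x * y))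
    (g6 : x ^ (1 / 3 : ℝ) ≤ √x * y) (hvw : v ≤ w * (√x * (2 * y))) (hv0 : 0 ≤ v) :
    (k * (d * c + 2 * Real.log x + Real.log 2) + (r * c + Real.log x) +
      (C₁ * x ^ (1 / 3 : ℝ) + k * (C₂ * e) + C₃ * r) + Real.log x * v) / (√x * S) ≤
      ((2 * (3 * c + 4 + C₂ + 2 * C₃) + C₁) + w * 2) / S * ((1 + Real.log x) * y) := by
  have hx0 : 0 < x := by linarith
  have hlog : 0 ≤ Real.log x := Real.log_nonneg hx1
  have hN0 : 0 ≤ N := hk0.trans hkN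
  obtain ⟨Λ, hΛ⟩ : ∃ Λ, Λ = 1 + Real.log x := ⟨_, rfl⟩
  have hΛ1 : 1 ≤ Λ := by linarith
  rw [← hΛ]
  have hlog2 : Real.log 2 ≤ 1 := by have := Real.log_two_lt_d9; linarith
  have hGΛ : G ≤ G * Λ := le_mul_of_one_le_right (by linarith) hΛ1
  have e1 : k * (d * c + 2 * Real.log x + Real.log 2) ≤ (c + 3) * (G * Λ) := by
    calc k * (d * c + 2 * Real.log x + Real.log 2) ≤
          N * (d * (c * Λ) + d * (2 * Real.log x) + d * Λ) := by
          have f1 : c ≤ c * Λ := le_mul_of_one_le_right hc hΛ1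
          have f2 : 2 * Real.log x ≤ d * (2 * Real.log x) :=
            le_mul_of_one_le_left (by positivity) hd1
          have f3 : Λ ≤ d * Λ := le_mul_of_one_le_left (by linarith) hd1
          have f4 : Real.log 2 ≤ d * Λ := by linarith
          gcongr
      _ = G * (c * Λ + 2 * Real.log x + Λ) := by rw [hG]; ring
      _ ≤ G * (c * Λ + 2 * Λ + Λ) := by gcongr; linarith
      _ = _ := by ring
  have e2 : r * c + Real.log x ≤ (2 * c + 1) * (G * Λ) := by
    have f1 : r * c ≤ 2 * (G * Λ) * c := by
      gcongr
      linarith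
    have f2 : Real.log x ≤ G * Λ := by
      have : Λ ≤ G * Λ := le_mul_of_one_le_left (by linarith) hG1
      linarith
    linarith
  have e3 : C₁ * x ^ (1 / 3 : ℝ) ≤ C₁ * (√x * (Λ * y)) := by
    have : y ≤ Λ * y := le_mul_of_one_le_left hy0.le hΛ1
    have : √x * y ≤ √x * (Λ * y) := by gcongr
    gcongr
    linarith
  have e4 : k * (C₂ * e) ≤ C₂ * (G * Λ) := by
    calc k * (C₂ * e) ≤ N * (C₂ * d) := by gcongr
      _ = C₂ * G := by rw [hG]; ring
      _ ≤ _ := by gcongr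
  have e5 : C₃ * r ≤ 2 * C₃ * (G * Λ) := by
    have : C₃ * r ≤ C₃ * (2 * (G * Λ)) := by gcongr; linarith
    linarith
  have e6 : Real.log x * v ≤ w * 2 * (√x * (Λ * y)) := by
    calc Real.log x * v ≤ Λ * (w * (√x * (2 * y))) := by
          gcongr
          linarith
      _ = _ := by ring
  have e7 : G * Λ ≤ 2 * (√x * (Λ * y)) := by
    calc G * Λ ≤ 2 * (√x * y) * Λ := by gcongr
      _ = _ := by ring
  have e8 : (3 * c + 4 + C₂ + 2 * C₃) * (G * Λ) ≤
      (3 * c + 4 + C₂ + 2 * C₃) * (2 * (√x * (Λ * y))) := by gcongr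
  rw [div_le_iff₀ (by positivity)]
  have e9 : ((2 * (3 * c + 4 + C₂ + 2 * C₃) + C₁) + w * 2) / S * (Λ * y) *
      (√x * S) = ((2 * (3 * c + 4 + C₂ + 2 * C₃) + C₁) + w * 2) *
        (√x * (Λ * y)) := by field_simp
  rw [e9]
  linarith

/-- The contribution of the difference between the variance of the blocks and `x * σ2`. -/
lemma variance_error_le {x y σ2 Cv N l d t m G v V : ℝ} (hx0 : 0 < x) (hσ : 0 < σ2)
    (hCv : 0 ≤ Cv) (hN0 : 0 ≤ N) (hV0 : 0 ≤ V) (hV : V ≤ (σ2 + Cv) * 2 * (x * y))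
    (hv : |v - l * σ2| ≤ Cv * m) (g7 : N * m ≤ x * y) (hG : G = N * d) (g9 : G ≤ 2 * (x * y))
    (hNG : N ≤ G) (hNl : N * l ≤ x) (f1 : x = N * (l + d) + t) (f2 : t ≤ N) :
    4 * |(V + N * v) - x * σ2| / (x * σ2) ≤ 4 * ((σ2 + Cv) * 2 + Cv + 4 * σ2) / σ2 * y := by
  have e1 : |V| ≤ (σ2 + Cv) * 2 * (x * y) := by
    rwa [abs_of_nonneg hV0]
  have e2 : |N * (v - l * σ2)| ≤ Cv * (x * y) := by
    rw [abs_mul, abs_of_nonneg hN0]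
    calc N * |v - l * σ2| ≤ N * (Cv * m) := by gcongr
      _ = Cv * (N * m) := by ring
      _ ≤ _ := by gcongr
  have e3 : |(N * l - x) * σ2| ≤ 4 * σ2 * (x * y) := by
    rw [abs_mul, abs_of_pos hσ, abs_of_nonpos (by linarith)]
    have f3 : -(N * l - x) ≤ 4 * (x * y) := by
      have : -(N * l - x) = G + t := by rw [hG]; linarith
      linarith
    calc -(N * l - x) * σ2 ≤ 4 * (x * y) * σ2 := by gcongr
      _ = _ := by ring
  have e4 : |(V + N * v) - x * σ2| ≤
      ((σ2 + Cv) * 2 + Cv + 4 * σ2) * (x * y) := by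
    calc |(V + N * v) - x * σ2| =
          |V + N * (v - l * σ2) + (N * l - x) * σ2| := by congr 1; ring
      _ ≤ _ := (abs_add_three _ _ _).trans (by linarith)
  rw [div_le_iff₀ (by positivity)]
  calc 4 * |(V + N * v) - x * σ2| ≤
        4 * (((σ2 + Cv) * 2 + Cv + 4 * σ2) * (x * y)) := by gcongr
    _ = _ := by field_simp

namespace IsMixingSystem

variable (h : IsMixingSystem μ T P ψ)
include h

/-- For long blocks the variance is positive, and the third absolute moment is bounded by its
`3 / 2`-th power. -/
lemma exists_thirdMoment_le_sqrt_cube {p Cψ σ2 Cv : ℝ} (hp : 8 ≤ p) (hCψ : 0 ≤ Cψ)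
    (hψ : ∀ d : ℕ, 0 < d → ψ d ≤ Cψ * (d : ℝ) ^ (-p)) (hσ : 0 < σ2) (hCv : 0 ≤ Cv)
    (hv : ∀ n : ℕ, 0 < n → |varInfo μ T P n - n * σ2| ≤ Cv * (n : ℝ) ^ (5 / 6 : ℝ)) :
    ∃ B : ℝ, 0 ≤ B ∧ ∀ᶠ l : ℕ in atTop, 0 < varInfo μ T P l ∧
      thirdMoment μ T P l ≤ B * √(varInfo μ T P l) ^ 3 := by
  obtain ⟨C, hC, h3⟩ := h.exists_thirdMoment_le (Cv := σ2 + Cv) hCψ hp hψ (by positivity)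
    fun n hn => by
      have h1 := (abs_le.1 (hv n hn)).2
      have hn1 : (1 : ℝ) ≤ n := by exact_mod_cast hn
      have h2 : (n : ℝ) ^ (5 / 6 : ℝ) ≤ n := by
        simpa using Real.rpow_le_rpow_of_exponent_le hn1 (by norm_num : (5 / 6 : ℝ) ≤ 1)
      have h4 : Cv * (n : ℝ) ^ (5 / 6 : ℝ) ≤ Cv * n := by gcongr
      linarith
  have hlim : Tendsto (fun l : ℕ => Cv * (l : ℝ) ^ (-(1 / 6) : ℝ)) atTop (𝓝 (Cv * 0)) :=
    ((tendsto_rpow_neg_atTop (by norm_num : (0 : ℝ) < 1 / 6)).comp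
      tendsto_natCast_atTop_atTop).const_mul Cv
  rw [mul_zero] at hlim
  refine ⟨C * (√(2 / σ2)) ^ 3, by positivity, ?_⟩
  filter_upwards [hlim.eventually_le_const (half_pos hσ), eventually_gt_atTop 0] with l hl hl0
  have hl1 : (0 : ℝ) < l := by exact_mod_cast hl0
  have h1 := (abs_le.1 (hv l hl0)).1
  have h2 : (l : ℝ) ^ (5 / 6 : ℝ) = (l : ℝ) ^ (-(1 / 6) : ℝ) * l := by
    nth_rewrite 3 [← Real.rpow_one (l : ℝ)]
    rw [← Real.rpow_add hl1]
    norm_num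
  have h4 : l * σ2 / 2 ≤ varInfo μ T P l := by
    rw [h2, ← mul_assoc] at h1
    have : Cv * (l : ℝ) ^ (-(1 / 6) : ℝ) * l ≤ σ2 / 2 * l := by gcongr
    linarith
  have h5 : 0 < varInfo μ T P l := lt_of_lt_of_le (by positivity) h4
  refine ⟨h5, (h3 l hl0).trans ?_⟩
  rw [mul_assoc, ← mul_pow, ← Real.sqrt_mul (by positivity)]
  have h6 : (l : ℝ) ^ (3 / 2 : ℝ) = √(l : ℝ) ^ 3 := by
    rw [Real.sqrt_eq_rpow, ← Real.rpow_natCast, ← Real.rpow_mul hl1.le]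
    norm_num
  rw [h6]
  gcongr
  rw [div_mul_eq_mul_div, le_div_iff₀ hσ]
  linarith

set_option maxHeartbeats 600000 in
/-- The rate of convergence, up to a logarithm. The number of blocks is about `n ^ (4 * κ)`, and
the gaps have length about `n ^ (2 / (p + 2))`. -/
lemma exists_abs_measureReal_wordInfo_le_sub_le {p Cψ σ2 Cv C₁ L κ : ℝ} (hp : 8 ≤ p) (hCψ : 0 ≤ Cψ)
    (hψ : ∀ d : ℕ, 0 < d → ψ d ≤ Cψ * (d : ℝ) ^ (-p)) (hσ : 0 < σ2) (hCv : 0 ≤ Cv)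
    (hv : ∀ n : ℕ, 0 < n → |varInfo μ T P n - n * σ2| ≤ Cv * (n : ℝ) ^ (5 / 6 : ℝ))
    (hC₁ : 0 ≤ C₁) (hL : ∀ n : ℕ, 0 < n → |meanInfo μ T P n - n * L| ≤ C₁ * (n : ℝ) ^ (1 / 3 : ℝ))
    (hκ0 : 0 < κ) (hκ : κ ≤ 1 / 10 - 3 / (5 * (p + 2))) :
    ∃ D : ℝ, 0 ≤ D ∧ ∀ᶠ n : ℕ in atTop, ∀ u : ℝ,
      |μ.real {x | wordInfo μ T P n x - n * L ≤ u} - normalDistribution (u / √(n * σ2))| ≤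
        D * ((1 + Real.log n) * (n : ℝ) ^ (-κ)) := by
  obtain ⟨B, hB0, hB⟩ := h.exists_thirdMoment_le_sqrt_cube hp hCψ hψ hσ hCv hv
  obtain ⟨l₀, hl₀⟩ := eventually_atTop.1 hB
  obtain ⟨a, ha⟩ : ∃ a, a = 2 / (p + 2) := ⟨_, rfl⟩
  have hp2 : 0 < p + 2 := by linarith
  have hap : a * (p + 2) = 2 := by rw [ha]; field_simp
  have ha0 : 0 < a := by rw [ha]; positivity
  have ha5 : a ≤ 1 / 5 := by
    rw [ha, div_le_div_iff₀ hp2 (by norm_num)]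
    linarith
  have hκ' : 5 * κ + 3 / 2 * a ≤ 1 / 2 := by
    have : 3 / (5 * (p + 2)) = 3 / 10 * a := by rw [ha]; field_simp; norm_num
    linarith
  obtain ⟨C₂, hC₂, h₂⟩ := h.integral_abs_gapDefect_pow_le_rpow (q := 1) (a := a) hCψ (by linarith)
    hψ ha0.le one_ne_zero (by push_cast; linarith)
  obtain ⟨C₃, hC₃, h₃⟩ := h.abs_meanInfo_add_right_sub_le
  set c := logCard ι with hcdef
  have hc : 0 ≤ c := logCard_nonneg
  have hsσ := Real.sqrt_pos.2 hσ
  refine ⟨(2 + 2 * Cψ + 1) + 1 + (2 * Cψ + 6 * (3 * B + 4) * 2) +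
    ((2 * (3 * c + 4 + C₂ + 2 * C₃) + C₁) + √(σ2 + Cv) * 2) / √σ2 +
    4 * ((σ2 + Cv) * 2 + Cv + 4 * σ2) / σ2, by positivity, ?_⟩
  filter_upwards [eventually_gt_atTop 0, eventually_ge_atTop ((2 + (l₀ + 1)) ^ 2)] with n hn hnl u
  obtain ⟨x, hxn⟩ : ∃ x : ℝ, x = n := ⟨_, rfl⟩
  have hx1 : 1 ≤ x := by rw [hxn]; exact_mod_cast hn
  have hx0 : 0 < x := by linarith
  set N := ⌊x ^ (4 * κ)⌋₊ with hN
  have hxθ : 1 ≤ x ^ (4 * κ) := Real.one_le_rpow hx1 (by linarith)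
  have hN1 : 1 ≤ N := Nat.le_floor (by exact_mod_cast hxθ)
  have hN1' : (1 : ℝ) ≤ N := by exact_mod_cast hN1
  have hNle : (N : ℝ) ≤ x ^ (4 * κ) := Nat.floor_le (by linarith)
  have hNge : x ^ (4 * κ) ≤ 16 * N := by
    have := (Nat.lt_floor_add_one (x ^ (4 * κ))).le
    rw [← hN] at this
    linarith
  set d := gapLength a n with hd
  have hd0 : 0 < d := gapLength_pos hn
  have hd1 : (1 : ℝ) ≤ d := by exact_mod_cast hd0
  have hdge : x ^ a ≤ d := by rw [hxn]; exact rpow_le_gapLength a n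
  have hdle : (d : ℝ) ≤ 2 * x ^ a := by rw [hxn]; exact gapLength_le ha0.le hn
  have hxa : 1 ≤ x ^ a := Real.one_le_rpow hx1 ha0.le
  have hθa : x ^ (4 * κ) * x ^ a ≤ √x := by
    rw [← Real.rpow_add hx0, Real.sqrt_eq_rpow]
    exact Real.rpow_le_rpow_of_exponent_le hx1 (by linarith)
  -- the blocks have length at least `l₀ + 1`
  have hlen : d + (l₀ + 1) ≤ n / N := by
    rw [Nat.le_div_iff_mul_le (by omega)]
    have h1 : ((d : ℝ) + (l₀ + 1)) * N ≤ n := by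
      rw [← hxn]
      have h2 : (2 + ((l₀ : ℝ) + 1)) ≤ √x := by
        refine Real.le_sqrt_of_sq_le ?_
        rw [hxn]; exact_mod_cast hnl
      calc ((d : ℝ) + (l₀ + 1)) * N ≤ (2 * x ^ a + (l₀ + 1) * x ^ a) * x ^ (4 * κ) := by
            gcongr
            exact le_mul_of_one_le_right (by positivity) hxa
        _ = (2 + (l₀ + 1)) * (x ^ (4 * κ) * x ^ a) := by ring
        _ ≤ √x * √x := by gcongr
        _ = x := Real.mul_self_sqrt hx0.le
    exact_mod_cast h1
  obtain ⟨l, hl⟩ : ∃ l, n / N = l + d := ⟨n / N - d, by omega⟩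
  have hl0 : 0 < l := by omega
  obtain ⟨k, hk⟩ : ∃ k, N = k + 1 := ⟨N - 1, by omega⟩
  have hmod : n % N < N := Nat.mod_lt _ (by omega)
  have hdm := Nat.div_add_mod n N
  rw [hl] at hdm
  set r := n % N + d with hr
  have hnr : n = k * (l + d) + l + r := by
    have : N * (l + d) = k * (l + d) + (l + d) := by rw [hk]; ring
    omega
  have hln : l ≤ n := by omega
  obtain ⟨hvpos, hBl⟩ := hl₀ l (by omega)
  set v := varInfo μ T P l with hvdef
  have hη := abs_block_mean_sub_le h hl0 hnr (by omega) (hL n hn) (C₂ := C₂)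
    (e₂ := (n : ℝ) ^ a) (fun m hm => by
      rw [h.meanInfo_gap]
      have := (h.abs_integral_gapDefect_le m d l).trans (h₂ n m l hn hm hl0 hln)
      simpa using this) h₃
  have hlog : 0 ≤ Real.log x := Real.log_nonneg hx1
  have hmain := h.abs_measureReal_wordInfo_le_sub_le hl0 hd0 hnr (s := Real.log x)
    (K := Real.log x) (V := n * σ2) hlog (by rw [← hxn]; positivity) hη hlog
    (by rw [← hxn]; positivity) hvpos hBl u
  have hexp : Real.exp (-Real.log x) = 1 / x := by rw [Real.exp_neg, Real.exp_log hx0, one_div]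
  rw [← hk, ← hvdef, hexp, ← hxn] at hmain
  rw [← hxn]
  refine hmain.trans ?_
  obtain ⟨y, hy⟩ : ∃ y, y = x ^ (-κ) := ⟨_, rfl⟩
  have hy0 : 0 < y := hy ▸ Real.rpow_pos_of_pos hx0 _
  obtain ⟨Λ, hΛ⟩ : ∃ Λ, Λ = 1 + Real.log x := ⟨_, rfl⟩
  rw [← hy, ← hΛ]
  have hΛ1 : 1 ≤ Λ := by linarith
  have hkN : (k : ℝ) ≤ N := by rw [hk]; push_cast; linarith
  set G : ℝ := N * d with hG
  have hG1 : 1 ≤ G := one_le_mul_of_one_le_of_one_le hN1' hd1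
  have hdG : (d : ℝ) ≤ G := le_mul_of_one_le_left (by positivity) hN1'
  have hNG : (N : ℝ) ≤ G := le_mul_of_one_le_right (by positivity) hd1
  have hr2 : (r : ℝ) ≤ 2 * G := by
    have : (r : ℝ) ≤ N + d := by exact_mod_cast (by omega : r ≤ N + d)
    linarith
  -- all error terms are at most `y = x ^ (-κ)`, up to constants and logarithms
  have hNl : (N : ℝ) * l ≤ x := by
    rw [hxn]
    have : N * l ≤ n := (Nat.mul_le_mul_left N (by omega : l ≤ l + d)).trans (by omega)
    exact_mod_cast this
  obtain ⟨g1, g2, g4, g5, g6, g7⟩ := block_rates hx1 ha0 hκ0 hκ' (by linarith) hap hCψ hN1' hNle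
    hNge hdge hdle (Nat.cast_nonneg l) hNl (hψ d hd0)
  rw [← hy] at g1 g2 g4 g5 g6 g7
  rw [← hG] at g5
  have g8 : 1 / √(N : ℝ) ≤ 2 * y := by
    refine le_trans ?_ g4
    have : 1 ≤ √(N : ℝ) := Real.one_le_sqrt.2 hN1'
    refine one_div_le_one_div_of_le (by positivity) ?_
    exact Real.sqrt_le_iff.2 ⟨by positivity, le_self_pow₀ this two_ne_zero⟩
  have hsx1 : 1 ≤ √x := Real.one_le_sqrt.2 hx1
  have g9 : G ≤ 2 * (x * y) := by
    refine g5.trans ?_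
    have : √x ≤ x := Real.sqrt_le_iff.2 ⟨hx0.le, le_self_pow₀ hx1 two_ne_zero⟩
    gcongr
  have hvl : v ≤ (σ2 + Cv) * l := by
    have e1 := (abs_le.1 (hv l hl0)).2
    have hl1 : (1 : ℝ) ≤ l := by exact_mod_cast hl0
    have e2 : (l : ℝ) ^ (5 / 6 : ℝ) ≤ l := by
      simpa using Real.rpow_le_rpow_of_exponent_le hl1 (by norm_num : (5 / 6 : ℝ) ≤ 1)
    have e3 : Cv * (l : ℝ) ^ (5 / 6 : ℝ) ≤ Cv * l := by gcongr
    linarith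
  have hvN : v * √(N : ℝ) ≤ (σ2 + Cv) * (x / √(N : ℝ)) := by
    have e1 : l * √(N : ℝ) ≤ x / √(N : ℝ) := by
      rw [le_div_iff₀ (by positivity), mul_assoc, Real.mul_self_sqrt (by positivity)]
      linarith
    calc v * √(N : ℝ) ≤ (σ2 + Cv) * l * √(N : ℝ) := by gcongr
      _ = (σ2 + Cv) * (l * √(N : ℝ)) := by ring
      _ ≤ _ := by gcongr
  have t1 : k * (2 * (1 / x) + 2 * ψ d) + 1 / x ≤ (2 + 2 * Cψ + 1) * y := by
    have e1 : (N : ℝ) * (1 / x) ≤ y := by rw [mul_one_div, div_le_iff₀ hx0]; linarith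
    have e2 : 1 / x ≤ y := by rw [div_le_iff₀ hx0]; linarith
    have e3 : k * (2 * (1 / x) + 2 * ψ d) ≤ N * (2 * (1 / x) + 2 * ψ d) := by
      have := h.psi_nonneg d
      gcongr
    linarith
  have t2 : normalDistribution (-Real.log x) ≤ 1 * y := by
    refine (normalDistribution_neg_le _).trans ?_
    rw [hexp, div_le_iff₀ hx0]
    linarith
  have t3 : 2 * ψ d * N + 6 * (3 * B + 4) / √√(N : ℝ) ≤ (2 * Cψ + 6 * (3 * B + 4) * 2) * y := by
    have e1 : 6 * (3 * B + 4) / √√(N : ℝ) = 6 * (3 * B + 4) * (1 / √√(N : ℝ)) := by ring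
    have e2 : 6 * (3 * B + 4) * (1 / √√(N : ℝ)) ≤ 6 * (3 * B + 4) * (2 * y) := by gcongr
    rw [e1]
    linarith
  have t4 : (k * (d * c + 2 * Real.log x + Real.log 2) + (r * c + Real.log x) +
      (C₁ * x ^ (1 / 3 : ℝ) + k * (C₂ * x ^ a) + C₃ * r) + Real.log x * √(v * √(N : ℝ))) /
        √(x * σ2) ≤ ((2 * (3 * c + 4 + C₂ + 2 * C₃) + C₁) + √(σ2 + Cv) * 2) / √σ2 * (Λ * y) := by
    rw [Real.sqrt_mul hx0.le, hΛ]
    refine centring_error_le hx1 hy0 hc hC₁ hC₂ hC₃ hd1 hkN k.cast_nonneg hG hG1 hr2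
      (by positivity) hdge hsσ g5 g6 ?_ (Real.sqrt_nonneg _)
    calc √(v * √(N : ℝ)) ≤ √(σ2 + Cv) * (√x * (1 / √√(N : ℝ))) := by
          refine (Real.sqrt_le_sqrt hvN).trans (le_of_eq ?_)
          rw [Real.sqrt_mul (by positivity), Real.sqrt_div hx0.le, mul_one_div]
      _ ≤ _ := by gcongr
  have t5 : 4 * |(v * √(N : ℝ) + N * v) - x * σ2| / (x * σ2) ≤
      4 * ((σ2 + Cv) * 2 + Cv + 4 * σ2) / σ2 * y := by
    refine variance_error_le hx0 hσ hCv (by positivity) (by positivity) ?_ (hv l hl0) g7 hG g9 hNG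
      hNl (t := (n % N : ℕ)) (by rw [hxn]; exact_mod_cast hdm.symm) (by exact_mod_cast hmod.le)
    have : x / √(N : ℝ) ≤ x * (2 * y) := by
      rw [div_eq_mul_one_div]; gcongr
    calc v * √(N : ℝ) ≤ (σ2 + Cv) * (x * (2 * y)) := hvN.trans (by gcongr)
      _ = _ := by ring
  have hyΛ : y ≤ Λ * y := le_mul_of_one_le_left hy0.le hΛ1
  have hsum : ∀ {A : ℝ}, 0 ≤ A → A * y ≤ A * (Λ * y) := fun hA =>
    mul_le_mul_of_nonneg_left hyΛ hA
  have s1 := t1.trans (hsum (by positivity))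
  have s2 := t2.trans (hsum (by positivity))
  have s3 := t3.trans (hsum (by positivity))
  have s5 := t5.trans (hsum (by positivity))
  refine (add_le_add (add_le_add (add_le_add (add_le_add s1 s2) s3) t4) s5).trans (le_of_eq ?_)
  ring

end IsMixingSystem

end Rate

/-! ### The central limit theorem with rate -/

section Conclusion

variable {Ω ι : Type*} [MeasurableSpace Ω] {μ : Measure Ω} [IsProbabilityMeasure μ]
  [Fintype ι] [MeasurableSpace ι] [MeasurableSingletonClass ι] {T : Ω → Ω} {P : Ω → ι} {ψ : ℕ → ℝ}

lemma exists_le_mul_rpow_of_isBigO {ψ : ℕ → ℝ} {p : ℝ}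
    (h : ψ =O[atTop] fun Δ : ℕ => (Δ : ℝ) ^ (-p)) :
    ∃ C : ℝ, 0 ≤ C ∧ ∀ d : ℕ, 0 < d → ψ d ≤ C * (d : ℝ) ^ (-p) := by
  obtain ⟨C, hC, hC'⟩ := bound_of_isBigO_nat_atTop h
  refine ⟨C, hC.le, fun d hd => ?_⟩
  have h1 : 0 < (d : ℝ) ^ (-p) := Real.rpow_pos_of_pos (by exact_mod_cast hd) _
  have h2 := hC' h1.ne'
  rw [Real.norm_of_nonneg h1.le] at h2
  exact (le_abs_self _).trans h2

lemma tendsto_div_of_abs_sub_le {f : ℕ → ℝ} {L C a : ℝ} (ha : a < 1)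
    (h : ∀ n : ℕ, 0 < n → |f n - n * L| ≤ C * (n : ℝ) ^ a) :
    Tendsto (fun n : ℕ => f n / n) atTop (𝓝 L) := by
  have hlim : Tendsto (fun n : ℕ => C * (n : ℝ) ^ (-(1 - a))) atTop (𝓝 (C * 0)) :=
    ((tendsto_rpow_neg_atTop (by linarith : 0 < 1 - a)).comp
      tendsto_natCast_atTop_atTop).const_mul C
  rw [mul_zero] at hlim
  rw [tendsto_iff_norm_sub_tendsto_zero]
  refine squeeze_zero' (Eventually.of_forall fun n => norm_nonneg _) ?_ hlim
  filter_upwards [eventually_gt_atTop 0] with n hn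
  have hn0 : (0 : ℝ) < n := by exact_mod_cast hn
  have e : f n / n - L = (f n - n * L) / n := by field_simp
  rw [e, Real.norm_eq_abs, abs_div, Nat.abs_cast, div_le_iff₀ hn0, mul_assoc]
  have e2 : (n : ℝ) ^ (-(1 - a)) * n = (n : ℝ) ^ a := by
    rw [← Real.rpow_add_one hn0.ne']
    ring_nf
  rw [e2]
  exact h n hn

namespace IsMixingSystem

variable (h : IsMixingSystem μ T P ψ)
include h

/-- The rate in the central limit theorem. The logarithm is absorbed by a smaller exponent, and
small `n` by the constant. -/
lemma exists_clt_rate {p σ Cv C₁ L κ : ℝ} (hp : 8 ≤ p)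
    (hψ : ψ =O[atTop] fun Δ : ℕ => (Δ : ℝ) ^ (-p)) (hσ : 0 < σ) (hCv : 0 ≤ Cv)
    (hv : ∀ n : ℕ, 0 < n → |varInfo μ T P n - n * σ ^ 2| ≤ Cv * (n : ℝ) ^ (5 / 6 : ℝ))
    (hC₁ : 0 ≤ C₁) (hL : ∀ n : ℕ, 0 < n → |meanInfo μ T P n - n * L| ≤ C₁ * (n : ℝ) ^ (1 / 3 : ℝ))
    (hκ : κ < 1 / 10 - 3 / (5 * (p + 2))) :
    ∃ C : ℝ, ∀ n : ℕ, 0 < n → ∀ t : ℝ,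
      |μ.real {x | (wordInfo μ T P n x - n * L) / (σ * √(n : ℝ)) ≤ t} - normalDistribution t| ≤
        C * (n : ℝ) ^ (-κ) := by
  obtain ⟨Cψ, hCψ, hψ'⟩ := exists_le_mul_rpow_of_isBigO hψ
  have hb : 0 < 1 / 10 - 3 / (5 * (p + 2)) := by
    rw [sub_pos, div_lt_div_iff₀ (by linarith) (by norm_num)]
    linarith
  obtain ⟨κ', hκ1, hκ2⟩ := exists_between (max_lt hκ hb)
  obtain ⟨hκ3, hκ4⟩ := max_lt_iff.1 hκ1
  obtain ⟨D, hD0, hD⟩ := h.exists_abs_measureReal_wordInfo_le_sub_le (σ2 := σ ^ 2) hp hCψ hψ'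
    (by positivity) hCv hv hC₁ hL hκ4 hκ2.le
  obtain ⟨F, hF⟩ : ∃ F : ℕ → ℝ → ℝ, F = fun n t =>
    |μ.real {x | (wordInfo μ T P n x - n * L) / (σ * √(n : ℝ)) ≤ t} - normalDistribution t| :=
    ⟨_, rfl⟩
  have hF0 : ∀ n t, 0 ≤ F n t := fun n t => by rw [hF]; exact abs_nonneg _
  have hF1 : ∀ n t, F n t ≤ 1 := fun n t => by
    rw [hF, abs_le]
    have h1 := normalDistribution_nonneg t
    have h2 := normalDistribution_le_one t
    have h3 := measureReal_nonneg (μ := μ)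
      (s := {x | (wordInfo μ T P n x - n * L) / (σ * √(n : ℝ)) ≤ t})
    have h4 := measureReal_le_one (μ := μ)
      (s := {x | (wordInfo μ T P n x - n * L) / (σ * √(n : ℝ)) ≤ t})
    constructor <;> linarith
  have hO : (fun n => ⨆ t, F n t) =O[atTop] fun n : ℕ => (n : ℝ) ^ (-κ) := by
    refine IsBigO.of_bound (D * (1 + 1 / (κ' - κ))) ?_
    filter_upwards [hD, eventually_gt_atTop 0] with n hDn hn
    have hn0 : (0 : ℝ) < n := by exact_mod_cast hn
    have hn1 : (1 : ℝ) ≤ n := by exact_mod_cast hn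
    have hs : 0 < √(n : ℝ) := Real.sqrt_pos.2 hn0
    have hδ : 0 < κ' - κ := by linarith
    have h1 : 1 + Real.log n ≤ (1 + 1 / (κ' - κ)) * (n : ℝ) ^ (κ' - κ) := by
      have e1 := Real.log_le_rpow_div hn0.le hδ
      have e2 := Real.one_le_rpow hn1 hδ.le
      calc 1 + Real.log n ≤ (n : ℝ) ^ (κ' - κ) + (n : ℝ) ^ (κ' - κ) / (κ' - κ) := by linarith
        _ = _ := by ring
    rw [Real.norm_of_nonneg (Real.iSup_nonneg (hF0 n)),
      Real.norm_of_nonneg (Real.rpow_nonneg hn0.le _)]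
    refine ciSup_le fun t => ?_
    have h2 := hDn (t * (σ * √(n : ℝ)))
    have h3 : √(n * σ ^ 2) = σ * √(n : ℝ) := by
      rw [Real.sqrt_mul hn0.le, Real.sqrt_sq hσ.le, mul_comm]
    rw [h3, mul_div_cancel_right₀ _ (by positivity)] at h2
    simp only [hF, div_le_iff₀ (mul_pos hσ hs)]
    refine h2.trans ?_
    rw [mul_assoc D]
    refine mul_le_mul_of_nonneg_left ?_ hD0
    calc (1 + Real.log n) * (n : ℝ) ^ (-κ') ≤
          (1 + 1 / (κ' - κ)) * (n : ℝ) ^ (κ' - κ) * (n : ℝ) ^ (-κ') := by gcongr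
      _ = _ := by
          rw [mul_assoc, ← Real.rpow_add hn0]
          ring_nf
  obtain ⟨C, hC, hC'⟩ := bound_of_isBigO_nat_atTop hO
  refine ⟨C, fun n hn t => ?_⟩
  have hn0 : (0 : ℝ) < (n : ℝ) ^ (-κ) := Real.rpow_pos_of_pos (by exact_mod_cast hn) _
  have h1 := hC' hn0.ne'
  rw [Real.norm_of_nonneg hn0.le] at h1
  refine le_trans ?_ ((le_abs_self _).trans h1)
  have := le_ciSup (f := F n) ⟨1, by rintro _ ⟨s, rfl⟩; exact hF1 n s⟩ t
  rwa [hF] at this ⊢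

lemma varInfo_eq (n : ℕ) :
    varInfo μ T P n = ∫ x, wordInfo μ T P n x ^ 2 ∂μ - meanInfo μ T P n ^ 2 := by
  have e : ∀ x, centred μ T P n x ^ 2 = wordInfo μ T P n x ^ 2 -
      (2 * meanInfo μ T P n * wordInfo μ T P n x - meanInfo μ T P n ^ 2) := fun x => by
    rw [centred]; ring
  have hw := h.finiteValued_wordInfo n
  simp only [varInfo, e]
  rw [(hw.pow 2).integral_sub ((hw.const_mul _).sub (FiniteValued.const _)),
    (hw.const_mul _).integral_sub (FiniteValued.const _), integral_const_mul, ← meanInfo]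
  simp only [integral_const, probReal_univ, one_smul]
  ring

end IsMixingSystem

end Conclusion

end InfoCLT

theorem mainTheorem7 {Ω : Type*} [MeasurableSpace Ω] [StandardBorelSpace Ω]
    (μ : Measure Ω) [IsProbabilityMeasure μ] (T : Ω → Ω) (hT : MeasurePreserving T μ μ)
    (k : ℕ) (P : Ω → Fin k) (hP : Measurable P) (hgen : InfoCLT.IsGenerating T P)
    (ψ : ℕ → ℝ) (hmix : InfoCLT.IsUniformlyStrongMixing T μ P ψ)
    (p : ℝ) (hp : 8 < p) (hψ : ψ =O[atTop] fun Δ : ℕ => (Δ : ℝ) ^ (-p)) :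
    InfoCLT.metricEntropy T μ ≠ ∞ ∧
    ∃ σ : ℝ, 0 ≤ σ ∧
      Tendsto
        (fun n : ℕ => (InfoCLT.infoMoment T μ P 2 n - InfoCLT.joinEntropy T μ P n ^ 2) / n)
        atTop (𝓝 (σ ^ 2)) ∧
      (0 < σ →
        (∀ κ : ℝ, κ < 1 / 10 - 3 / (5 * (p + 2)) →
          ∃ C : ℝ, ∀ n : ℕ, 0 < n → ∀ t : ℝ,
            |InfoCLT.infoDistribution T μ P σ n t - InfoCLT.normalDistribution t|
              ≤ C * (n : ℝ) ^ (-κ)) ∧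
        ((∀ q : ℝ, ψ =O[atTop] fun Δ : ℕ => (Δ : ℝ) ^ (-q)) →
          ∀ κ : ℝ, κ < 1 / 10 →
            ∃ C : ℝ, ∀ n : ℕ, 0 < n → ∀ t : ℝ,
              |InfoCLT.infoDistribution T μ P σ n t - InfoCLT.normalDistribution t|
                ≤ C * (n : ℝ) ^ (-κ))) := by
  have h : InfoCLT.IsMixingSystem μ T P ψ := ⟨hT, hP, hmix⟩
  obtain ⟨Cψ, hCψ, hψ'⟩ := InfoCLT.exists_le_mul_rpow_of_isBigO hψ
  obtain ⟨L, C₁, hC₁, hL⟩ := h.exists_meanInfo_linear hCψ hp.le hψ'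
  obtain ⟨V, Cv, hCv, hV⟩ := h.exists_varInfo_linear hCψ hp.le hψ'
  have hLlim := InfoCLT.tendsto_div_of_abs_sub_le (by norm_num) hL
  have hVlim := InfoCLT.tendsto_div_of_abs_sub_le (by norm_num) hV
  have hL0 : 0 ≤ L := ge_of_tendsto' hLlim fun n =>
    div_nonneg (InfoCLT.meanInfo_nonneg n) n.cast_nonneg
  have hV0 : 0 ≤ V := ge_of_tendsto' hVlim fun n =>
    div_nonneg (InfoCLT.varInfo_nonneg n) n.cast_nonneg
  have hent := InfoCLT.metricEntropy_eq hT hP hgen hLlim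
  rw [← Real.sq_sqrt hV0] at hVlim hV
  refine ⟨by rw [hent]; exact ENNReal.ofReal_ne_top, √V, Real.sqrt_nonneg _, ?_, fun hσ => ?_⟩
  · refine hVlim.congr fun n => ?_
    have h2 := InfoCLT.infoMoment_eq_integral (μ := μ) hT.measurable hP 2 n
    rw [Nat.cast_ofNat] at h2
    rw [h2, InfoCLT.joinEntropy_eq_meanInfo hT.measurable hP, h.varInfo_eq]
  · have hdist : ∀ n t, InfoCLT.infoDistribution T μ P (√V) n t =
        μ.real {x | (InfoCLT.wordInfo μ T P n x - n * L) / (√V * √(n : ℝ)) ≤ t} := fun n t => by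
      rw [InfoCLT.infoDistribution, hent, ENNReal.toReal_ofReal hL0, InfoCLT.information_eq_info]
      rfl
    simp only [hdist]
    refine ⟨fun κ hκ => h.exists_clt_rate hp.le hψ hσ hCv hV hC₁ hL hκ, fun hψq κ hκ => ?_⟩
    -- a large power `q` brings `1 / 10 - 3 / (5 * (q + 2))` above `κ`
    obtain ⟨δ, hδ⟩ : ∃ δ, δ = 1 / 10 - κ := ⟨_, rfl⟩
    have hδ0 : 0 < δ := by linarith
    have h0 : 0 < 1 / δ := by positivity
    refine h.exists_clt_rate (p := 8 + 1 / δ) (by linarith) (hψq _) hσ hCv hV hC₁ hL ?_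
    have h1 : 3 / (5 * (8 + 1 / δ + 2)) < δ := by
      rw [div_lt_iff₀ (by positivity)]
      have : δ * (5 * (8 + 1 / δ + 2)) = 50 * δ + 5 := by
        field_simp
        ring
      linarith
    linarith
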